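/- Let $M$ be a (not necessarily compact, Hausdorff, $\sigma$-compact) Kähler manifold of complex dimension $n$ with complex structure $J$, Kähler metric $g$ and closed Kähler form $\omega(u,v)=g(Ju,v)$, oriented by its complex structure. Let $X$ be a real vector field on $M$ which is Killing ($L_Xg=0$) and holomorphic ($X^{1,0}$ is a holomorphic section of $T^{1,0}M$), where $X=X^{1,0}+X^{0,1}$ is the decomposition into types. Let $K\subseteq M$ be a compact subset such that $X$ has no zeros on the topological boundary $\partial K$ and such that the zeros of $X$ in $K$ are isolated (for compact $M$ one may take $K=M$). Put $K_X=\{p\in K\mid X_p=0\}$, a finite set. Set $$\partial_X=\partial-2\pi i\,\iota_{X^{0,1}},\qquad \bar\partial_X=\bar\partial-2\pi i\,\iota_{X^{1,0}},$$ and, for $t>0$, $$d_t=\frac{\omega}{2\pi t}\exp\left(\frac{\bar\partial_X\partial_X}{2\pi i t}\,\frac{-\omega}{2\pi}\right).$$ For $p\in K_X$ let $m_p\in\mathrm{End}_{\mathbb C}(T_pM)$ be the moment map $\nabla_X-L_X$ of $TM$ at $p$, i.e. the linearization of $X$ at $p$, and put $$(c_{\mathrm{top},X}^{-1})'(TM)_p=\left.\frac{\partial}{\partial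 b}\right|_{b=0}\det(m_p+b\,\mathrm{id})^{-1}.$$ Then for every smooth complex-valued differential form $\eta$ on $M$ of mixed degree (not necessarily closed under $d_X=d-2\pi i\,\iota_X$), with degree zero part $\eta^{[0]}$, $$\int_K\eta\wedge d_t=\sum_{p\in K_X}\eta^{[0]}(p)\,(c_{\mathrm{top},X}^{-1})'(TM)_p+O(t)\qquad(t\to0^+).$$ -/

import Mathlib

open Set Filter MeasureTheory
open scoped Manifold ContDiff Topology

noncomputable section

namespace KahlerForms

/-! ### Exterior algebra of one real vector space, with complex coefficients -/

section Pointwise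

variable {V : Type*} [AddCommGroup V] [Module ℝ V] [TopologicalSpace V]

/-- The wedge product of complex valued alternating forms, the sum over shuffles of
`± α (v_σ(1), …) * β (v_σ(k+1), …)`; thus `(α ∧ β) (u, v) = α u * β v - α v * β u` in degrees
`(1, 1)`. -/
def wedge {k l m : ℕ} (h : k + l = m) (α : V [⋀^Fin k]→L[ℝ] ℂ) (β : V [⋀^Fin l]→L[ℝ] ℂ) :
    V [⋀^Fin m]→L[ℝ] ℂ :=
  { ((LinearMap.mul' ℝ ℂ).compAlternatingMap
      (α.toAlternatingMap.domCoprod β.toAlternatingMap)).domDomCongr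
        (finSumFinEquiv.trans (finCongr h)) with
    cont := by
      change Continuous fun v : Fin m → V => LinearMap.mul' ℝ ℂ
        ((∑ σ : Equiv.Perm.ModSumCongr (Fin k) (Fin l),
          AlternatingMap.domCoprod.summand α.toAlternatingMap β.toAlternatingMap σ)
          (fun i => v ((finSumFinEquiv.trans (finCongr h)) i)))
      simp only [_root_.sum_apply, map_sum]
      refine continuous_finsetSum _ fun σ _ => ?_
      induction σ using Quotient.inductionOn' with
      | h σ =>
        simp only [AlternatingMap.domCoprod.summand_mk'', _root_.smul_apply,
          MultilinearMap.domDomCongr_apply, MultilinearMap.domCoprod_apply]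
        simp only [map_zsmul_unit, LinearMap.mul'_apply]
        refine Continuous.const_smul (Continuous.mul ?_ ?_) _
        · exact α.cont.comp (continuous_pi fun i => continuous_apply _)
        · exact β.cont.comp (continuous_pi fun i => continuous_apply _) }

/-- The interior product: insert `u` into the first slot. -/
def interior {k : ℕ} (u : V) (α : V [⋀^Fin (k + 1)]→L[ℝ] ℂ) : V [⋀^Fin k]→L[ℝ] ℂ :=
  { α.toAlternatingMap.curryLeft u with
    cont := by
      change Continuous fun v : Fin k → V => α (Matrix.vecCons u v)
      exact α.cont.comp (continuous_const.matrixVecCons continuous_id) }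

end Pointwise

variable {E : Type*} [NormedAddCommGroup E] [NormedSpace ℂ E]
  {M : Type*} [TopologicalSpace M] [ChartedSpace E M]

/-- A complex manifold is in particular a real analytic manifold. -/
theorem isManifold_real [h : IsManifold 𝓘(ℂ, E) ω M] (m : ℕ∞ω) :
    IsManifold 𝓘(ℝ, E) m M := by
  have : IsManifold 𝓘(ℝ, E) ω M := by
    refine isManifold_of_contDiffOn 𝓘(ℝ, E) ω M fun e e' he he' => ?_
    have := (contDiffGroupoid ω 𝓘(ℂ, E)).compatible he he'
    rw [contDiffGroupoid, mem_groupoid_of_pregroupoid] at this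
    exact ContDiffOn.restrict_scalars ℝ this.1
  exact IsManifold.of_le le_top

instance [IsManifold 𝓘(ℂ, E) ω M] : IsManifold 𝓘(ℝ, E) 1 M := isManifold_real 1

instance [IsManifold 𝓘(ℂ, E) ω M] : IsManifold 𝓘(ℝ, E) ∞ M := isManifold_real ∞

/-! ### Differential forms -/

variable (E M) in
/-- Complex valued differential forms of degree `k` on the real manifold underlying `M`
(no regularity required). -/
abbrev DForm (k : ℕ) : Type _ := ∀ p : M, TangentSpace 𝓘(ℝ, E) p [⋀^Fin k]→L[ℝ] ℂ

variable (E M) in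
/-- Complex valued differential forms of mixed degree. -/
abbrev MForm : Type _ := ∀ k : ℕ, DForm E M k

variable (E M) in
/-- Real vector fields (no regularity required). -/
abbrev VField : Type _ := ∀ p : M, TangentSpace 𝓘(ℝ, E) p

/-- The differential at `y` of the parametrization of `M` by the inverse of the chart around `c`. -/
def frame (c : M) (y : E) : E →L[ℝ] TangentSpace 𝓘(ℝ, E) ((chartAt E c).symm y) :=
  mfderiv 𝓘(ℝ, E) 𝓘(ℝ, E) (chartAt E c).symm y

/-- A differential form in the coordinates of the chart around `c`: its pullback under the inverse
of the chart. -/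
def DForm.inChart {k : ℕ} (α : DForm E M k) (c : M) (y : E) : E [⋀^Fin k]→L[ℝ] ℂ :=
  (α ((chartAt E c).symm y)).compContinuousLinearMap (frame c y)

/-- A vector field in the coordinates of the chart around `c`. -/
def VField.inChart (X : VField E M) (c : M) (y : E) : E :=
  VectorField.mpullback 𝓘(ℝ, E) 𝓘(ℝ, E) (chartAt E c).symm X y

/-- Smooth forms. -/
def DForm.Smooth {k : ℕ} (α : DForm E M k) : Prop :=
  ∀ c : M, ContDiffOn ℝ ∞ (α.inChart c) (chartAt E c).target

/-- Smooth forms of mixed degree. -/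
def MForm.Smooth (α : MForm E M) : Prop := ∀ k, DForm.Smooth (α k)

/-- The exterior derivative at `p`, computed in the chart around `p`. -/
def DForm.extDer {k : ℕ} (α : DForm E M k) : DForm E M (k + 1) := fun p =>
  (extDeriv (α.inChart p) (chartAt E p p)).compContinuousLinearMap
    (mfderiv 𝓘(ℝ, E) 𝓘(ℝ, E) (chartAt E p) p)

/-- The complex structure on the tangent spaces: multiplication by `i` in a holomorphic chart. -/
def complexStructure (p : M) : TangentSpace 𝓘(ℝ, E) p →L[ℝ] TangentSpace 𝓘(ℝ, E) p :=
  (Complex.I • ContinuousLinearMap.id ℝ E : E →L[ℝ] E)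

namespace MForm

/-- A form of degree `k`, as a form of mixed degree. -/
def ofDegree (k : ℕ) (α : DForm E M k) : MForm E M :=
  Pi.single (M := fun j => DForm E M j) k α

/-- The wedge product of forms of mixed degree. -/
def mul (α β : MForm E M) : MForm E M := fun m p =>
  ∑ k : Fin (m + 1),
    wedge (Nat.add_sub_of_le (Nat.lt_succ_iff.mp k.isLt)) (α k p) (β (m - k) p)

/-- The constant function `1`. -/
def one : MForm E M :=
  ofDegree 0 fun _ => ContinuousAlternatingMap.constOfIsEmpty ℝ _ (Fin 0) 1

/-- Powers for the wedge product. -/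
def pow (α : MForm E M) : ℕ → MForm E M
  | 0 => one
  | m + 1 => mul α (pow α m)

/-- The value at `p` of the degree zero part. -/
def fn (α : MForm E M) (p : M) : ℂ := α 0 p ![]

/-- The part of positive degree. -/
def posPart (α : MForm E M) : MForm E M := Function.update α 0 0

/-- The exponential `exp α = exp (α_0) * ∑ m, (α - α_0) ^ m / m!`, where `α_0` is the degree zero
part (which is central). In degree `k` the terms with `m > k` vanish. -/
def exp (α : MForm E M) : MForm E M := fun k p =>
  Complex.exp (α.fn p) •
    ∑ m ∈ Finset.range (k + 1), ((m.factorial : ℂ)⁻¹) • (α.posPart.pow m) k p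

/-- The exterior derivative `d`. -/
def d (α : MForm E M) : MForm E M
  | 0 => 0
  | k + 1 => DForm.extDer (α k)

/-- The interior product with a real vector field. -/
def contract (X : VField E M) (α : MForm E M) : MForm E M := fun k p => interior (X p) (α (k + 1) p)

/-- `(J^* α) (v, …) = α (J v, …)`, which is `i ^ (p - q) α` on forms of type `(p, q)`. -/
def pullJ (α : MForm E M) : MForm E M := fun k p =>
  (α k p).compContinuousLinearMap (complexStructure p)

/-- The inverse of `pullJ`. -/
def pullJInv (α : MForm E M) : MForm E M := fun k p =>
  (α k p).compContinuousLinearMap (-complexStructure p)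

/-- `d^c = (J^*)⁻¹ d J^*`, which is `i (∂bar - ∂)`. -/
def dc (α : MForm E M) : MForm E M := pullJInv (d (pullJ α))

/-- The operator `∂ = (d + i d^c) / 2`, the part of bidegree `(1, 0)` of `d`. -/
def del (α : MForm E M) : MForm E M := (1 / 2 : ℂ) • (d α + Complex.I • dc α)

/-- The operator `∂bar = (d - i d^c) / 2`, the part of bidegree `(0, 1)` of `d`. -/
def delbar (α : MForm E M) : MForm E M := (1 / 2 : ℂ) • (d α - Complex.I • dc α)

/-- The interior product with `X^{1,0} = (X - i J X) / 2`. -/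
def contract10 (X : VField E M) (α : MForm E M) : MForm E M :=
  (1 / 2 : ℂ) • (contract X α - Complex.I • contract (fun p => complexStructure p (X p)) α)

/-- The interior product with `X^{0,1} = (X + i J X) / 2`. -/
def contract01 (X : VField E M) (α : MForm E M) : MForm E M :=
  (1 / 2 : ℂ) • (contract X α + Complex.I • contract (fun p => complexStructure p (X p)) α)

/-- `∂_X = ∂ - 2πi ι_{X^{0,1}}`. -/
def delX (X : VField E M) (α : MForm E M) : MForm E M :=
  del α - (2 * Real.pi * Complex.I) • contract01 X α

/-- `∂bar_X = ∂bar - 2πi ι_{X^{1,0}}`. -/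
def delbarX (X : VField E M) (α : MForm E M) : MForm E M :=
  delbar α - (2 * Real.pi * Complex.I) • contract10 X α

end MForm

/-! ### Integration -/

section Integration

variable (E) in
/-- A real basis `b_1, i b_1, b_2, i b_2, …` of `E`, positive for the complex orientation. -/
def realBasis [FiniteDimensional ℂ E] : Module.Basis (Fin (Module.finrank ℂ E * 2)) ℝ E :=
  (Complex.basisOneI.smulTower' (Module.finBasis ℂ E)).reindex finProdFinEquiv

/-- The integral over `K` of (the top degree part of) a form, for the complex orientation, computed
by means of a partition of unity `ρ` on `K`, where `ρ c` is supported in the domain of the chart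
around `c`: it is the sum over `c` of the integrals over `K` of `ρ c • α`, each one the Lebesgue
integral of the coefficient of `ρ c • α` with respect to oriented coordinates. -/
def integral [FiniteDimensional ℂ E] [MeasurableSpace E] [BorelSpace E] {K : Set M}
    (ρ : SmoothPartitionOfUnity M 𝓘(ℝ, E) M K) (α : MForm E M) : ℂ :=
  ∑ᶠ c : M, ∫ y in (chartAt E c).target ∩ (chartAt E c).symm ⁻¹' K,
    ((ρ c ((chartAt E c).symm y) : ℝ) : ℂ) *
      DForm.inChart (α (Module.finrank ℂ E * 2)) c y (realBasis E) ∂(realBasis E).addHaar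

end Integration

/-! ### Kähler metrics -/

variable (E M) in
/-- A smooth Riemannian metric for which the complex structure is orthogonal. -/
structure HermitianMetric [IsManifold 𝓘(ℂ, E) ω M] extends
    Bundle.ContMDiffRiemannianMetric 𝓘(ℝ, E) ∞ E (fun p : M => TangentSpace 𝓘(ℝ, E) p) where
  hermitian : ∀ (p : M) (u v : TangentSpace 𝓘(ℝ, E) p),
    inner p (complexStructure p u) (complexStructure p v) = inner p u v

namespace HermitianMetric

variable [IsManifold 𝓘(ℂ, E) ω M]

theorem inner_J_swap (g : HermitianMetric E M) (p : M) (u v : TangentSpace 𝓘(ℝ, E) p) :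
    g.inner p (complexStructure p u) v = - g.inner p (complexStructure p v) u := by
  have hJ : complexStructure p (complexStructure p u) = -u := by
    have h (w : E) : Complex.I • Complex.I • w = -w := by
      rw [smul_smul, Complex.I_mul_I, neg_one_smul]
    exact h u
  rw [← g.hermitian p (complexStructure p u) v, hJ, map_neg, neg_apply,
    g.symm p u]

/-- The Kähler form `ω(u, v) = g(J u, v)`. -/
def kahlerForm (g : HermitianMetric E M) : DForm E M 2 := fun p =>
  { toFun := fun v => ((g.inner p (complexStructure p (v 0)) (v 1) : ℝ) : ℂ)
    map_update_add' := by
      intro _ v i x y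
      fin_cases i <;> simp [Function.update]
    map_update_smul' := by
      intro _ v i c x
      fin_cases i <;> simp [Function.update]
    map_eq_zero_of_eq' := by
      intro v i j h hij
      have h01 : v 0 = v 1 := by
        fin_cases i <;> fin_cases j <;> simp_all
      have := g.inner_J_swap p (v 1) (v 1)
      have h0 : g.inner p (complexStructure p (v 1)) (v 1) = 0 := by linarith
      simp [h01, h0]
    cont := by
      have h1 : Continuous fun v : Fin 2 → TangentSpace 𝓘(ℝ, E) p =>
          g.inner p (complexStructure p (v 0)) (v 1) := by
        have h (B : E →L[ℝ] E →L[ℝ] ℝ) (L : E →L[ℝ] E) :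
            Continuous fun v : Fin 2 → E => B (L (v 0)) (v 1) := by fun_prop
        exact h (g.inner p) (complexStructure p)
      exact Complex.continuous_ofReal.comp h1 }

/-- The metric is Kähler if its Kähler form is closed. -/
def IsKahler (g : HermitianMetric E M) : Prop := ∀ p : M, g.kahlerForm.extDer p = 0

/-- The Kähler form, as a form of mixed degree. -/
def kahler (g : HermitianMetric E M) : MForm E M := MForm.ofDegree 2 g.kahlerForm

/-- The metric in the coordinates of the chart around `c`. -/
def inChart (g : HermitianMetric E M) (c : M) (y : E) (u v : E) : ℝ :=
  g.inner ((chartAt E c).symm y) (frame c y u) (frame c y v)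

/-- `X` is a Killing field: the Lie derivative `L_X g` vanishes, in coordinates
`X(g(u, v)) + g(DX u, v) + g(u, DX v) = 0`. -/
def IsKilling (g : HermitianMetric E M) (X : VField E M) : Prop :=
  ∀ c : M, ∀ y ∈ (chartAt E c).target, ∀ u v : E,
    fderiv ℝ (fun z => g.inChart c z u v) y (X.inChart c y)
      + g.inChart c y (fderiv ℝ (X.inChart c) y u) v
      + g.inChart c y u (fderiv ℝ (X.inChart c) y v) = 0

/-- The form `d_t = ω / (2πt) * exp (∂bar_X ∂_X / (2πit) (-ω / (2π)))`. -/
def dForm (g : HermitianMetric E M) (X : VField E M) (t : ℝ) : MForm E M :=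
  ((2 * Real.pi * t : ℂ)⁻¹ • g.kahler).mul
    (MForm.exp ((2 * Real.pi * Complex.I * t : ℂ)⁻¹ •
      MForm.delbarX X (MForm.delX X (-(2 * Real.pi : ℂ)⁻¹ • g.kahler))))

end HermitianMetric

/-- `X` is holomorphic: `X^{1,0}` is a holomorphic section of `T^{1,0}M`, which is `X` itself as
a section of the holomorphic tangent bundle. -/
def VField.IsHolomorphic [IsManifold 𝓘(ℂ, E) ω M] (X : VField E M) : Prop :=
  ContMDiff 𝓘(ℂ, E) 𝓘(ℂ, E).tangent ω
    (fun p : M => (⟨p, X p⟩ : TangentBundle 𝓘(ℂ, E) M))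

/-- At a zero `p` of the holomorphic field `X`, the moment map `m(X) = ∇_X - L_X` of the tangent
bundle, a complex linear endomorphism of the tangent space. There `∇_X Y` vanishes, so `m(X)` is
`Y ↦ [Y, X]`, the linearization of `X` at `p`. -/
def momentAtZero (X : VField E M) (p : M) : E →L[ℂ] E :=
  fderiv ℂ (X.inChart p) (chartAt E p p)

/-- The class `(c_top,X⁻¹)'(TM)` at an isolated zero `p` of `X`: the derivative at `b = 0` of
`c_top(-Ω / (2πi) + m(X) + b id)⁻¹`. The curvature `Ω` restricts to zero on the zero-dimensional
manifold of zeros, and `c_top` is the determinant. -/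
def cTopInvDeriv (X : VField E M) (p : M) : ℂ :=
  deriv (fun b : ℂ =>
    (LinearMap.det ((momentAtZero X p : E →ₗ[ℂ] E) + b • LinearMap.id))⁻¹) 0

end KahlerForms

end

/-!
Write `|X|²` for `g (X, X)` and `n` for the complex dimension. Since `ω` is closed, `∂_X` maps
`-ω / (2π)` to the form `i ι_{X^{0,1}} ω` of type `(1, 0)`, and `∂bar_X` of this form has only the
part `-π i |X|²` of degree zero and a part `beta` of type `(1, 1)`. Hence the top degree part of
`η ∧ d_t` is `exp (-|X|² / (2t))` times a polynomial in `1 / t` without constant term and of degree at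
most `n` (`mul_dForm_apply`), whose coefficients are smooth forms independent of `t`. As `t → 0`, the
integral concentrates at the zeros of `X`, where it is evaluated by Laplace's method.

The zeros are nondegenerate: along a geodesic starting at a zero in a direction of the kernel of the
linearization, a Killing field solves the Jacobi equation with vanishing initial data, so that it
vanishes and the zero is not isolated (`killing_zero_not_isolated`). Thus `|X|²` has a nondegenerate
minimum at each zero, with second order part `g (A u, A u)`, where `A` is the linearization. Taylor
expansion after the symmetrization `z ↦ -z` about the zero, which cancels the terms of odd order,
shows that replacing the integrand by its leading term costs `O (t ^ (n + 1))`, one full power of `t`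
more than the size `t ^ n` of the Gaussian integral (`exists_laplace_bound`). Multiplied by
`t ^ (-(m + 1))`, the contribution of a zero is therefore `O (t)` unless `m + 1 = n`, and in this case
it is the leading term up to `O (t)` (`exists_chart_bound`).

In the remaining term, of order `t ^ (-n)`, the form `ω ∧ beta ^ (n - 1)` has top degree, so that it
pairs with the part of `η` of degree zero only. At a zero `beta (u, v) = g (A u, v)` (`inChart_beta`),
and `A` is complex linear and skew-adjoint, so it has a unitary eigenbasis with eigenvalues `i a_j`
(`exists_unitary_eigenbasis`). On this basis `ω ∧ beta ^ (n - 1)` takes the value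
`(n - 1)! ∑ j, ∏_{k ≠ j} a_k`, and the Gaussian integral is `∏ j, 2πt / a_j²`. The product of the two
with the constants is the derivative of `det (A + b)⁻¹` at `b = 0` (`leading_term`).

The estimates are made in one chart at a time, against a function `r` supported in its domain
(`exists_chart_integral_bound`). A zero in several charts contributes to each of them with the weight
`r p`, and these weights sum to one for a partition of unity.
-/

noncomputable section

set_option linter.unusedSectionVars false
set_option maxSynthPendingDepth 3

namespace KahlerForms

/-! ### Wedge products at a point -/

section Wedge

variable {V : Type*} [AddCommGroup V] [Module ℝ V] [TopologicalSpace V]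

/-- The summand of `α ∧ β` which belongs to one shuffle, given as a coset of permutations. -/
def shuffleTerm {k l m : ℕ} (h : k + l = m) (α : V [⋀^Fin k]→L[ℝ] ℂ) (β : V [⋀^Fin l]→L[ℝ] ℂ)
    (v : Fin m → V) (s : Equiv.Perm.ModSumCongr (Fin k) (Fin l)) : ℂ :=
  LinearMap.mul' ℝ ℂ (AlternatingMap.domCoprod.summand α.toAlternatingMap β.toAlternatingMap s
    fun i => v ((finSumFinEquiv.trans (finCongr h)) i))

theorem shuffleTerm_mk {k l m : ℕ} (h : k + l = m) (α : V [⋀^Fin k]→L[ℝ] ℂ)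
    (β : V [⋀^Fin l]→L[ℝ] ℂ) (v : Fin m → V) (s : Equiv.Perm (Fin k ⊕ Fin l)) :
    shuffleTerm h α β v (Quotient.mk'' s) =
      Equiv.Perm.sign s •
        (α (fun i => v ((finSumFinEquiv.trans (finCongr h)) (s (Sum.inl i)))) *
          β (fun i => v ((finSumFinEquiv.trans (finCongr h)) (s (Sum.inr i))))) := by
  simp only [shuffleTerm, AlternatingMap.domCoprod.summand_mk'', _root_.smul_apply,
    MultilinearMap.domDomCongr_apply, MultilinearMap.domCoprod_apply]
  simp only [map_zsmul_unit, LinearMap.mul'_apply]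
  rfl

theorem shuffleTerm_eq {k l m : ℕ} (h : k + l = m) (α : V [⋀^Fin k]→L[ℝ] ℂ)
    (β : V [⋀^Fin l]→L[ℝ] ℂ) (v : Fin m → V) (s : Equiv.Perm.ModSumCongr (Fin k) (Fin l)) :
    shuffleTerm h α β v s =
      Equiv.Perm.sign s.out •
        (α (fun i => v ((finSumFinEquiv.trans (finCongr h)) (s.out (Sum.inl i)))) *
          β (fun i => v ((finSumFinEquiv.trans (finCongr h)) (s.out (Sum.inr i))))) := by
  rw [← shuffleTerm_mk]
  congr 1
  exact (Quotient.out_eq' s).symm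

theorem wedge_apply {k l m : ℕ} (h : k + l = m) (α : V [⋀^Fin k]→L[ℝ] ℂ)
    (β : V [⋀^Fin l]→L[ℝ] ℂ) (v : Fin m → V) :
    wedge h α β v = ∑ s, shuffleTerm h α β v s := by
  change LinearMap.mul' ℝ ℂ ((∑ s : Equiv.Perm.ModSumCongr (Fin k) (Fin l),
          AlternatingMap.domCoprod.summand α.toAlternatingMap β.toAlternatingMap s)
          (fun i => v ((finSumFinEquiv.trans (finCongr h)) i))) = _
  simp only [_root_.sum_apply, map_sum]
  rfl

/-- The wedge product, with one representative chosen for each shuffle. -/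
theorem wedge_apply_out {k l m : ℕ} (h : k + l = m) (α : V [⋀^Fin k]→L[ℝ] ℂ)
    (β : V [⋀^Fin l]→L[ℝ] ℂ) (v : Fin m → V) :
    wedge h α β v = ∑ s : Equiv.Perm.ModSumCongr (Fin k) (Fin l), Equiv.Perm.sign s.out •
        (α (fun i => v ((finSumFinEquiv.trans (finCongr h)) (s.out (Sum.inl i)))) *
          β (fun i => v ((finSumFinEquiv.trans (finCongr h)) (s.out (Sum.inr i))))) := by
  simp only [wedge_apply, shuffleTerm_eq]

theorem wedge_smul_left {k l m : ℕ} (h : k + l = m) (c : ℂ) (α : V [⋀^Fin k]→L[ℝ] ℂ)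
    (β : V [⋀^Fin l]→L[ℝ] ℂ) : wedge h (c • α) β = c • wedge h α β := by
  ext v
  simp only [wedge_apply_out, ContinuousAlternatingMap.smul_apply, smul_eq_mul, Units.smul_def,
    zsmul_eq_mul, Finset.mul_sum]
  exact Finset.sum_congr rfl fun s _ => by ring

theorem wedge_smul_right {k l m : ℕ} (h : k + l = m) (c : ℂ) (α : V [⋀^Fin k]→L[ℝ] ℂ)
    (β : V [⋀^Fin l]→L[ℝ] ℂ) : wedge h α (c • β) = c • wedge h α β := by
  ext v
  simp only [wedge_apply_out, ContinuousAlternatingMap.smul_apply, smul_eq_mul, Units.smul_def,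
    zsmul_eq_mul, Finset.mul_sum]
  exact Finset.sum_congr rfl fun s _ => by ring

theorem wedge_zero_left {k l m : ℕ} (h : k + l = m) (β : V [⋀^Fin l]→L[ℝ] ℂ) :
    wedge h (0 : V [⋀^Fin k]→L[ℝ] ℂ) β = 0 := by
  ext v
  simp [wedge_apply_out]

theorem wedge_zero_right {k l m : ℕ} (h : k + l = m) (α : V [⋀^Fin k]→L[ℝ] ℂ) :
    wedge h α (0 : V [⋀^Fin l]→L[ℝ] ℂ) = 0 := by
  ext v
  simp [wedge_apply_out]

theorem wedge_compContinuousLinearMap {W : Type*} [AddCommGroup W] [Module ℝ W]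
    [TopologicalSpace W] {k l m : ℕ} (h : k + l = m) (α : V [⋀^Fin k]→L[ℝ] ℂ)
    (β : V [⋀^Fin l]→L[ℝ] ℂ) (f : W →L[ℝ] V) :
    (wedge h α β).compContinuousLinearMap f =
      wedge h (α.compContinuousLinearMap f) (β.compContinuousLinearMap f) := by
  ext v
  simp only [wedge_apply_out, ContinuousAlternatingMap.compContinuousLinearMap_apply]
  rfl

/-- The wedge product with a form of degree zero is multiplication by its value. -/
theorem wedge_degree_zero {l m : ℕ} (h : 0 + l = m) (α : V [⋀^Fin 0]→L[ℝ] ℂ)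
    (β : V [⋀^Fin l]→L[ℝ] ℂ) (v : Fin m → V) :
    wedge h α β v = α ![] * β (fun i => v (finCongr ((zero_add l).symm.trans h) i)) := by
  have hrange : ∀ s : Equiv.Perm (Fin 0 ⊕ Fin l),
      s ∈ (Equiv.Perm.sumCongrHom (Fin 0) (Fin l)).range := fun s =>
    Equiv.Perm.mem_sumCongrHom_range_of_perm_mapsTo_inl (by rintro _ ⟨i, -⟩; exact i.elim0)
  have hone : ∀ s : Equiv.Perm.ModSumCongr (Fin 0) (Fin l), s = Quotient.mk'' 1 := by
    intro s
    induction s using Quotient.inductionOn' with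
    | h s => exact Quotient.sound' (QuotientGroup.leftRel_apply.mpr (hrange _))
  rw [wedge_apply]
  refine (Finset.sum_eq_single (Quotient.mk'' 1) (fun s _ hs => absurd (hone s) hs)
    fun hs => absurd (Finset.mem_univ _) hs).trans ?_
  rw [shuffleTerm_mk]
  simp only [Equiv.Perm.sign_one, one_smul, Equiv.Perm.coe_one, id_eq]
  congr 2
  · exact Subsingleton.elim _ _
  · funext i
    congr 1
    ext
    simp

section Pairs

/-- The arrangement of `m + 1` pairs in which the pair `j` comes first. -/
def pairFirst {m l : ℕ} (e : Fin m × Fin 2 ≃ Fin l) (j : Fin (m + 1)) :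
    Fin 2 ⊕ Fin l ≃ Fin (m + 1) × Fin 2 :=
  (Equiv.sumCongr (Equiv.punitProd (Fin 2)).symm e.symm).trans
    ((Equiv.sumProdDistrib Unit (Fin m) (Fin 2)).symm.trans
      (((Equiv.sumComm Unit (Fin m)).trans ((Equiv.optionEquivSumPUnit (Fin m)).symm.trans
        (finSuccEquiv' j).symm)).prodCongr (Equiv.refl _)))

theorem pairFirst_inl {m l : ℕ} (e : Fin m × Fin 2 ≃ Fin l) (j : Fin (m + 1)) (s : Fin 2) :
    pairFirst e j (Sum.inl s) = (j, s) := by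
  simp [pairFirst]

theorem pairFirst_inr {m l : ℕ} (e : Fin m × Fin 2 ≃ Fin l) (j : Fin (m + 1)) (i : Fin l) :
    pairFirst e j (Sum.inr i) = (j.succAbove (e.symm i).1, (e.symm i).2) := by
  simp [pairFirst]

theorem pairFirst_eq {m l : ℕ} (e : Fin m × Fin 2 ≃ Fin l) (j : Fin (m + 1)) :
    pairFirst e j = (pairFirst e 0).trans
      (Equiv.prodCongrLeft fun _ : Fin 2 => j.cycleRange.symm) := by
  ext1 x
  rcases x with s | i
  · simp [pairFirst_inl, Equiv.prodCongrLeft]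
  · simp [pairFirst_inr, Equiv.prodCongrLeft]

/-- The value of `α ∧ γ` on a family of pairs, where `α` has degree two and pairs vectors of
different pairs to zero: an expansion along the pair which is inserted into `α`. -/
theorem wedge_two_pairs {m l N : ℕ} (h : 2 + l = N) (hl : m * 2 = l) (hN : (m + 1) * 2 = N)
    (α : V [⋀^Fin 2]→L[ℝ] ℂ) (γ : V [⋀^Fin l]→L[ℝ] ℂ) (w : Fin (m + 1) × Fin 2 → V)
    (hα : ∀ u : Fin 2 → Fin (m + 1) × Fin 2, (u 0).1 ≠ (u 1).1 → α (fun i => w (u i)) = 0) :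
    wedge h α γ (fun i => w ((finProdFinEquiv.trans (finCongr hN)).symm i)) =
      ∑ j : Fin (m + 1), α (fun s => w (j, s)) *
        γ (fun i => w (j.succAbove ((finProdFinEquiv.trans (finCongr hl)).symm i).1,
          ((finProdFinEquiv.trans (finCongr hl)).symm i).2)) := by
  set e := (finProdFinEquiv (m := m) (n := 2)).trans (finCongr hl) with he
  set eN := (finProdFinEquiv (m := m + 1) (n := 2)).trans (finCongr hN) with heN
  set eS := (finSumFinEquiv (m := 2) (n := l)).trans (finCongr h) with heS
  let P : Fin (m + 1) → Equiv.Perm (Fin 2 ⊕ Fin l) := fun j =>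
    (pairFirst e j).trans (eN.trans eS.symm)
  have hP : ∀ j x, eN.symm (eS (P j x)) = pairFirst e j x := fun j x => by simp [P]
  have hP0 : P 0 = 1 := by
    ext1 x
    apply eS.injective
    apply eN.symm.injective
    rw [hP, Equiv.eq_symm_apply]
    rcases x with s | i
    · rw [pairFirst_inl]
      ext
      simp [heS, heN, finProdFinEquiv]
    · rw [pairFirst_inr]
      obtain ⟨⟨a, b⟩, rfl⟩ := e.surjective i
      ext
      simp [heS, heN, he, finProdFinEquiv]
      omega
  -- `P j` permutes whole pairs, that is, it acts in the same way on both members: it is even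
  have hsign : ∀ j, Equiv.Perm.sign (P j) = 1 := by
    intro j
    have : P j = (P 0).trans ((eN.trans eS.symm).permCongr
        (Equiv.prodCongrLeft fun _ : Fin 2 => j.cycleRange.symm)) := by
      ext1 x
      simp [P, pairFirst_eq e j, Equiv.permCongr]
    rw [this, hP0]
    have h2 : ((1 : Equiv.Perm (Fin 2 ⊕ Fin l))).trans ((eN.trans eS.symm).permCongr
        (Equiv.prodCongrLeft fun _ : Fin 2 => j.cycleRange.symm)) = (eN.trans eS.symm).permCongr
        (Equiv.prodCongrLeft fun _ : Fin 2 => j.cycleRange.symm) := by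
      ext1 x; rfl
    rw [h2, Equiv.Perm.sign_permCongr, Equiv.Perm.sign_prodCongrLeft]
    simp
  rw [wedge_apply]
  symm
  refine Finset.sum_of_injOn (fun j => (Quotient.mk'' (P j) : Equiv.Perm.ModSumCongr _ _))
    ?_ (fun _ _ => Finset.mem_coe.mpr (Finset.mem_univ _)) ?_ ?_
  · intro j _ k _ hjk
    have := QuotientGroup.leftRel_apply.mp (Quotient.exact' hjk)
    obtain ⟨⟨a, b⟩, hab⟩ := this
    have h1 : P k (Sum.inl 0) = P j (Sum.inl (a 0)) := by
      have := congrArg (fun q : Equiv.Perm _ => P j (q (Sum.inl 0))) hab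
      simpa using this.symm
    have h2 : pairFirst e k (Sum.inl 0) = pairFirst e j (Sum.inl (a 0)) := by
      rw [← hP, ← hP, h1]
    rw [pairFirst_inl, pairFirst_inl] at h2
    exact (congrArg Prod.fst h2).symm
  -- every other shuffle inserts members of different pairs into `α`
  · intro s _ hs
    induction s using Quotient.inductionOn' with
    | h s =>
      rw [shuffleTerm_mk]
      by_cases hne : (eN.symm (eS (s (Sum.inl 0)))).1 = (eN.symm (eS (s (Sum.inl 1)))).1
      · exfalso
        apply hs
        refine ⟨(eN.symm (eS (s (Sum.inl 0)))).1, by simp, ?_⟩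
        refine Quotient.sound' (QuotientGroup.leftRel_apply.mpr ?_)
        apply Equiv.Perm.mem_sumCongrHom_range_of_perm_mapsTo_inl
        rintro _ ⟨i, rfl⟩
        refine ⟨(eN.symm (eS (s (Sum.inl i)))).2, ?_⟩
        rw [Equiv.Perm.mul_apply, Equiv.Perm.eq_inv_iff_eq]
        apply eS.injective
        apply eN.symm.injective
        rw [hP, pairFirst_inl]
        fin_cases i
        · rfl
        · exact Prod.ext hne rfl
      · have : α (fun i => w (eN.symm (eS (s (Sum.inl i))))) = 0 :=
          hα (fun i => eN.symm (eS (s (Sum.inl i)))) hne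
        rw [this, zero_mul, smul_zero]
  · intro j _
    rw [shuffleTerm_mk, hsign, one_smul]
    congr 2
    · funext i
      rw [hP, pairFirst_inl]
    · funext i
      rw [hP, pairFirst_inr]

end Pairs

end Wedge

/-! ### The algebra of forms of mixed degree -/

namespace MForm

variable {E : Type*} [NormedAddCommGroup E] [NormedSpace ℂ E]
  {M : Type*} [TopologicalSpace M] [ChartedSpace E M]

theorem ofDegree_same (k : ℕ) (α : DForm E M k) : ofDegree k α k = α := Pi.single_eq_same _ _

theorem ofDegree_of_ne {k m : ℕ} (h : m ≠ k) (α : DForm E M k) : ofDegree k α m = 0 :=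
  Pi.single_eq_of_ne h _

theorem ofDegree_mul {k l m : ℕ} (h : k + l = m) (α : DForm E M k) (β : MForm E M) (p : M) :
    mul (ofDegree k α) β m p = wedge h (α p) (β l p) := by
  obtain rfl : l = m - k := by omega
  rw [mul, Finset.sum_eq_single (⟨k, by omega⟩ : Fin (m + 1))]
  · simp only [ofDegree_same]
  · rintro ⟨j, hj⟩ - hne
    have : j ≠ k := fun h => hne (Fin.ext h)
    simp only [ofDegree_of_ne this]
    exact wedge_zero_left _ _
  · exact fun h => absurd (Finset.mem_univ _) h

theorem ofDegree_mul_of_lt {k m : ℕ} (h : m < k) (α : DForm E M k) (β : MForm E M) (p : M) :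
    mul (ofDegree k α) β m p = 0 := by
  rw [mul]
  refine Finset.sum_eq_zero fun j _ => ?_
  have : (j : ℕ) ≠ k := by have := j.isLt; omega
  simp only [ofDegree_of_ne this]
  exact wedge_zero_left _ _

theorem mul_eq_zero_of_right {α β : MForm E M} {m : ℕ} {p : M} (h : ∀ k ≤ m, β k p = 0) :
    mul α β m p = 0 := by
  rw [mul]
  refine Finset.sum_eq_zero fun j _ => ?_
  rw [h _ (Nat.sub_le _ _)]
  exact wedge_zero_right _ _

theorem smul_mul (c : ℂ) (α β : MForm E M) : mul (c • α) β = c • mul α β := by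
  funext m p
  simp only [mul, Pi.smul_apply, Finset.smul_sum]
  exact Finset.sum_congr rfl fun k _ => wedge_smul_left _ _ _ _

theorem mul_smul (c : ℂ) (α β : MForm E M) : mul α (c • β) = c • mul α β := by
  funext m p
  simp only [mul, Pi.smul_apply, Finset.smul_sum]
  exact Finset.sum_congr rfl fun k _ => wedge_smul_right _ _ _ _

theorem smul_pow (c : ℂ) (α : MForm E M) (m : ℕ) : pow (c • α) m = c ^ m • pow α m := by
  induction m with
  | zero => simp [pow]
  | succ m ih => rw [pow, ih, smul_mul, mul_smul, pow, smul_smul, pow_succ']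

theorem wedge_sum_right {V : Type*} [AddCommGroup V] [Module ℝ V] [TopologicalSpace V]
    {ι : Type*} (s : Finset ι) {k l m : ℕ}
    (h : k + l = m) (α : V [⋀^Fin k]→L[ℝ] ℂ) (β : ι → V [⋀^Fin l]→L[ℝ] ℂ) :
    wedge h α (∑ i ∈ s, β i) = ∑ i ∈ s, wedge h α (β i) := by
  ext v
  simp only [wedge_apply_out, ContinuousAlternatingMap.sum_apply]
  rw [Finset.sum_comm]
  exact Finset.sum_congr rfl fun x _ => by rw [Finset.mul_sum, Finset.smul_sum]

/-- The product is linear in the second factor, also over functions. -/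
theorem mul_sum_right {ι : Type*} (s : Finset ι) (a : ℂ) (c : ι → ℂ) (α β : MForm E M)
    (γ : ι → MForm E M) {m : ℕ} {p : M}
    (h : ∀ k ≤ m, β k p = a • ∑ i ∈ s, c i • γ i k p) :
    mul α β m p = a • ∑ i ∈ s, c i • mul α (γ i) m p := by
  simp only [mul, Finset.smul_sum]
  rw [Finset.sum_comm' (t' := Finset.univ) (s' := fun _ => s) (by simp)]
  simp only [← Finset.smul_sum]
  refine (Finset.sum_congr rfl fun k _ => ?_).trans (Finset.smul_sum ..).symm
  rw [h _ (Nat.sub_le _ _)]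
  refine (wedge_smul_right _ _ _ _).trans ?_
  congr 1
  refine (wedge_sum_right _ _ _ _).trans ?_
  exact Finset.sum_congr rfl fun i _ => wedge_smul_right _ _ _ _

theorem pow_ofDegree_two_of_ne (β : DForm E M 2) {m k : ℕ} (h : k ≠ m * 2) (p : M) :
    pow (ofDegree 2 β) m k p = 0 := by
  induction m generalizing k with
  | zero => rw [pow, one, ofDegree_of_ne (by omega)]; rfl
  | succ m ih =>
    rw [pow]
    rcases lt_or_ge k 2 with hk | hk
    · exact ofDegree_mul_of_lt hk _ _ _
    · obtain ⟨l, rfl⟩ := Nat.exists_eq_add_of_le hk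
      rw [ofDegree_mul rfl, ih (by omega)]
      exact wedge_zero_right _ _

/-- The exponential of a form with components in the degrees zero and two only. -/
theorem exp_smul_of_posPart_eq {A : MForm E M} {β : DForm E M 2}
    (hA : A.posPart = ofDegree 2 β) (c : ℂ) {k N : ℕ} (hk : k ≤ N) (p : M) :
    exp (c • A) k p = Complex.exp (c * A.fn p) •
      ∑ m ∈ Finset.range (N + 1), (c ^ m * (m.factorial : ℂ)⁻¹) • (ofDegree 2 β).pow m k p := by
  have hpos : (c • A).posPart = c • ofDegree 2 β := by
    rw [← hA]
    funext j
    rcases eq_or_ne j 0 with rfl | hj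
    · simp only [posPart, Function.update_self, Pi.smul_apply]
      funext q
      ext v
      exact (mul_zero c).symm
    · simp [posPart, Function.update_of_ne hj]
  rw [exp, hpos]
  congr 1
  rw [← Finset.sum_subset (Finset.range_mono (Nat.succ_le_succ hk))]
  · refine Finset.sum_congr rfl fun m _ => ?_
    rw [smul_pow, Pi.smul_apply, Pi.smul_apply, smul_smul, mul_comm]
  · intro m _ hm
    rw [pow_ofDegree_two_of_ne β (by simp at hm; omega)]
    ext v
    exact mul_zero _

section Pairs

variable {p : M}

/-- The value of `α ∧ β ^ m` on `m + 1` pairs of vectors, where `α` and `β` pair vectors of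
different pairs to zero. -/
theorem two_mul_pow_pairs (α β : DForm E M 2) {m N : ℕ} (hN : (m + 1) * 2 = N)
    (w : Fin (m + 1) × Fin 2 → TangentSpace 𝓘(ℝ, E) p)
    (hα : ∀ u : Fin 2 → Fin (m + 1) × Fin 2, (u 0).1 ≠ (u 1).1 → α p (fun i => w (u i)) = 0)
    (hβ : ∀ u : Fin 2 → Fin (m + 1) × Fin 2, (u 0).1 ≠ (u 1).1 → β p (fun i => w (u i)) = 0) :
    mul (ofDegree 2 α) (pow (ofDegree 2 β) m) N p
        (fun i => w ((finProdFinEquiv.trans (finCongr hN)).symm i)) =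
      (m.factorial : ℂ) * ∑ j : Fin (m + 1), α p (fun s => w (j, s)) *
        ∏ k : Fin m, β p (fun s => w (j.succAbove k, s)) := by
  have key : ∀ (m : ℕ) (w : Fin m × Fin 2 → TangentSpace 𝓘(ℝ, E) p),
      (∀ u : Fin 2 → Fin m × Fin 2, (u 0).1 ≠ (u 1).1 → β p (fun i => w (u i)) = 0) →
      pow (ofDegree 2 β) m (m * 2) p (fun i => w ((finProdFinEquiv).symm i)) =
        (m.factorial : ℂ) * ∏ k : Fin m, β p (fun s => w (k, s)) := by
    intro m
    induction m with
    | zero =>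
      intro w _
      have h : pow (ofDegree 2 β) 0 (0 * 2) p =
          ContinuousAlternatingMap.constOfIsEmpty ℝ (TangentSpace 𝓘(ℝ, E) p) (Fin 0) 1 :=
        congrFun (ofDegree_same 0 _) p
      rw [h]
      simp
    | succ m ih =>
      intro w hw
      have h2 : 2 + m * 2 = (m + 1) * 2 := by ring
      rw [pow, ofDegree_mul h2]
      refine (wedge_two_pairs h2 rfl rfl (β p) _ w hw).trans ?_
      have : ∀ j : Fin (m + 1), pow (ofDegree 2 β) m (m * 2) p (fun i =>
          w (j.succAbove (finProdFinEquiv.symm i).1, (finProdFinEquiv.symm i).2)) =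
          (m.factorial : ℂ) * ∏ k : Fin m, β p (fun s => w (j.succAbove k, s)) := fun j =>
        ih (fun x => w (j.succAbove x.1, x.2)) fun u hu =>
          hw (fun i => (j.succAbove (u i).1, (u i).2))
            fun h => hu (Fin.succAbove_right_injective h)
      have h3 : ∀ j : Fin (m + 1), β p (fun s => w (j, s)) * ((m.factorial : ℂ) *
          ∏ k : Fin m, β p (fun s => w (j.succAbove k, s))) =
          (m.factorial : ℂ) * ∏ k : Fin (m + 1), β p (fun s => w (k, s)) := fun j => by
        rw [Fin.prod_univ_succAbove _ j]; ring
      refine (Finset.sum_congr rfl fun j _ => (congrArg _ (this j)).trans (h3 j)).trans ?_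
      rw [Finset.sum_const, Finset.card_univ, Fintype.card_fin, Nat.factorial_succ]
      push_cast
      rw [nsmul_eq_mul]
      push_cast
      ring
  have h2 : 2 + m * 2 = N := by omega
  rw [ofDegree_mul h2]
  refine (wedge_two_pairs h2 rfl hN (α p) _ w hα).trans ?_
  rw [Finset.mul_sum]
  refine Finset.sum_congr rfl fun j _ => ?_
  have := key m (fun x => w (j.succAbove x.1, x.2)) fun u hu =>
          hβ (fun i => (j.succAbove (u i).1, (u i).2))
            fun h => hu (Fin.succAbove_right_injective h)
  refine (congrArg _ this).trans ?_
  ring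

end Pairs

end MForm

/-! ### Calculus in charts -/

section Charts

variable {E : Type*} [NormedAddCommGroup E] [NormedSpace ℂ E]
  {M : Type*} [TopologicalSpace M] [ChartedSpace E M]

/-- The change of coordinates from the chart around `c` to the chart around `q`. -/
def transition (c q : M) : E → E := chartAt E q ∘ (chartAt E c).symm

/-- The domain of `transition c q`. -/
def transitionDomain (c q : M) : Set E :=
  ((chartAt E c).symm.trans (chartAt E q)).source

theorem isOpen_transitionDomain (c q : M) : IsOpen (transitionDomain (E := E) c q) :=
  ((chartAt E c).symm.trans (chartAt E q)).open_source

theorem mem_transitionDomain {c q : M} {y : E} : y ∈ transitionDomain c q ↔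
    y ∈ (chartAt E c).target ∧ (chartAt E c).symm y ∈ (chartAt E q).source := by
  simp [transitionDomain]

theorem symm_transition {c q : M} {y : E} (hy : y ∈ transitionDomain c q) :
    (chartAt E q).symm (transition c q y) = (chartAt E c).symm y :=
  (chartAt E q).left_inv (mem_transitionDomain.mp hy).2

theorem transition_mem {c q : M} {y : E} (hy : y ∈ transitionDomain c q) :
    transition c q y ∈ transitionDomain (E := E) q c := by
  rw [mem_transitionDomain] at hy ⊢
  refine ⟨(chartAt E q).map_source hy.2, ?_⟩
  rw [transition, Function.comp_apply, (chartAt E q).left_inv hy.2]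
  exact (chartAt E c).map_target hy.1

theorem transition_mem_target {c q : M} {y : E} (hy : y ∈ transitionDomain c q) :
    transition c q y ∈ (chartAt E q).target := (mem_transitionDomain.mp (transition_mem hy)).1

theorem transition_transition {c q : M} {y : E} (hy : y ∈ transitionDomain c q) :
    transition q c (transition c q y) = y := by
  rw [transition, Function.comp_apply, symm_transition hy]
  exact (chartAt E c).right_inv (mem_transitionDomain.mp hy).1

section Manifold

variable [IsManifold 𝓘(ℂ, E) ω M]

theorem contDiffOn_transition (c q : M) :
    ContDiffOn ℂ ω (transition c q) (transitionDomain (E := E) c q) := by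
  have := (contDiffGroupoid ω 𝓘(ℂ, E)).compatible (chart_mem_atlas E c) (chart_mem_atlas E q)
  rw [contDiffGroupoid, mem_groupoid_of_pregroupoid] at this
  simpa [contDiffPregroupoid, transition, transitionDomain] using this.1

theorem contDiffAt_transition {c q : M} {y : E} (hy : y ∈ transitionDomain c q) :
    ContDiffAt ℂ ω (transition c q) y :=
  (contDiffOn_transition c q).contDiffAt ((isOpen_transitionDomain c q).mem_nhds hy)

theorem differentiableAt_transition {c q : M} {y : E} (hy : y ∈ transitionDomain c q) :
    DifferentiableAt ℂ (transition c q) y :=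
  (contDiffAt_transition hy).differentiableAt (by simp)

theorem fderiv_transition_real {c q : M} {y : E} (hy : y ∈ transitionDomain c q) :
    fderiv ℝ (transition c q) y = (fderiv ℂ (transition c q) y).restrictScalars ℝ :=
  (differentiableAt_transition hy).fderiv_restrictScalars ℝ

theorem fderiv_transition_comp {c q : M} {y : E} (hy : y ∈ transitionDomain c q) :
    (fderiv ℂ (transition q c) (transition c q y)).comp (fderiv ℂ (transition c q) y) =
      ContinuousLinearMap.id ℂ E := by
  rw [← fderiv_comp y (differentiableAt_transition (transition_mem hy))
    (differentiableAt_transition hy)]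
  have : transition q c ∘ transition c q =ᶠ[𝓝 y] id := by
    filter_upwards [(isOpen_transitionDomain c q).mem_nhds hy] with z hz
    exact transition_transition hz
  rw [this.fderiv_eq, fderiv_id]

theorem transition_trans_eventuallyEq {c q r : M} {y : E} (hq : y ∈ transitionDomain c q) :
    transition c r =ᶠ[𝓝 y] transition q r ∘ transition c q := by
  filter_upwards [(isOpen_transitionDomain c q).mem_nhds hq] with z hz
  simp only [Function.comp_apply]
  conv_rhs => rw [transition, Function.comp_apply, symm_transition hz]
  rfl

theorem transition_mem_transitionDomain {c q r : M} {y : E} (hq : y ∈ transitionDomain c q)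
    (hr : y ∈ transitionDomain c r) : transition c q y ∈ transitionDomain (E := E) q r := by
  rw [mem_transitionDomain, symm_transition hq]
  exact ⟨transition_mem_target hq, (mem_transitionDomain.mp hr).2⟩

theorem fderiv_transition_trans {c q r : M} {y : E} (hq : y ∈ transitionDomain c q)
    (hr : y ∈ transitionDomain c r) : fderiv ℂ (transition c r) y =
      (fderiv ℂ (transition q r) (transition c q y)).comp (fderiv ℂ (transition c q) y) := by
  rw [(transition_trans_eventuallyEq hq).fderiv_eq]
  exact fderiv_comp y (differentiableAt_transition (transition_mem_transitionDomain hq hr))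
    (differentiableAt_transition hq)

/-- The domain of the change of coordinates to the chart around a point contains the point. -/
theorem mem_transitionDomain_of_eq {c q : M} {y : E} (hy : y ∈ (chartAt E c).target)
    (hq : (chartAt E c).symm y = q) : y ∈ transitionDomain c q := by
  rw [mem_transitionDomain, hq]
  exact ⟨hy, mem_chart_source E q⟩

variable (𝕜 : Type*) [NontriviallyNormedField 𝕜] [NormedSpace 𝕜 E] in
theorem mfderiv_chart_symm {c : M} {y : E} [IsManifold 𝓘(𝕜, E) 1 M]
    (hy : y ∈ (chartAt E c).target) :
    mfderiv 𝓘(𝕜, E) 𝓘(𝕜, E) (chartAt E c).symm y =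
      fderiv 𝕜 (transition c ((chartAt E c).symm y)) y := by
  have h : MDifferentiableAt 𝓘(𝕜, E) 𝓘(𝕜, E) (chartAt E c).symm y :=
    (mdifferentiableAt_atlas_symm (chart_mem_atlas E c) hy)
  have hfun : writtenInExtChartAt 𝓘(𝕜, E) 𝓘(𝕜, E) y (chartAt E c).symm =
      transition c ((chartAt E c).symm y) := by
    ext z
    simp [writtenInExtChartAt, transition, chartAt_self_eq]
  refine h.mfderiv.trans ?_
  rw [hfun]
  simp [chartAt_self_eq]
  rfl

theorem frame_eq {c : M} {y : E} (hy : y ∈ (chartAt E c).target) :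
    frame c y = (fderiv ℂ (transition c ((chartAt E c).symm y)) y).restrictScalars ℝ := by
  rw [← fderiv_transition_real (mem_transitionDomain_of_eq hy rfl)]
  exact mfderiv_chart_symm ℝ hy

theorem frame_I_smul {c : M} {y : E} (hy : y ∈ (chartAt E c).target) (u : E) :
    frame c y (Complex.I • u) = complexStructure _ (frame c y u) := by
  rw [frame_eq hy]
  exact (fderiv ℂ (transition c ((chartAt E c).symm y)) y).map_smul Complex.I u

/-- `frame c y` is a complex linear isomorphism. -/
theorem exists_frame_inverse {c : M} {y : E} (hy : y ∈ (chartAt E c).target) :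
    ∃ e : E ≃L[ℂ] E, frame c y = ((e : E →L[ℂ] E).restrictScalars ℝ) := by
  have h := mem_transitionDomain_of_eq hy rfl
  refine ⟨ContinuousLinearEquiv.equivOfInverse (fderiv ℂ (transition c ((chartAt E c).symm y)) y)
    (fderiv ℂ (transition ((chartAt E c).symm y) c) (transition c ((chartAt E c).symm y) y))
    ?_ ?_, frame_eq hy⟩
  · exact fun u => DFunLike.congr_fun (fderiv_transition_comp h) u
  · intro u
    have := fderiv_transition_comp (transition_mem h)
    rw [transition_transition h] at this
    exact DFunLike.congr_fun this u

theorem frame_injective {c : M} {y : E} (hy : y ∈ (chartAt E c).target) :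
    Function.Injective (frame c y) := by
  obtain ⟨e, he⟩ := exists_frame_inverse hy
  rw [he]
  exact e.injective

/-- The real and the complex derivatives of the charts give the same coordinates of vector fields. -/
theorem mpullback_chart_symm_real (X : VField E M) {c : M} {y : E}
    (hy : y ∈ (chartAt E c).target) :
    X.inChart c y = VectorField.mpullback 𝓘(ℂ, E) 𝓘(ℂ, E) (chartAt E c).symm X y := by
  have : IsManifold 𝓘(ℂ, E) 1 M := IsManifold.of_le le_top
  obtain ⟨e, he⟩ := exists_frame_inverse hy
  change (mfderiv 𝓘(ℝ, E) 𝓘(ℝ, E) (chartAt E c).symm y).inverse (X _) =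
    (mfderiv 𝓘(ℂ, E) 𝓘(ℂ, E) (chartAt E c).symm y).inverse (X _)
  have h1 : mfderiv 𝓘(ℂ, E) 𝓘(ℂ, E) (chartAt E c).symm y = (e : E →L[ℂ] E) := by
    rw [mfderiv_chart_symm ℂ hy]
    ext u
    exact (DFunLike.congr_fun ((frame_eq hy).symm.trans he) u)
  have h2 : mfderiv 𝓘(ℝ, E) 𝓘(ℝ, E) (chartAt E c).symm y =
      ((e.restrictScalars ℝ : E ≃L[ℝ] E) : E →L[ℝ] E) := he
  rw [h1, h2]
  refine (DFunLike.congr_fun (ContinuousLinearMap.inverse_equiv (e.restrictScalars ℝ)) _).trans ?_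
  exact (DFunLike.congr_fun (ContinuousLinearMap.inverse_equiv e) _).symm

theorem frame_inChart (X : VField E M) {c : M} {y : E} (hy : y ∈ (chartAt E c).target) :
    frame c y (X.inChart c y) = X ((chartAt E c).symm y) := by
  obtain ⟨e, he⟩ := exists_frame_inverse hy
  have h2 : frame c y = ((e.restrictScalars ℝ : E ≃L[ℝ] E) : E →L[ℝ] E) := he
  have h3 : X.inChart c y = e.symm (X ((chartAt E c).symm y)) := by
    rw [VField.inChart, VectorField.mpullback_apply]
    change (frame c y).inverse _ = _
    rw [h2]
    exact (DFunLike.congr_fun (ContinuousLinearMap.inverse_equiv (e.restrictScalars ℝ)) _)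
  rw [h3, h2]
  exact e.apply_symm_apply _

theorem inChart_eq_zero_iff (X : VField E M) {c : M} {y : E} (hy : y ∈ (chartAt E c).target) :
    X.inChart c y = 0 ↔ X ((chartAt E c).symm y) = 0 := by
  rw [← frame_inChart X hy]
  exact (map_eq_zero_iff (frame c y) (frame_injective hy)).symm

theorem VField.IsHolomorphic.contDiffOn [FiniteDimensional ℂ E] {X : VField E M}
    (hX : X.IsHolomorphic) (c : M) :
    ContDiffOn ℂ ω (X.inChart c) (chartAt E c).target := by
  have : IsManifold 𝓘(ℂ, E) 1 M := IsManifold.of_le le_top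
  have : IsManifold 𝓘(ℂ, E) (ω + 1) M := IsManifold.of_le le_top
  have : CompleteSpace E := FiniteDimensional.complete ℂ E
  suffices h : ContDiffOn ℂ ω
      (VectorField.mpullback 𝓘(ℂ, E) 𝓘(ℂ, E) (chartAt E c).symm X) (chartAt E c).target from
    h.congr fun y hy => mpullback_chart_symm_real X hy
  intro y hy
  apply ContDiffAt.contDiffWithinAt
  rw [← contMDiffAt_vectorSpace_iff_contDiffAt]
  refine ContMDiffAt.mpullback_vectorField_preimage (n := ω) (hX _)
    ((contMDiffOn_chart_symm (I := 𝓘(ℂ, E)) (x := c)).contMDiffAt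
      ((chartAt E c).open_target.mem_nhds hy)) ?_ (by simp)
  obtain ⟨e, he⟩ := exists_frame_inverse hy
  refine ⟨e, ?_⟩
  rw [mfderiv_chart_symm ℂ hy]
  ext u
  exact (DFunLike.congr_fun ((frame_eq hy).symm.trans he) u).symm

/-- A form in the coordinates of the chart around `c`, computed with the tangent space at `q`. -/
theorem DForm.inChart_eq {k : ℕ} (α : DForm E M k) {c q : M} {y : E}
    (hy : y ∈ (chartAt E c).target) (hq : (chartAt E c).symm y = q) :
    α.inChart c y = (show E [⋀^Fin k]→L[ℝ] ℂ from α q).compContinuousLinearMap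
      (fderiv ℝ (transition c q) y) := by
  subst hq
  rw [DForm.inChart, frame_eq hy, ← fderiv_transition_real (mem_transitionDomain_of_eq hy rfl)]
  rfl

theorem DForm.inChart_transition {k : ℕ} (α : DForm E M k) {c q : M} {y : E}
    (hy : y ∈ transitionDomain c q) :
    α.inChart c y = (α.inChart q (transition c q y)).compContinuousLinearMap
      (fderiv ℝ (transition c q) y) := by
  have hy1 := (mem_transitionDomain.mp hy).1
  rw [DForm.inChart_eq α hy1 rfl, DForm.inChart_eq α (transition_mem_target hy) (symm_transition hy)]
  have hr := mem_transitionDomain_of_eq (E := E) hy1 rfl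
  have h1 := fderiv_transition_trans hy hr
  have h2 : fderiv ℝ (transition c ((chartAt E c).symm y)) y =
      (fderiv ℝ (transition q ((chartAt E c).symm y)) (transition c q y)).comp
        (fderiv ℝ (transition c q) y) := by
    rw [fderiv_transition_real hr, fderiv_transition_real hy,
      fderiv_transition_real (transition_mem_transitionDomain hy hr), h1]
    rfl
  rw [h2]
  rfl

theorem transition_self_apply {q : M} {y : E} (hy : y ∈ (chartAt E q).target) :
    transition q q y = y := (chartAt E q).right_inv hy

theorem mfderiv_chart_self (q : M) :
    mfderiv 𝓘(ℝ, E) 𝓘(ℝ, E) (chartAt E q) q = ContinuousLinearMap.id ℝ E := by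
  have h : MDifferentiableAt 𝓘(ℝ, E) 𝓘(ℝ, E) (chartAt E q) q :=
    (mdifferentiableAt_atlas (chart_mem_atlas E q) (mem_chart_source E q))
  have hfun : writtenInExtChartAt 𝓘(ℝ, E) 𝓘(ℝ, E) q (chartAt E q) = transition q q := by
    ext z
    simp [writtenInExtChartAt, transition, chartAt_self_eq]
  refine h.mfderiv.trans ?_
  rw [hfun]
  have h2 : (transition q q : E → E) =ᶠ[𝓝 (chartAt E q q)] id := by
    filter_upwards [(chartAt E q).open_target.mem_nhds (mem_chart_target E q)] with z hz
    exact transition_self_apply hz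
  have h3 := h2.fderiv_eq (𝕜 := ℝ)
  rw [fderiv_id] at h3
  simp only [modelWithCornersSelf_coe, range_id, fderivWithin_univ, extChartAt_coe,
    Function.comp_apply, id_eq]
  exact h3

/-- The exterior derivative may be computed in any chart. -/
theorem DForm.inChart_extDer {k : ℕ} {α : DForm E M k} (hα : α.Smooth) {c : M} {y : E}
    (hy : y ∈ (chartAt E c).target) :
    α.extDer.inChart c y = extDeriv (α.inChart c) y := by
  set q := (chartAt E c).symm y with hq
  have hyq := mem_transitionDomain_of_eq hy hq.symm
  have hty : transition c q y = chartAt E q q := rfl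
  rw [DForm.inChart_eq _ hy hq.symm]
  have h1 : α.inChart c =ᶠ[𝓝 y] fun z => (α.inChart q (transition c q z)).compContinuousLinearMap
      (fderiv ℝ (transition c q) z) := by
    filter_upwards [(isOpen_transitionDomain c q).mem_nhds hyq] with z hz
    exact α.inChart_transition hz
  rw [h1.extDeriv_eq, extDeriv_pullback (r := ω), hty]
  · rw [DForm.extDer]
    congr 1
    change (extDeriv (α.inChart q) (chartAt E q q)).compContinuousLinearMap
      (mfderiv 𝓘(ℝ, E) 𝓘(ℝ, E) (chartAt E q) q) = _
    rw [mfderiv_chart_self]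
    ext v
    rfl
  · refine ((hα q).contDiffAt ((chartAt E q).open_target.mem_nhds ?_)).differentiableAt (by simp)
    exact transition_mem_target hyq
  · exact (contDiffAt_transition hyq).restrict_scalars ℝ
  · simp

end Manifold

end Charts

/-! ### Smooth forms -/

section FormValued

variable {E : Type*} [NormedAddCommGroup E] [NormedSpace ℝ E] [FiniteDimensional ℝ E]
  {D : Type*} [NormedAddCommGroup D] [NormedSpace ℝ D]

instance finiteDimensional_forms (k : ℕ) : FiniteDimensional ℝ (E [⋀^Fin k]→L[ℝ] ℂ) := by
  let b := Module.finBasis ℝ E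
  let Φ : (E [⋀^Fin k]→L[ℝ] ℂ) →ₗ[ℝ] ((Fin k → Fin (Module.finrank ℝ E)) → ℂ) :=
    { toFun := fun f i => f fun j => b (i j)
      map_add' := fun f g => rfl
      map_smul' := fun c f => rfl }
  refine FiniteDimensional.of_injective Φ fun f g h => ?_
  apply ContinuousAlternatingMap.toAlternatingMap_injective
  exact b.ext_alternating fun i _ => congrFun h i

/-- A form valued function is smooth if its values on constant vectors are. -/
theorem contDiffOn_form_iff {k : ℕ} {n : ℕ∞ω} {f : D → E [⋀^Fin k]→L[ℝ] ℂ} {s : Set D} :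
    ContDiffOn ℝ n f s ↔ ∀ v, ContDiffOn ℝ n (fun y => f y v) s := by
  constructor
  · intro h v
    let ev : (E [⋀^Fin k]→L[ℝ] ℂ) →ₗ[ℝ] ℂ :=
      { toFun := fun f => f v
        map_add' := fun f g => rfl
        map_smul' := fun c f => rfl }
    exact (LinearMap.toContinuousLinearMap ev).contDiff.comp_contDiffOn h
  · intro h
    let b := Module.finBasis ℝ E
    let Φ : (E [⋀^Fin k]→L[ℝ] ℂ) →ₗ[ℝ] ((Fin k → Fin (Module.finrank ℝ E)) → ℂ) :=
      { toFun := fun f i => f fun j => b (i j)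
        map_add' := fun f g => rfl
        map_smul' := fun c f => rfl }
    have hΦ : LinearMap.ker Φ = ⊥ := by
      refine LinearMap.ker_eq_bot.mpr fun f g h => ?_
      apply ContinuousAlternatingMap.toAlternatingMap_injective
      exact b.ext_alternating fun i _ => congrFun h i
    obtain ⟨Ψ, hΨ⟩ := Φ.exists_leftInverse_of_injective hΦ
    have hf : f = fun y => LinearMap.toContinuousLinearMap Ψ (Φ (f y)) := by
      funext y
      exact (DFunLike.congr_fun hΨ (f y)).symm
    rw [hf]
    exact (LinearMap.toContinuousLinearMap Ψ).contDiff.comp_contDiffOn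
      (contDiffOn_pi.mpr fun i => h _)

theorem contDiffOn_interior {k : ℕ} {n : ℕ∞ω} {f : D → E [⋀^Fin (k + 1)]→L[ℝ] ℂ} {X : D → E}
    {s : Set D} (hf : ContDiffOn ℝ n f s) (hX : ContDiffOn ℝ n X s) :
    ContDiffOn ℝ n (fun y => interior (X y) (f y)) s := by
  rw [contDiffOn_form_iff] at hf ⊢
  intro v
  let b := Module.finBasis ℝ E
  have key : ∀ y, interior (X y) (f y) v =
      ∑ i, b.repr (X y) i • f y (Matrix.vecCons (b i) v) := by
    intro y
    let Λ : E →ₗ[ℝ] ℂ :=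
      { toFun := fun u => (f y).toAlternatingMap.curryLeft u v
        map_add' := fun u w => by simp
        map_smul' := fun a u => by simp }
    have h1 : interior (X y) (f y) v = Λ (X y) := rfl
    conv_lhs => rw [h1, ← b.sum_repr (X y)]
    rw [map_sum]
    refine Finset.sum_congr rfl fun i _ => ?_
    rw [map_smul]
    rfl
  refine ContDiffOn.congr ?_ fun y _ => key y
  refine ContDiffOn.sum fun i _ => ContDiffOn.fun_smul ?_ (hf _)
  exact (LinearMap.toContinuousLinearMap (b.coord i)).contDiff.comp_contDiffOn hX

theorem contDiffOn_wedge {k l m : ℕ} (h : k + l = m) {n : ℕ∞ω} {f : D → E [⋀^Fin k]→L[ℝ] ℂ}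
    {f' : D → E [⋀^Fin l]→L[ℝ] ℂ} {s : Set D} (hf : ContDiffOn ℝ n f s)
    (hf' : ContDiffOn ℝ n f' s) : ContDiffOn ℝ n (fun y => wedge h (f y) (f' y)) s := by
  rw [contDiffOn_form_iff] at hf hf' ⊢
  intro v
  simp only [wedge_apply_out, Units.smul_def, zsmul_eq_mul]
  exact ContDiffOn.sum fun i _ => contDiffOn_const.mul ((hf _).mul (hf' _))

end FormValued

section Smooth

variable {E : Type*} [NormedAddCommGroup E] [NormedSpace ℂ E] [FiniteDimensional ℂ E]
  {M : Type*} [TopologicalSpace M] [ChartedSpace E M]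

instance : FiniteDimensional ℝ E := FiniteDimensional.complexToReal E

/-- Smooth real vector fields. -/
def VField.Smooth (X : VField E M) : Prop :=
  ∀ c : M, ContDiffOn ℝ ∞ (X.inChart c) (chartAt E c).target

theorem DForm.smooth_iff {k : ℕ} {α : DForm E M k} : α.Smooth ↔
    ∀ (c : M) (v : Fin k → E), ContDiffOn ℝ ∞ (fun y => α.inChart c y v) (chartAt E c).target :=
  forall_congr' fun _ => contDiffOn_form_iff

namespace MForm

theorem Smooth.add {α β : MForm E M} (hα : α.Smooth) (hβ : β.Smooth) : (α + β).Smooth :=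
  fun k c => (hα k c).add (hβ k c)

theorem Smooth.sub {α β : MForm E M} (hα : α.Smooth) (hβ : β.Smooth) : (α - β).Smooth :=
  fun k c => (hα k c).sub (hβ k c)

theorem Smooth.smul {α : MForm E M} (hα : α.Smooth) (a : ℂ) : (a • α).Smooth := fun k => by
  rw [DForm.smooth_iff]
  exact fun c v => contDiffOn_const.mul (DForm.smooth_iff.mp (hα k) c v)

theorem smooth_ofDegree {k : ℕ} {α : DForm E M k} (hα : α.Smooth) : (ofDegree k α).Smooth := by
  intro m
  rcases eq_or_ne m k with rfl | h
  · rwa [ofDegree_same]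
  · rw [ofDegree_of_ne h, DForm.smooth_iff]
    exact fun c v => contDiffOn_const (c := (0 : ℂ))

theorem smooth_one : (one : MForm E M).Smooth := by
  refine smooth_ofDegree (DForm.smooth_iff.mpr fun c v => ?_)
  exact contDiffOn_const (c := (1 : ℂ))

theorem Smooth.mul {α β : MForm E M} (hα : α.Smooth) (hβ : β.Smooth) : (α.mul β).Smooth := by
  intro m
  rw [DForm.smooth_iff]
  intro c v
  have : ∀ y, (α.mul β m).inChart c y v = ∑ k : Fin (m + 1),
      wedge (Nat.add_sub_of_le (Nat.lt_succ_iff.mp k.isLt)) ((α k).inChart c y)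
        ((β (m - k)).inChart c y) v := by
    intro y
    simp only [DForm.inChart, ← wedge_compContinuousLinearMap, MForm.mul,
      ContinuousAlternatingMap.compContinuousLinearMap_apply, ContinuousAlternatingMap.sum_apply]
  simp only [this]
  exact ContDiffOn.sum fun k _ => contDiffOn_form_iff.mp
    (contDiffOn_wedge _ (hα k c) (hβ (m - k) c)) v

theorem Smooth.pow {α : MForm E M} (hα : α.Smooth) (m : ℕ) : (α.pow m).Smooth := by
  induction m with
  | zero => exact smooth_one
  | succ m ih => exact hα.mul ih

variable [IsManifold 𝓘(ℂ, E) ω M]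

theorem inChart_contract (X : VField E M) (α : MForm E M) (k : ℕ) {c : M} {y : E}
    (hy : y ∈ (chartAt E c).target) :
    (contract X α k).inChart c y = interior (X.inChart c y) ((α (k + 1)).inChart c y) := by
  ext v
  change α (k + 1) _ (Matrix.vecCons (X _) (fun i => frame c y (v i))) =
    α (k + 1) _ (fun i => frame c y (Matrix.vecCons (X.inChart c y) v i))
  congr 1
  funext i
  refine Fin.cases ?_ (fun i => ?_) i
  · exact (frame_inChart X hy).symm
  · rfl

theorem inChart_complexStructure (X : VField E M) {c : M} {y : E}
    (hy : y ∈ (chartAt E c).target) :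
    VField.inChart (fun p => complexStructure p (X p)) c y = Complex.I • X.inChart c y := by
  apply frame_injective hy
  rw [frame_I_smul hy, frame_inChart X hy, frame_inChart _ hy]

theorem inChart_pullJ (α : MForm E M) (k : ℕ) {c : M} {y : E}
    (hy : y ∈ (chartAt E c).target) (v : Fin k → E) :
    (pullJ α k).inChart c y v = (α k).inChart c y fun i => Complex.I • v i := by
  change α k _ (fun i => complexStructure _ (frame c y (v i))) =
    α k _ (fun i => frame c y (Complex.I • v i))
  simp only [frame_I_smul hy]

theorem inChart_pullJInv (α : MForm E M) (k : ℕ) {c : M} {y : E}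
    (hy : y ∈ (chartAt E c).target) (v : Fin k → E) :
    (pullJInv α k).inChart c y v = (α k).inChart c y fun i => -(Complex.I • v i) := by
  change α k _ (fun i => (-complexStructure _) (frame c y (v i))) =
    α k _ (fun i => frame c y (-(Complex.I • v i)))
  simp only [map_neg, frame_I_smul hy]
  rfl

theorem Smooth.contract {X : VField E M} {α : MForm E M} (hX : X.Smooth) (hα : α.Smooth) :
    (contract X α).Smooth := fun k c =>
  (contDiffOn_interior (hα (k + 1) c) (hX c)).congr fun _ hy => inChart_contract X α k hy

theorem _root_.KahlerForms.VField.Smooth.complexStructure {X : VField E M} (hX : X.Smooth) :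
    VField.Smooth fun p => complexStructure p (X p) := fun c =>
  ((hX c).const_smul Complex.I).congr fun _ hy => inChart_complexStructure X hy

theorem Smooth.pullJ {α : MForm E M} (hα : α.Smooth) : (pullJ α).Smooth := by
  intro k
  rw [DForm.smooth_iff]
  exact fun c v => (DForm.smooth_iff.mp (hα k) c _).congr fun y hy => inChart_pullJ α k hy v

theorem Smooth.pullJInv {α : MForm E M} (hα : α.Smooth) : (pullJInv α).Smooth := by
  intro k
  rw [DForm.smooth_iff]
  exact fun c v => (DForm.smooth_iff.mp (hα k) c _).congr fun y hy => inChart_pullJInv α k hy v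

theorem _root_.KahlerForms.DForm.Smooth.extDer {k : ℕ} {α : DForm E M k} (hα : α.Smooth) :
    α.extDer.Smooth := by
  intro c
  refine ContDiffOn.congr ?_ fun y hy => DForm.inChart_extDer hα hy
  have h := (hα c).fderiv_of_isOpen (m := ∞) (chartAt E c).open_target (by simp)
  exact (ContinuousAlternatingMap.alternatizeUncurryFinCLM ℝ E ℂ).contDiff.comp_contDiffOn h

theorem Smooth.d {α : MForm E M} (hα : α.Smooth) : (d α).Smooth := by
  intro k
  cases k with
  | zero =>
    rw [DForm.smooth_iff]
    exact fun c v => contDiffOn_const (c := (0 : ℂ))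
  | succ k => exact (hα k).extDer

theorem Smooth.dc {α : MForm E M} (hα : α.Smooth) : (dc α).Smooth := hα.pullJ.d.pullJInv

theorem Smooth.delbar {α : MForm E M} (hα : α.Smooth) : (delbar α).Smooth :=
  (hα.d.sub (hα.dc.smul _)).smul _

theorem Smooth.contract01 {X : VField E M} {α : MForm E M} (hX : X.Smooth) (hα : α.Smooth) :
    (contract01 X α).Smooth :=
  ((Smooth.contract hX hα).add ((Smooth.contract hX.complexStructure hα).smul _)).smul _

end MForm

theorem VField.IsHolomorphic.smooth [IsManifold 𝓘(ℂ, E) ω M] {X : VField E M}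
    (hX : X.IsHolomorphic) : X.Smooth := fun c =>
  ((hX.contDiffOn c).restrict_scalars ℝ).of_le (by simp)

end Smooth

/-! ### The metric in a chart -/

namespace HermitianMetric

variable {E : Type*} [NormedAddCommGroup E] [NormedSpace ℂ E]
  {M : Type*} [TopologicalSpace M] [ChartedSpace E M] [IsManifold 𝓘(ℂ, E) ω M]

/-- The metric in the coordinates of the chart around `c`, as a bilinear form. -/
def gram (g : HermitianMetric E M) (c : M) (y : E) : E →L[ℝ] E →L[ℝ] ℝ :=
  (show E →L[ℝ] E →L[ℝ] ℝ from g.inner ((chartAt E c).symm y)).bilinearComp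
    (show E →L[ℝ] E from frame c y) (show E →L[ℝ] E from frame c y)

theorem gram_apply (g : HermitianMetric E M) (c : M) (y u v : E) :
    g.gram c y u v = g.inChart c y u v := rfl

theorem gram_symm (g : HermitianMetric E M) (c : M) (y u v : E) :
    g.gram c y u v = g.gram c y v u :=
  g.symm ((chartAt E c).symm y) (frame c y u) (frame c y v)

theorem gram_pos (g : HermitianMetric E M) {c : M} {y : E} (hy : y ∈ (chartAt E c).target)
    {u : E} (hu : u ≠ 0) : 0 < g.gram c y u u :=
  g.pos ((chartAt E c).symm y) (frame c y u) fun h => hu (frame_injective hy (h.trans (map_zero _).symm))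

theorem gram_I_smul (g : HermitianMetric E M) {c : M} {y : E} (hy : y ∈ (chartAt E c).target)
    (u v : E) : g.gram c y (Complex.I • u) (Complex.I • v) = g.gram c y u v := by
  change g.inner ((chartAt E c).symm y) (frame c y (Complex.I • u)) (frame c y (Complex.I • v)) = _
  rw [frame_I_smul hy, frame_I_smul hy, g.hermitian]
  rfl

theorem contMDiffOn_frame (c : M) (u : E) :
    ContMDiffOn 𝓘(ℝ, E) 𝓘(ℝ, E).tangent ∞
      (fun y => (⟨(chartAt E c).symm y, frame c y u⟩ : TangentBundle 𝓘(ℝ, E) M))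
      (chartAt E c).target := by
  have : IsManifold 𝓘(ℝ, E) ∞ M := isManifold_real ∞
  have h1 : ContMDiffOn 𝓘(ℝ, E) 𝓘(ℝ, E) ∞ (chartAt E c).symm (chartAt E c).target :=
    contMDiffOn_chart_symm
  have h2 := h1.contMDiffOn_tangentMapWithin (m := ∞) (by simp)
    (chartAt E c).open_target.uniqueMDiffOn
  have h3 : ContMDiff 𝓘(ℝ, E) 𝓘(ℝ, E).tangent ∞
      (fun y => (⟨y, u⟩ : TangentBundle 𝓘(ℝ, E) E)) := by
    intro y
    exact (contMDiffAt_vectorSpace_iff_contDiffAt (V := fun _ => u)).mpr contDiffAt_const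
  refine (h2.comp h3.contMDiffOn (fun y hy => hy)).congr fun y hy => ?_
  simp only [Function.comp_apply, tangentMapWithin, frame]
  rw [mfderivWithin_of_isOpen (chartAt E c).open_target hy]
  rfl

theorem contDiffOn_inChart (g : HermitianMetric E M) (c : M) (u v : E) :
    ContDiffOn ℝ ∞ (fun y => g.inChart c y u v) (chartAt E c).target := by
  have : IsManifold 𝓘(ℝ, E) ∞ M := isManifold_real ∞
  have h1 : ContMDiffOn 𝓘(ℝ, E) 𝓘(ℝ, E) ∞ (chartAt E c).symm (chartAt E c).target :=
    contMDiffOn_chart_symm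
  have h : ContMDiffOn 𝓘(ℝ, E) (𝓘(ℝ, E).prod 𝓘(ℝ)) ∞
      (fun y ↦ Bundle.TotalSpace.mk' ℝ (E := Bundle.Trivial M ℝ) ((chartAt E c).symm y)
        (g.inner ((chartAt E c).symm y) (frame c y u) (frame c y v))) (chartAt E c).target := by
    apply ContMDiffOn.clm_bundle_apply₂ (F₁ := E) (F₂ := E)
    · exact g.contMDiff.comp_contMDiffOn h1
    · exact contMDiffOn_frame c u
    · exact contMDiffOn_frame c v
  rw [← contMDiffOn_iff_contDiffOn]
  intro y hy
  have := h y hy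
  simp only [Bundle.contMDiffWithinAt_totalSpace] at this
  exact this.2

theorem contDiffOn_gram [FiniteDimensional ℂ E] (g : HermitianMetric E M) (c : M) :
    ContDiffOn ℝ ∞ (g.gram c) (chartAt E c).target :=
  contDiffOn_clm_apply.mpr fun u => contDiffOn_clm_apply.mpr fun v => g.contDiffOn_inChart c u v

end HermitianMetric

/-! ### The components of the form `d_t` -/

section Components

variable {E : Type*} [NormedAddCommGroup E] [NormedSpace ℂ E]
  {M : Type*} [TopologicalSpace M] [ChartedSpace E M]

theorem DForm.extDer_zero {k : ℕ} : DForm.extDer (0 : DForm E M k) = 0 := by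
  funext p
  have h : (0 : DForm E M k).inChart p = fun _ => 0 := by
    funext y
    ext v
    rfl
  have h0 : (fun _ : E => (0 : E [⋀^Fin k]→L[ℝ] ℂ)) = (0 : ℝ) • fun _ => 0 := by
    funext y
    ext v
    exact (smul_zero (0 : ℝ)).symm
  rw [DForm.extDer, h, h0, extDeriv_smul]
  ext v
  exact zero_smul ℝ _

theorem DForm.extDer_smul {k : ℕ} (r : ℝ) (α : DForm E M k) :
    DForm.extDer ((r : ℂ) • α) = (r : ℂ) • DForm.extDer α := by
  funext p
  have h : ((r : ℂ) • α).inChart p = r • α.inChart p := by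
    funext y
    ext v
    exact (Complex.real_smul).symm
  rw [DForm.extDer, h, extDeriv_smul]
  ext v
  exact Complex.real_smul

namespace MForm

theorem d_eq_zero {α : MForm E M} {k : ℕ} (h : α k = 0) : d α (k + 1) = 0 := by
  change DForm.extDer (α k) = 0
  rw [h, DForm.extDer_zero]

theorem pullJ_eq_zero {α : MForm E M} {k : ℕ} (h : α k = 0) : pullJ α k = 0 := by
  funext p
  ext v
  exact DFunLike.congr_fun (congrFun h p) _

theorem pullJInv_eq_zero {α : MForm E M} {k : ℕ} (h : α k = 0) : pullJInv α k = 0 := by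
  funext p
  ext v
  exact DFunLike.congr_fun (congrFun h p) _

theorem dc_eq_zero {α : MForm E M} {k : ℕ} (h : α k = 0) : dc α (k + 1) = 0 :=
  pullJInv_eq_zero (d_eq_zero (pullJ_eq_zero h))

theorem del_apply (α : MForm E M) (k : ℕ) (p : M) (v : Fin k → TangentSpace 𝓘(ℝ, E) p) :
    del α k p v = 1 / 2 * (d α k p v + Complex.I * dc α k p v) := rfl

theorem delbar_apply (α : MForm E M) (k : ℕ) (p : M) (v : Fin k → TangentSpace 𝓘(ℝ, E) p) :
    delbar α k p v = 1 / 2 * (d α k p v - Complex.I * dc α k p v) := rfl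

theorem contract01_apply (X : VField E M) (α : MForm E M) (k : ℕ) (p : M)
    (v : Fin k → TangentSpace 𝓘(ℝ, E) p) :
    contract01 X α k p v = 1 / 2 * (α (k + 1) p (Matrix.vecCons (X p) v) +
      Complex.I * α (k + 1) p (Matrix.vecCons (complexStructure p (X p)) v)) := rfl

theorem contract10_apply (X : VField E M) (α : MForm E M) (k : ℕ) (p : M)
    (v : Fin k → TangentSpace 𝓘(ℝ, E) p) :
    contract10 X α k p v = 1 / 2 * (α (k + 1) p (Matrix.vecCons (X p) v) -
      Complex.I * α (k + 1) p (Matrix.vecCons (complexStructure p (X p)) v)) := rfl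

theorem delbar_eq_zero {α : MForm E M} {k : ℕ} (h : α k = 0) : delbar α (k + 1) = 0 := by
  funext p
  ext v
  rw [delbar_apply, d_eq_zero h, dc_eq_zero h]
  simp

theorem contract10_eq_zero (X : VField E M) {α : MForm E M} {k : ℕ} (h : α (k + 1) = 0) :
    contract10 X α k = 0 := by
  funext p
  ext v
  rw [contract10_apply, h]
  simp

theorem contract01_eq_zero (X : VField E M) {α : MForm E M} {k : ℕ} (h : α (k + 1) = 0) :
    contract01 X α k = 0 := by
  funext p
  ext v
  rw [contract01_apply, h]
  simp

end MForm

end Components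

namespace HermitianMetric

open MForm

variable {E : Type*} [NormedAddCommGroup E] [NormedSpace ℂ E]
  {M : Type*} [TopologicalSpace M] [ChartedSpace E M] [IsManifold 𝓘(ℂ, E) ω M]

theorem complexStructure_complexStructure (p : M) (u : TangentSpace 𝓘(ℝ, E) p) :
    complexStructure p (complexStructure p u) = -u := by
  have h (w : E) : Complex.I • Complex.I • w = -w := by
    rw [smul_smul, Complex.I_mul_I, neg_one_smul]
  exact h u

theorem kahlerForm_apply (g : HermitianMetric E M) (p : M)
    (v : Fin 2 → TangentSpace 𝓘(ℝ, E) p) :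
    g.kahlerForm p v = ((g.inner p (complexStructure p (v 0)) (v 1) : ℝ) : ℂ) := rfl

theorem pullJ_kahler (g : HermitianMetric E M) : pullJ g.kahler = g.kahler := by
  funext k
  rcases eq_or_ne k 2 with rfl | h
  · funext p
    ext v
    change g.kahler 2 p (fun i => complexStructure p (v i)) = g.kahler 2 p v
    rw [kahler, ofDegree_same, kahlerForm_apply, kahlerForm_apply, g.hermitian]
  · have h0 : g.kahler k = 0 := ofDegree_of_ne h _
    rw [h0, pullJ_eq_zero h0]

theorem d_kahler {g : HermitianMetric E M} (hg : g.IsKahler) : d g.kahler = 0 := by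
  funext k
  cases k with
  | zero => rfl
  | succ k =>
    rcases eq_or_ne k 2 with rfl | h
    · change DForm.extDer (g.kahler 2) = 0
      rw [kahler, ofDegree_same]
      exact funext hg
    · exact d_eq_zero (ofDegree_of_ne h _)

theorem del_smul_kahler {g : HermitianMetric E M} (hg : g.IsKahler) (r : ℝ) :
    del ((r : ℂ) • g.kahler) = 0 := by
  have h1 : d ((r : ℂ) • g.kahler) = 0 := by
    funext k
    cases k with
    | zero => rfl
    | succ k =>
      change DForm.extDer ((r : ℂ) • g.kahler k) = 0
      rw [DForm.extDer_smul]
      have : DForm.extDer (g.kahler k) = 0 := congrFun (d_kahler hg) (k + 1)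
      rw [this]
      funext p
      ext v
      exact mul_zero _
  have h2 : pullJ ((r : ℂ) • g.kahler) = (r : ℂ) • g.kahler := by
    conv_rhs => rw [← pullJ_kahler]
    rfl
  funext k p
  ext v
  rw [del_apply, dc, h2, h1]
  change 1 / 2 * ((0 : ℂ) + Complex.I * 0) = 0
  simp

/-- The form `∂_X (-ω / (2π)) = i ι_{X^{0,1}} ω` of type `(1, 0)`. -/
def theta (g : HermitianMetric E M) (X : VField E M) : DForm E M 1 :=
  Complex.I • contract01 X g.kahler 1

/-- The form `∂bar (i ι_{X^{0,1}} ω)` of type `(1, 1)`. -/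
def beta (g : HermitianMetric E M) (X : VField E M) : DForm E M 2 :=
  delbar (ofDegree 1 (g.theta X)) 2

theorem delX_kahler {g : HermitianMetric E M} (hg : g.IsKahler) (X : VField E M) :
    delX X (-(2 * Real.pi : ℂ)⁻¹ • g.kahler) = ofDegree 1 (g.theta X) := by
  have hr : (-(2 * Real.pi : ℂ)⁻¹) = ((-(2 * Real.pi)⁻¹ : ℝ) : ℂ) := by push_cast; rfl
  have hc : (2 * Real.pi * Complex.I) * (-(2 * Real.pi : ℂ)⁻¹) = -Complex.I := by
    have : (Real.pi : ℂ) ≠ 0 := by exact_mod_cast Real.pi_ne_zero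
    field_simp
  rw [delX, hr, del_smul_kahler hg, ← hr, zero_sub]
  funext k
  rcases eq_or_ne k 1 with rfl | h
  · rw [ofDegree_same]
    funext p
    ext v
    change -((2 * Real.pi * Complex.I) * (1 / 2 * ((-(2 * Real.pi : ℂ)⁻¹) * _ + Complex.I *
      ((-(2 * Real.pi : ℂ)⁻¹) * _)))) = Complex.I * (1 / 2 * (_ + Complex.I * _))
    rw [mul_left_comm Complex.I (-(2 * Real.pi : ℂ)⁻¹), ← mul_add, mul_left_comm (1 / 2 : ℂ),
      ← mul_assoc, hc, neg_mul, neg_neg]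
    rfl
  · rw [ofDegree_of_ne h]
    have h0 : (-(2 * Real.pi : ℂ)⁻¹ • g.kahler) (k + 1) = 0 := by
      rw [Pi.smul_apply, kahler, ofDegree_of_ne (by omega)]
      funext p
      ext v
      exact mul_zero _
    funext p
    ext v
    change -((2 * Real.pi * Complex.I) * contract01 X (-(2 * Real.pi : ℂ)⁻¹ • g.kahler) k p v) = 0
    rw [contract01_eq_zero X h0]
    simp

theorem theta_apply (g : HermitianMetric E M) (X : VField E M) (p : M)
    (v : Fin 1 → TangentSpace 𝓘(ℝ, E) p) :
    g.theta X p v = Complex.I / 2 * (g.inner p (complexStructure p (X p)) (v 0) : ℝ) +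
      1 / 2 * (g.inner p (X p) (v 0) : ℝ) := by
  have h : g.kahler 2 = g.kahlerForm := ofDegree_same 2 _
  change Complex.I * contract01 X g.kahler 1 p v = _
  rw [contract01_apply, h, kahlerForm_apply, kahlerForm_apply]
  simp only [Matrix.cons_val_zero, Matrix.cons_val_one, complexStructure_complexStructure,
    map_neg, neg_apply]
  push_cast
  linear_combination (-(1 / 2) * (g.inner p (X p) (v 0) : ℂ)) * Complex.I_mul_I

/-- The degree zero part of `∂bar_X ∂_X (-ω / (2π))` is `-π i |X|²`, by the pairing of `X^{1,0}`
with `X^{0,1}`. -/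
theorem fn_delbarX_delX {g : HermitianMetric E M} (hg : g.IsKahler) (X : VField E M) (p : M) :
    (delbarX X (delX X (-(2 * Real.pi : ℂ)⁻¹ • g.kahler))).fn p =
      -(Real.pi * Complex.I * (g.inner p (X p) (X p) : ℝ)) := by
  rw [delX_kahler hg]
  change delbar (ofDegree 1 (g.theta X)) 0 p ![] -
    (2 * Real.pi * Complex.I) * contract10 X (ofDegree 1 (g.theta X)) 0 p ![] = _
  have h0 : delbar (ofDegree 1 (g.theta X)) 0 p ![] = 0 := by
    rw [delbar_apply]
    change 1 / 2 * ((0 : ℂ) - Complex.I * 0) = 0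
    simp
  have h1 : g.inner p (complexStructure p (X p)) (X p) = 0 := by
    have := g.inner_J_swap p (X p) (X p)
    linarith
  have h2 : g.inner p (X p) (complexStructure p (X p)) = 0 := by rw [g.symm, h1]
  have h3 : ofDegree 1 (g.theta X) (0 + 1) = g.theta X := ofDegree_same 1 _
  rw [h0, contract10_apply, h3, theta_apply, theta_apply]
  simp only [Matrix.cons_val_zero, h1, h2, g.hermitian]
  push_cast
  linear_combination (Real.pi * Complex.I * (g.inner p (X p) (X p) : ℂ) / 2) * Complex.I_mul_I

/-- The part of positive degree of `∂bar_X ∂_X (-ω / (2π))` is the `(1, 1)` form `beta`; there is no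
part of degree three since `ω` is closed. -/
theorem posPart_delbarX_delX {g : HermitianMetric E M} (hg : g.IsKahler) (X : VField E M) :
    (delbarX X (delX X (-(2 * Real.pi : ℂ)⁻¹ • g.kahler))).posPart = ofDegree 2 (g.beta X) := by
  rw [delX_kahler hg]
  funext k
  match k with
  | 0 =>
    rw [ofDegree_of_ne (by omega)]
    exact Function.update_self ..
  | 1 =>
    rw [ofDegree_of_ne (by omega), MForm.posPart, Function.update_of_ne (by omega)]
    funext p
    ext v
    change delbar (ofDegree 1 (g.theta X)) 1 p v -
      (2 * Real.pi * Complex.I) * contract10 X (ofDegree 1 (g.theta X)) 1 p v = 0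
    rw [delbar_eq_zero (ofDegree_of_ne (by omega) _),
      contract10_eq_zero X (ofDegree_of_ne (by omega) _)]
    simp
  | 2 =>
    rw [ofDegree_same, MForm.posPart, Function.update_of_ne (by omega)]
    funext p
    ext v
    change g.beta X p v -
      (2 * Real.pi * Complex.I) * contract10 X (ofDegree 1 (g.theta X)) 2 p v = g.beta X p v
    rw [contract10_eq_zero X (ofDegree_of_ne (by omega) _)]
    simp
  | k + 3 =>
    rw [ofDegree_of_ne (by omega), MForm.posPart, Function.update_of_ne (by omega)]
    funext p
    ext v
    change delbar (ofDegree 1 (g.theta X)) (k + 3) p v -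
      (2 * Real.pi * Complex.I) * contract10 X (ofDegree 1 (g.theta X)) (k + 3) p v = 0
    rw [delbar_eq_zero (ofDegree_of_ne (by omega) _),
      contract10_eq_zero X (ofDegree_of_ne (by omega) _)]
    simp

/-- The coefficient of `t ^ (-(m + 1))` in `d_t`, up to the exponential factor. -/
def coeffForm (g : HermitianMetric E M) (X : VField E M) (m : ℕ) : MForm E M :=
  ((2 * Real.pi : ℂ)⁻¹ * (2 * Real.pi * Complex.I : ℂ)⁻¹ ^ m * (m.factorial : ℂ)⁻¹) •
    g.kahler.mul ((ofDegree 2 (g.beta X)).pow m)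

/-- The top degree part of `η ∧ d_t` is an exponential times a polynomial in `1 / t`. -/
theorem mul_dForm_apply {g : HermitianMetric E M} (hg : g.IsKahler) (X : VField E M)
    (η : MForm E M) (t : ℝ) (n : ℕ) (p : M) :
    (η.mul (g.dForm X t)) (n * 2) p =
      Complex.exp (-((g.inner p (X p) (X p) / (2 * t) : ℝ) : ℂ)) •
        ∑ m ∈ Finset.range n, ((t : ℂ)⁻¹ ^ (m + 1)) • (η.mul (g.coeffForm X m)) (n * 2) p := by
  set A := delbarX X (delX X (-(2 * Real.pi : ℂ)⁻¹ • g.kahler)) with hA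
  have hexp : Complex.exp ((2 * Real.pi * Complex.I * t : ℂ)⁻¹ * A.fn p) =
      Complex.exp (-((g.inner p (X p) (X p) / (2 * t) : ℝ) : ℂ)) := by
    congr 1
    rw [hA, fn_delbarX_delX hg]
    have h1 : (Real.pi : ℂ) ≠ 0 := by exact_mod_cast Real.pi_ne_zero
    rcases eq_or_ne t 0 with rfl | ht
    · simp
    have h2 : (t : ℂ) ≠ 0 := by exact_mod_cast ht
    push_cast
    field_simp
  have h1 : ∀ k ≤ n * 2, g.dForm X t k p =
      Complex.exp (-((g.inner p (X p) (X p) / (2 * t) : ℝ) : ℂ)) •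
        ∑ m ∈ Finset.range (n * 2 + 1), ((t : ℂ)⁻¹ ^ (m + 1)) • g.coeffForm X m k p := by
    intro k hk
    rw [dForm, ← hexp]
    have := mul_sum_right (Finset.range (n * 2 + 1))
      (Complex.exp ((2 * Real.pi * Complex.I * t : ℂ)⁻¹ * A.fn p))
      (fun m => ((2 * Real.pi * Complex.I * t : ℂ)⁻¹) ^ m * (m.factorial : ℂ)⁻¹)
      ((2 * Real.pi * t : ℂ)⁻¹ • g.kahler)
      (MForm.exp ((2 * Real.pi * Complex.I * t : ℂ)⁻¹ • A))
      (fun m => (ofDegree 2 (g.beta X)).pow m) (m := k) (p := p)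
      (fun j hj => exp_smul_of_posPart_eq (posPart_delbarX_delX hg X) _ (hj.trans hk) p)
    refine this.trans ?_
    congr 1
    refine Finset.sum_congr rfl fun m _ => ?_
    rw [smul_mul]
    ext v
    change (_ * _) * ((2 * Real.pi * t : ℂ)⁻¹ * _) = _ * ((_ * _ * _) * _)
    simp only [mul_inv, mul_pow, pow_succ]
    ring
  have h2 := mul_sum_right (Finset.range (n * 2 + 1)) _ (fun m => (t : ℂ)⁻¹ ^ (m + 1)) η
    (g.dForm X t) (fun m => g.coeffForm X m) h1
  rw [h2]
  congr 1
  symm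
  refine Finset.sum_subset (Finset.range_mono (by omega)) fun m _ hm => ?_
  have h3 : (η.mul (g.coeffForm X m)) (n * 2) p = 0 := by
    refine mul_eq_zero_of_right fun k hk => ?_
    have h4 : g.kahler.mul ((ofDegree 2 (g.beta X)).pow m) k p = 0 := by
      rcases lt_or_ge k 2 with hk2 | hk2
      · exact ofDegree_mul_of_lt hk2 _ _ _
      · obtain ⟨l, rfl⟩ := Nat.exists_eq_add_of_le hk2
        rw [kahler, ofDegree_mul rfl, pow_ofDegree_two_of_ne _ (by simp at hm; omega)]
        exact wedge_zero_right _ _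
    ext v
    change _ * g.kahler.mul ((ofDegree 2 (g.beta X)).pow m) k p v = 0
    rw [h4]
    simp
  rw [h3]
  ext v
  exact mul_zero _

end HermitianMetric

/-! ### The curvature term at a zero of the vector field -/

namespace HermitianMetric

open MForm

variable {E : Type*} [NormedAddCommGroup E] [NormedSpace ℂ E] [FiniteDimensional ℂ E]
  {M : Type*} [TopologicalSpace M] [ChartedSpace E M] [IsManifold 𝓘(ℂ, E) ω M]

theorem smooth_kahlerForm (g : HermitianMetric E M) : g.kahlerForm.Smooth := by
  rw [DForm.smooth_iff]
  intro c v
  have h := Complex.ofRealCLM.contDiff.comp_contDiffOn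
    (g.contDiffOn_inChart c (Complex.I • v 0) (v 1))
  refine h.congr fun y hy => ?_
  change ((g.inner _ (complexStructure _ (frame c y (v 0))) (frame c y (v 1)) : ℝ) : ℂ) = _
  rw [← frame_I_smul hy]
  rfl

theorem smooth_kahler (g : HermitianMetric E M) : g.kahler.Smooth :=
  smooth_ofDegree g.smooth_kahlerForm

theorem smooth_theta (g : HermitianMetric E M) {X : VField E M} (hX : X.Smooth) :
    (g.theta X).Smooth :=
  (Smooth.smul (Smooth.contract01 hX g.smooth_kahler) Complex.I) 1

theorem smooth_beta (g : HermitianMetric E M) {X : VField E M} (hX : X.Smooth) :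
    (g.beta X).Smooth :=
  (Smooth.delbar (smooth_ofDegree (g.smooth_theta hX))) 2

theorem smooth_coeffForm (g : HermitianMetric E M) {X : VField E M} (hX : X.Smooth) (m : ℕ) :
    (g.coeffForm X m).Smooth :=
  Smooth.smul (g.smooth_kahler.mul (Smooth.pow (smooth_ofDegree (g.smooth_beta hX)) m)) _

theorem inChart_theta (g : HermitianMetric E M) (X : VField E M) {c : M} {y : E}
    (hy : y ∈ (chartAt E c).target) (v : Fin 1 → E) :
    (g.theta X).inChart c y v =
      Complex.I / 2 * (g.gram c y (Complex.I • X.inChart c y) (v 0) : ℝ) +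
        1 / 2 * (g.gram c y (X.inChart c y) (v 0) : ℝ) := by
  change g.theta X _ (fun i => frame c y (v i)) = _
  rw [theta_apply, ← frame_inChart X hy, ← frame_I_smul hy]
  rfl

theorem _root_.KahlerForms.VField.IsHolomorphic.differentiableAt {X : VField E M}
    (hX : X.IsHolomorphic) {c : M} {y : E} (hy : y ∈ (chartAt E c).target) :
    DifferentiableAt ℂ (X.inChart c) y :=
  ((hX.contDiffOn c).contDiffAt ((chartAt E c).open_target.mem_nhds hy)).differentiableAt (by simp)

/-- The derivative of a metric expression `g (L X, w)` at a zero of `X`. -/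
theorem hasFDerivAt_gram_at_zero (g : HermitianMetric E M) {X : VField E M} {c : M} {y : E}
    (hy : y ∈ (chartAt E c).target) (hX : DifferentiableAt ℝ (X.inChart c) y)
    (h0 : X.inChart c y = 0) (L : E →L[ℝ] E) (w : E) :
    HasFDerivAt (fun z => g.gram c z (L (X.inChart c z)) w)
      (((g.gram c y).flip w).comp (L.comp (fderiv ℝ (X.inChart c) y))) y := by
  have hG : HasFDerivAt (g.gram c) (fderiv ℝ (g.gram c) y) y :=
    (((g.contDiffOn_gram c).contDiffAt ((chartAt E c).open_target.mem_nhds hy)).differentiableAt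
      (by simp)).hasFDerivAt
  have hL : HasFDerivAt (fun z => L (X.inChart c z)) (L.comp (fderiv ℝ (X.inChart c) y)) y :=
    L.hasFDerivAt.comp y hX.hasFDerivAt
  have h := (hG.clm_apply hL).clm_apply (hasFDerivAt_const w y)
  refine h.congr_fderiv ?_
  ext u
  simp [h0]

/-- The skew-symmetry of the linearization of a Killing field at a zero. -/
theorem IsKilling.skew {g : HermitianMetric E M} {X : VField E M} (hXg : g.IsKilling X)
    {c : M} {y : E} (hy : y ∈ (chartAt E c).target) (h0 : X.inChart c y = 0) (u v : E) :
    g.gram c y (fderiv ℝ (X.inChart c) y u) v = -g.gram c y u (fderiv ℝ (X.inChart c) y v) := by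
  have := hXg c y hy u v
  rw [h0, map_zero] at this
  simp only [← gram_apply] at this
  linarith

/-- At a zero of `X` with linearization `A`, the `(1, 1)` form `beta` is `g (A u, v)`. -/
theorem inChart_beta (g : HermitianMetric E M) {X : VField E M} (hX : X.IsHolomorphic)
    (hXg : g.IsKilling X) {c : M} {y : E} (hy : y ∈ (chartAt E c).target)
    (h0 : X.inChart c y = 0) (v : Fin 2 → E) :
    (g.beta X).inChart c y v = (g.gram c y (fderiv ℝ (X.inChart c) y (v 0)) (v 1) : ℝ) := by
  set A := fderiv ℝ (X.inChart c) y with hA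
  have hXd := hX.differentiableAt (c := c) hy
  have hAI : ∀ u, A (Complex.I • u) = Complex.I • A u := fun u => by
    rw [hA, hXd.fderiv_restrictScalars ℝ]
    exact (fderiv ℂ (X.inChart c) y).map_smul Complex.I u
  have hsm := hX.smooth
  have hθ := g.smooth_theta hsm
  have hAs : ∀ u v, g.gram c y (A u) v = -g.gram c y u (A v) := hXg.skew hy h0
  -- the derivative of `theta` in the chart
  let T : E → E → ℂ := fun u w => Complex.I / 2 * (g.gram c y (Complex.I • A u) w : ℝ) +
    1 / 2 * (g.gram c y (A u) w : ℝ)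
  have hnhds := (chartAt E c).open_target.mem_nhds hy
  have hθd : DifferentiableAt ℝ ((g.theta X).inChart c) y :=
    ((hθ c).contDiffAt hnhds).differentiableAt (by simp)
  let J : E →L[ℝ] E := Complex.I • ContinuousLinearMap.id ℝ E
  have hT : ∀ (u : E) (w : Fin 1 → E), fderiv ℝ (fun z => (g.theta X).inChart c z w) y u =
      T u (w 0) := by
    intro u w
    have e1 : (fun z => (g.theta X).inChart c z w) =ᶠ[𝓝 y] fun z =>
        Complex.I / 2 * (g.gram c z (J (X.inChart c z)) (w 0) : ℝ) +
        1 / 2 * (g.gram c z (ContinuousLinearMap.id ℝ E (X.inChart c z)) (w 0) : ℝ) := by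
      filter_upwards [hnhds] with z hz
      exact g.inChart_theta X hz w
    have hr := hXd.restrictScalars ℝ
    have d1 := (Complex.ofRealCLM.hasFDerivAt.comp y
      (g.hasFDerivAt_gram_at_zero hy hr h0 J (w 0))).const_mul (Complex.I / 2)
    have d2 := (Complex.ofRealCLM.hasFDerivAt.comp y
      (g.hasFDerivAt_gram_at_zero hy hr h0 (ContinuousLinearMap.id ℝ E) (w 0))).const_mul
        (1 / 2 : ℂ)
    rw [e1.fderiv_eq]
    exact DFunLike.congr_fun ((d1.add d2).fderiv) u
  have hd : ∀ w : Fin 2 → E, (DForm.extDer (g.theta X)).inChart c y w =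
      T (w 0) (w 1) - T (w 1) (w 0) := by
    intro w
    rw [DForm.inChart_extDer hθ hy, extDeriv_apply hθd]
    simp only [hT]
    simp [Fin.removeNth]
    ring
  have hθJ : DForm.Smooth (pullJ (ofDegree 1 (g.theta X)) 1) :=
    (Smooth.pullJ (smooth_ofDegree hθ)) 1
  have hθJd : DifferentiableAt ℝ ((pullJ (ofDegree 1 (g.theta X)) 1).inChart c) y :=
    ((hθJ c).contDiffAt hnhds).differentiableAt (by simp)
  have hTJ : ∀ (u : E) (w : Fin 1 → E),
      fderiv ℝ (fun z => (pullJ (ofDegree 1 (g.theta X)) 1).inChart c z w) y u =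
      T u (Complex.I • w 0) := by
    intro u w
    have e1 : (fun z => (pullJ (ofDegree 1 (g.theta X)) 1).inChart c z w) =ᶠ[𝓝 y] fun z =>
        (g.theta X).inChart c z (fun i => Complex.I • w i) := by
      filter_upwards [hnhds] with z hz
      rw [inChart_pullJ _ _ hz, ofDegree_same]
    rw [e1.fderiv_eq, hT]
  have hdc : ∀ w : Fin 2 → E, (dc (ofDegree 1 (g.theta X)) 2).inChart c y w =
      T (-(Complex.I • w 0)) (Complex.I • -(Complex.I • w 1)) -
        T (-(Complex.I • w 1)) (Complex.I • -(Complex.I • w 0)) := by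
    intro w
    rw [dc, inChart_pullJInv _ _ hy]
    change (DForm.extDer (pullJ (ofDegree 1 (g.theta X)) 1)).inChart c y _ = _
    rw [DForm.inChart_extDer hθJ hy, extDeriv_apply hθJd]
    simp only [hTJ]
    simp [Fin.removeNth]
    ring
  have hb : (g.beta X).inChart c y v = 1 / 2 * ((DForm.extDer (g.theta X)).inChart c y v -
      Complex.I * (dc (ofDegree 1 (g.theta X)) 2).inChart c y v) := by
    have h1 : d (ofDegree 1 (g.theta X)) 2 = DForm.extDer (g.theta X) := by
      change DForm.extDer (ofDegree 1 (g.theta X) 1) = _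
      rw [ofDegree_same]
    rw [← h1]
    rfl
  have hII : ∀ u : E, Complex.I • Complex.I • u = -u := fun u => by
    rw [smul_smul, Complex.I_mul_I, neg_one_smul]
  have hsk1 : g.gram c y (A (v 1)) (v 0) = -g.gram c y (A (v 0)) (v 1) := by
    rw [hAs, gram_symm]
  have hsk2 : g.gram c y (Complex.I • A (v 1)) (v 0) = g.gram c y (Complex.I • A (v 0)) (v 1) := by
    rw [← g.gram_I_smul hy, hII, map_neg, neg_apply, hAs, hAI, neg_neg, gram_symm]
  rw [hb, hd, hdc]
  simp only [T, smul_neg, hII, map_neg, neg_apply, neg_neg, hAI, hsk1, hsk2]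
  push_cast
  linear_combination (-(1 / 2) * (g.gram c y (A (v 0)) (v 1) : ℂ)) * Complex.I_mul_I

end HermitianMetric

/-! ### Isolated zeros of Killing fields are nondegenerate -/

section Killing

variable {E : Type*} [NormedAddCommGroup E] [NormedSpace ℝ E] [FiniteDimensional ℝ E]

/-- A positive definite bilinear form on a finite dimensional space is an isomorphism to the dual. -/
theorem exists_equiv_of_pos {B : E →L[ℝ] E →L[ℝ] ℝ} (hB : ∀ u, u ≠ 0 → 0 < B u u) :
    ∃ e : E ≃L[ℝ] (E →L[ℝ] ℝ), (e : E →L[ℝ] E →L[ℝ] ℝ) = B := by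
  have hinj : Function.Injective (B : E →ₗ[ℝ] E →L[ℝ] ℝ) := by
    rw [injective_iff_map_eq_zero]
    intro u hu
    by_contra h
    have h1 := hB u h
    have h2 : B u = 0 := hu
    rw [h2] at h1
    simp at h1
  have hdim : Module.finrank ℝ E = Module.finrank ℝ (E →L[ℝ] ℝ) := by
    rw [← (LinearMap.toContinuousLinearMap : (E →ₗ[ℝ] ℝ) ≃ₗ[ℝ] (E →L[ℝ] ℝ)).finrank_eq]
    exact (Subspace.dual_finrank_eq (K := ℝ) (V := E)).symm
  refine ⟨(LinearEquiv.ofInjectiveOfFinrankEq (B : E →ₗ[ℝ] E →L[ℝ] ℝ) hinj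
    hdim).toContinuousLinearEquiv, ?_⟩
  ext u v
  rfl

theorem norm_apply_three_le (B : E →L[ℝ] E →L[ℝ] E →L[ℝ] ℝ) (a b c : E) :
    ‖B a b c‖ ≤ ‖B‖ * ‖a‖ * ‖b‖ * ‖c‖ :=
  ((B a).le_opNorm₂ b c).trans (by gcongr; exact B.le_opNorm a)

theorem norm_apply_four_le (B : E →L[ℝ] E →L[ℝ] E →L[ℝ] E →L[ℝ] ℝ) (a b c d : E) :
    ‖B a b c d‖ ≤ ‖B‖ * ‖a‖ * ‖b‖ * ‖c‖ * ‖d‖ :=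
  (norm_apply_three_le (B a) b c d).trans (by gcongr; exact B.le_opNorm a)

theorem contDiffAt_flip {D F : Type*} [NormedAddCommGroup D] [NormedSpace ℝ D]
    [NormedAddCommGroup F] [NormedSpace ℝ F] {f : D → E →L[ℝ] E →L[ℝ] F} {n : ℕ∞ω} {p : D}
    (hf : ContDiffAt ℝ n f p) : ContDiffAt ℝ n (fun q => (f q).flip) p :=
  (ContinuousLinearMap.flipₗᵢ ℝ E E F).contDiff.contDiffAt.comp p hf

theorem _root_.ContinuousAt.eventually_norm_le {T F : Type*} [TopologicalSpace T]
    [SeminormedAddCommGroup F] {f : T → F} {t : T} (hf : ContinuousAt f t) :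
    ∀ᶠ s in 𝓝 t, ‖f s‖ ≤ ‖f t‖ + 1 :=
  (hf.norm.eventually (eventually_lt_nhds (lt_add_one _))).mono fun _ h => h.le

variable {G : E → E →L[ℝ] E →L[ℝ] ℝ} {X : E → E} {U : Set E}

/-- The covector `w ↦ ½ (D_w g)(u, u) - (D_u g)(u, w)`, which is `g (γ'', w)` for a geodesic `γ` with
velocity `u`. -/
def geodesicForce (G : E → E →L[ℝ] E →L[ℝ] ℝ) (p : E × E) : E →L[ℝ] ℝ :=
  (1 / 2 : ℝ) • ((fderiv ℝ G p.1).flip p.2).flip p.2 - fderiv ℝ G p.1 p.2 p.2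

/-- The acceleration of a geodesic with given position and velocity. -/
def geodesicAcceleration (G : E → E →L[ℝ] E →L[ℝ] ℝ) (p : E × E) : E :=
  (G p.1).inverse (geodesicForce G p)

theorem geodesicForce_apply (p : E × E) (w : E) :
    geodesicForce G p w = 1 / 2 * fderiv ℝ G p.1 w p.2 p.2 - fderiv ℝ G p.1 p.2 p.2 w := by
  simp [geodesicForce]

theorem apply_geodesicAcceleration (hpos : ∀ y ∈ U, ∀ u, u ≠ 0 → 0 < G y u u) {p : E × E}
    (hp : p.1 ∈ U) (w : E) : G p.1 (geodesicAcceleration G p) w =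
      1 / 2 * fderiv ℝ G p.1 w p.2 p.2 - fderiv ℝ G p.1 p.2 p.2 w := by
  obtain ⟨e, he⟩ := exists_equiv_of_pos (hpos _ hp)
  rw [geodesicAcceleration, ← he, ContinuousLinearMap.inverse_equiv, ← geodesicForce_apply]
  simp

theorem contDiffAt_geodesicAcceleration (hU : IsOpen U) (hG : ContDiffOn ℝ ∞ G U)
    (hpos : ∀ y ∈ U, ∀ u, u ≠ 0 → 0 < G y u u) {p : E × E} (hp : p.1 ∈ U) :
    ContDiffAt ℝ 1 (geodesicAcceleration G) p := by
  have hGp : ContDiffAt ℝ 2 G p.1 := (hG.contDiffAt (hU.mem_nhds hp)).of_le (by norm_cast)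
  obtain ⟨e, he⟩ := exists_equiv_of_pos (hpos _ hp)
  have h1 : ContDiffAt ℝ 1 (fun q : E × E => (G q.1).inverse) p := by
    have := contDiffAt_map_inverse (𝕜 := ℝ) (n := 1) e
    rw [he] at this
    exact this.comp p ((hGp.of_le (by norm_num)).comp p contDiffAt_fst)
  have hD : ContDiffAt ℝ 1 (fun q : E × E => fderiv ℝ G q.1) p :=
    (hGp.fderiv_right (m := 1) (by norm_num)).comp p contDiffAt_fst
  have h2 : ContDiffAt ℝ 1 (geodesicForce G) p := by
    refine ContDiffAt.sub (ContDiffAt.const_smul _ ?_) ?_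
    · exact (contDiffAt_flip ((contDiffAt_flip hD).clm_apply contDiffAt_snd)).clm_apply contDiffAt_snd
    · exact (hD.clm_apply contDiffAt_snd).clm_apply contDiffAt_snd
  exact h1.clm_apply h2

/-- The second derivative of a Killing field along a geodesic is determined, in a linear way, by its
value and its first derivative: the Jacobi equation, with lowered index. -/
theorem killing_second_derivative (hU : IsOpen U) (hG : ContDiffOn ℝ ∞ G U)
    (hX : ContDiffOn ℝ ∞ X U) (hsymm : ∀ y u v, G y u v = G y v u)
    (hK : ∀ y ∈ U, ∀ u v, fderiv ℝ (fun z => G z u v) y (X y) + G y (fderiv ℝ X y u) v +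
      G y u (fderiv ℝ X y v) = 0) {y : E} (hy : y ∈ U) (u a w : E)
    (ha : ∀ w, G y a w = 1 / 2 * fderiv ℝ G y w u u - fderiv ℝ G y u u w) :
    G y (fderiv ℝ (fderiv ℝ X) y u u + fderiv ℝ X y a) w =
      -fderiv ℝ (fderiv ℝ G) y u (X y) u w - fderiv ℝ G y (fderiv ℝ X y u) u w
      - fderiv ℝ G y u (fderiv ℝ X y u) w + 1 / 2 * fderiv ℝ (fderiv ℝ G) y w (X y) u u
      + fderiv ℝ G y w (fderiv ℝ X y u) u - fderiv ℝ G y (X y) a w := by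
  have hGy : ∀ {z}, z ∈ U → ContDiffAt ℝ 2 G z := fun hz =>
    (hG.contDiffAt (hU.mem_nhds hz)).of_le (by norm_cast)
  have hXy : ContDiffAt ℝ 2 X y := (hX.contDiffAt (hU.mem_nhds hy)).of_le (by norm_cast)
  have hsB := hXy.isSymmSndFDerivAt (by simp)
  have hsG : ∀ p q r, fderiv ℝ G y r p q = fderiv ℝ G y r q p := by
    intro p q r
    have hd := ((hGy hy).differentiableAt (by norm_num)).hasFDerivAt
    have e1 := (hd.clm_apply (hasFDerivAt_const p y)).clm_apply (hasFDerivAt_const q y)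
    have e2 := (hd.clm_apply (hasFDerivAt_const q y)).clm_apply (hasFDerivAt_const p y)
    have e3 : (fun z => G z p q) = fun z => G z q p := funext fun z => hsymm z p q
    rw [e3] at e1
    have := DFunLike.congr_fun (e1.unique e2) r
    simpa using this
  have hK' : ∀ z ∈ U, ∀ p q, fderiv ℝ G z (X z) p q + G z (fderiv ℝ X z p) q +
      G z p (fderiv ℝ X z q) = 0 := by
    intro z hz p q
    rw [← hK z hz p q]
    congr 2
    have hd := ((hGy hz).differentiableAt (by norm_num)).hasFDerivAt
    have e1 := (hd.clm_apply (hasFDerivAt_const p z)).clm_apply (hasFDerivAt_const q z)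
    rw [e1.fderiv]
    simp
  have hD : ∀ p q r, fderiv ℝ (fderiv ℝ G) y r (X y) p q + fderiv ℝ G y (fderiv ℝ X y r) p q +
      fderiv ℝ G y r (fderiv ℝ X y p) q + G y (fderiv ℝ (fderiv ℝ X) y r p) q +
      fderiv ℝ G y r p (fderiv ℝ X y q) + G y p (fderiv ℝ (fderiv ℝ X) y r q) = 0 := by
    intro p q r
    have dG := ((hGy hy).differentiableAt (by norm_num)).hasFDerivAt
    have dX := (hXy.differentiableAt (by norm_num)).hasFDerivAt
    have dG2 := (((hGy hy).fderiv_right (m := 1) (by norm_num)).differentiableAt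
      (by norm_num)).hasFDerivAt
    have dX2 := ((hXy.fderiv_right (m := 1) (by norm_num)).differentiableAt
      (by norm_num)).hasFDerivAt
    have cp := hasFDerivAt_const (𝕜 := ℝ) p y
    have cq := hasFDerivAt_const (𝕜 := ℝ) q y
    have e1 := ((dG2.clm_apply dX).clm_apply cp).clm_apply cq
    have e2 := (dG.clm_apply (dX2.clm_apply cp)).clm_apply cq
    have e3 := (dG.clm_apply cp).clm_apply (dX2.clm_apply cq)
    have e4 := (e1.add e2).add e3
    have e5 : (fun z => fderiv ℝ G z (X z) p q + G z (fderiv ℝ X z p) q +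
      G z p (fderiv ℝ X z q)) =ᶠ[𝓝 y] fun _ => 0 := by
      filter_upwards [hU.mem_nhds hy] with z hz
      exact hK' z hz p q
    have e6 := (e4.congr_of_eventuallyEq e5.symm).unique (hasFDerivAt_const (0 : ℝ) y)
    have e7 := DFunLike.congr_fun e6 r
    simp at e7
    linarith
  have k1 := hD u w u
  have k2 := hD u u w
  have k3 := hK' y hy a w
  have k4 := ha (fderiv ℝ X y w)
  rw [hsB w u, hsymm y (fderiv ℝ (fderiv ℝ X) y u w) u, hsG u (fderiv ℝ X y u) w] at k2
  simp only [map_add, add_apply]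
  linarith

/-- A quantitative form of `killing_second_derivative`. -/
theorem norm_killing_second_derivative_le (hU : IsOpen U) (hG : ContDiffOn ℝ ∞ G U)
    (hX : ContDiffOn ℝ ∞ X U) (hsymm : ∀ y u v, G y u v = G y v u)
    (hpos : ∀ y ∈ U, ∀ u, u ≠ 0 → 0 < G y u u)
    (hK : ∀ y ∈ U, ∀ u v, fderiv ℝ (fun z => G z u v) y (X y) + G y (fderiv ℝ X y u) v +
      G y u (fderiv ℝ X y v) = 0) {y : E} (hy : y ∈ U) (u : E) {C N : ℝ} (hC : 0 ≤ C)
    (b2 : ‖fderiv ℝ (fderiv ℝ G) y‖ ≤ C) (b1 : ‖fderiv ℝ G y‖ ≤ C) (bu : ‖u‖ ≤ C)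
    (ba : ‖geodesicAcceleration G (y, u)‖ ≤ C) (bi : ‖(G y).inverse‖ ≤ C)
    (hY : ‖X y‖ ≤ N) (hZ : ‖fderiv ℝ X y u‖ ≤ N) :
    ‖fderiv ℝ (fderiv ℝ X) y u u + fderiv ℝ X y (geodesicAcceleration G (y, u))‖ ≤
      C * ((6 * C ^ 3 + 6 * C ^ 2) * N) := by
  have hN : 0 ≤ N := (norm_nonneg _).trans hY
  set a := geodesicAcceleration G (y, u) with ha
  set D := fderiv ℝ (fderiv ℝ X) y u u + fderiv ℝ X y a with hD
  have hGD : ‖G y D‖ ≤ (6 * C ^ 3 + 6 * C ^ 2) * N := by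
    refine ContinuousLinearMap.opNorm_le_bound _ (by positivity) fun w => ?_
    have key := killing_second_derivative hU hG hX hsymm hK hy u a w
      (fun w => apply_geodesicAcceleration (p := (y, u)) hpos hy w)
    rw [hD, key]
    have t1 : ‖fderiv ℝ (fderiv ℝ G) y u (X y) u w‖ ≤ C * C * N * C * ‖w‖ :=
      (norm_apply_four_le _ _ _ _ _).trans (by gcongr)
    have t2 : ‖fderiv ℝ G y (fderiv ℝ X y u) u w‖ ≤ C * N * C * ‖w‖ :=
      (norm_apply_three_le _ _ _ _).trans (by gcongr)
    have t3 : ‖fderiv ℝ G y u (fderiv ℝ X y u) w‖ ≤ C * C * N * ‖w‖ :=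
      (norm_apply_three_le _ _ _ _).trans (by gcongr)
    have t4 : ‖fderiv ℝ (fderiv ℝ G) y w (X y) u u‖ ≤ C * ‖w‖ * N * C * C :=
      (norm_apply_four_le _ _ _ _ _).trans (by gcongr)
    have t5 : ‖fderiv ℝ G y w (fderiv ℝ X y u) u‖ ≤ C * ‖w‖ * N * C :=
      (norm_apply_three_le _ _ _ _).trans (by gcongr)
    have t6 : ‖fderiv ℝ G y (X y) a w‖ ≤ C * N * C * ‖w‖ :=
      (norm_apply_three_le _ _ _ _).trans (by gcongr)
    have p3 : 0 ≤ C ^ 3 * N * ‖w‖ := by positivity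
    have p2 : 0 ≤ C ^ 2 * N * ‖w‖ := by positivity
    rw [Real.norm_eq_abs, abs_le] at t1 t2 t3 t4 t5 t6
    rw [Real.norm_eq_abs, abs_le]
    generalize fderiv ℝ (fderiv ℝ G) y u (X y) u w = x1 at *
    generalize fderiv ℝ G y (fderiv ℝ X y u) u w = x2 at *
    generalize fderiv ℝ G y u (fderiv ℝ X y u) w = x3 at *
    generalize fderiv ℝ (fderiv ℝ G) y w (X y) u u = x4 at *
    generalize fderiv ℝ G y w (fderiv ℝ X y u) u = x5 at *
    generalize fderiv ℝ G y (X y) a w = x6 at *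
    have e : (6 * C ^ 3 + 6 * C ^ 2) * N * ‖w‖ =
      6 * (C ^ 3 * N * ‖w‖) + 6 * (C ^ 2 * N * ‖w‖) := by ring
    have e1 : C * C * N * C * ‖w‖ = C ^ 3 * N * ‖w‖ := by ring
    have e2 : C * N * C * ‖w‖ = C ^ 2 * N * ‖w‖ := by ring
    have e3 : C * C * N * ‖w‖ = C ^ 2 * N * ‖w‖ := by ring
    have e4 : C * ‖w‖ * N * C * C = C ^ 3 * N * ‖w‖ := by ring
    have e5 : C * ‖w‖ * N * C = C ^ 2 * N * ‖w‖ := by ring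
    rw [e1] at t1
    rw [e2] at t2 t6
    rw [e3] at t3
    rw [e4] at t4
    rw [e5] at t5
    rw [e]
    constructor <;> linarith [t1.1, t1.2, t2.1, t2.2, t3.1, t3.2, t4.1, t4.2, t5.1, t5.2, t6.1, t6.2]
  have hDt : D = (G y).inverse (G y D) := by
    obtain ⟨e, he⟩ := exists_equiv_of_pos (hpos _ hy)
    rw [← he, ContinuousLinearMap.inverse_equiv]
    simp
  rw [hDt]
  exact ((G y).inverse.le_opNorm _).trans (by gcongr)

/-- A field with a degenerate zero, which is Killing for some metric, has other zeros nearby: it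
vanishes along the geodesics tangent to the kernel of its linearization, by the Jacobi equation. -/
theorem killing_zero_not_isolated (hU : IsOpen U) (hG : ContDiffOn ℝ ∞ G U)
    (hX : ContDiffOn ℝ ∞ X U) (hsymm : ∀ y u v, G y u v = G y v u)
    (hpos : ∀ y ∈ U, ∀ u, u ≠ 0 → 0 < G y u u)
    (hK : ∀ y ∈ U, ∀ u v, fderiv ℝ (fun z => G z u v) y (X y) + G y (fderiv ℝ X y u) v +
      G y u (fderiv ℝ X y v) = 0) {y : E} (hy : y ∈ U) (h0 : X y = 0) {v : E} (hv : v ≠ 0)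
    (hAv : fderiv ℝ X y v = 0) : ∃ᶠ z in 𝓝[≠] y, X z = 0 := by
  have : CompleteSpace E := FiniteDimensional.complete ℝ E
  -- the geodesic with initial velocity `v`
  have hW : ContDiffAt ℝ 1 (fun p : E × E => (p.2, geodesicAcceleration G p)) (y, v) :=
    contDiffAt_snd.prodMk (contDiffAt_geodesicAcceleration hU hG hpos hy)
  obtain ⟨α, hα0, ε, hε, hα⟩ :=
    hW.exists_forall_mem_closedBall_exists_eq_forall_mem_Ioo_hasDerivAt₀ 0
  rw [zero_sub, zero_add] at hα
  have hα00 := hα 0 ⟨by linarith, hε⟩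
  have hc0 : ContinuousAt α 0 := hα00.continuousAt
  have hUev : ∀ᶠ t in 𝓝 (0 : ℝ), (α t).1 ∈ U := by
    have : ContinuousAt (fun t => (α t).1) 0 := continuousAt_fst.comp hc0
    exact this.preimage_mem_nhds (by rw [hα0]; exact hU.mem_nhds hy)
  let D : ℝ → E := fun t => fderiv ℝ (fderiv ℝ X) (α t).1 (α t).2 (α t).2 +
    fderiv ℝ X (α t).1 (geodesicAcceleration G (α t))
  -- the field and its derivative along the geodesic
  let f : ℝ → E × E := fun t => (X (α t).1, fderiv ℝ X (α t).1 (α t).2)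
  have hf : ∀ t ∈ Ioo (-ε) ε, (α t).1 ∈ U → HasDerivAt f ((f t).2, D t) t := by
    intro t ht hUt
    have h1 : HasDerivAt (fun t => (α t).1) (α t).2 t := (hα t ht).fst
    have h2 : HasDerivAt (fun t => (α t).2) (geodesicAcceleration G (α t)) t := (hα t ht).snd
    have hXt : ContDiffAt ℝ 2 X (α t).1 := (hX.contDiffAt (hU.mem_nhds hUt)).of_le (by norm_cast)
    have dX := (hXt.differentiableAt (by norm_num)).hasFDerivAt
    have dX2 := ((hXt.fderiv_right (m := 1) (by norm_num)).differentiableAt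
      (by norm_num)).hasFDerivAt
    have h3 : HasDerivAt (fun s => X (α s).1) (fderiv ℝ X (α t).1 (α t).2) t :=
      HasFDerivAt.comp_hasDerivAt (f := fun s => (α s).1) t dX h1
    have h5 : HasDerivAt (fun s => fderiv ℝ X (α s).1)
        (fderiv ℝ (fderiv ℝ X) (α t).1 (α t).2) t :=
      HasFDerivAt.comp_hasDerivAt (f := fun s => (α s).1) t dX2 h1
    have h4 : HasDerivAt (fun s => fderiv ℝ X (α s).1 (α s).2) (D t) t := h5.clm_apply h2
    exact h3.prodMk h4
  -- the coefficients of the Jacobi equation are bounded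
  have hG0 : ContDiffAt ℝ 2 G (α 0).1 := by
    rw [hα0]
    exact (hG.contDiffAt (hU.mem_nhds hy)).of_le (by norm_cast)
  have hD1 : ContDiffAt ℝ 1 (fderiv ℝ G) (α 0).1 := hG0.fderiv_right (by norm_num)
  have hD2 : ContDiffAt ℝ 0 (fderiv ℝ (fderiv ℝ G)) (α 0).1 := hD1.fderiv_right (by norm_num)
  have hc1 : ContinuousAt (fun t => (α t).1) 0 := continuousAt_fst.comp hc0
  have hc2 : ContinuousAt (fun t => (α t).2) 0 := continuousAt_snd.comp hc0
  have hacc : ContinuousAt (geodesicAcceleration G) (α 0) := by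
    rw [hα0]
    exact (contDiffAt_geodesicAcceleration hU hG hpos hy).continuousAt
  have hinv : ContinuousAt (fun t => (G (α t).1).inverse) 0 := by
    obtain ⟨e, he⟩ := exists_equiv_of_pos (hpos _ hy)
    have h := (contDiffAt_map_inverse (𝕜 := ℝ) (n := 1) e).continuousAt
    have he' : (e : E →L[ℝ] E →L[ℝ] ℝ) = G (α 0).1 := by rw [he, hα0]
    rw [he'] at h
    exact ContinuousAt.comp (f := fun t => G (α t).1) h
      (ContinuousAt.comp (f := fun t => (α t).1) hG0.continuousAt hc1)
  have n1 : ∀ᶠ t in 𝓝 (0 : ℝ), ‖fderiv ℝ (fderiv ℝ G) (α t).1‖ ≤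
      ‖fderiv ℝ (fderiv ℝ G) (α 0).1‖ + 1 := hc1.eventually hD2.continuousAt.eventually_norm_le
  have n2 : ∀ᶠ t in 𝓝 (0 : ℝ), ‖fderiv ℝ G (α t).1‖ ≤ ‖fderiv ℝ G (α 0).1‖ + 1 :=
    hc1.eventually hD1.continuousAt.eventually_norm_le
  have n3 := hc2.eventually_norm_le
  have n4 : ∀ᶠ t in 𝓝 (0 : ℝ), ‖geodesicAcceleration G (α t)‖ ≤
      ‖geodesicAcceleration G (α 0)‖ + 1 := hc0.eventually hacc.eventually_norm_le
  have n5 := hinv.eventually_norm_le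
  obtain ⟨C, hC0, hCev⟩ : ∃ C : ℝ, 0 ≤ C ∧ ∀ᶠ t in 𝓝 (0 : ℝ),
      ‖fderiv ℝ (fderiv ℝ G) (α t).1‖ ≤ C ∧ ‖fderiv ℝ G (α t).1‖ ≤ C ∧ ‖(α t).2‖ ≤ C ∧
      ‖geodesicAcceleration G (α t)‖ ≤ C ∧ ‖(G (α t).1).inverse‖ ≤ C := by
    refine ⟨_, ?_, (n1.and (n2.and (n3.and (n4.and n5)))).mono fun t ht =>
      ⟨ht.1.trans (le_max_left _ _), ht.2.1.trans ((le_max_left _ _).trans (le_max_right _ _)),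
        ht.2.2.1.trans ((le_max_left _ _).trans ((le_max_right _ _).trans (le_max_right _ _))),
        ht.2.2.2.1.trans ((le_max_left _ _).trans ((le_max_right _ _).trans
          ((le_max_right _ _).trans (le_max_right _ _)))),
        ht.2.2.2.2.trans ((le_max_right _ _).trans ((le_max_right _ _).trans
          ((le_max_right _ _).trans (le_max_right _ _))))⟩⟩
    exact le_max_of_le_left (by positivity)
  obtain ⟨δ, hδ, hball⟩ := Metric.eventually_nhds_iff.mp (hUev.and hCev)
  set r := min δ ε / 2 with hr
  have hr0 : 0 < r := by positivity
  have hrδ : r < δ := by have := min_le_left δ ε; linarith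
  have hrε : r < ε := by have := min_le_right δ ε; linarith
  have hgood : ∀ t ∈ Icc 0 r, t ∈ Ioo (-ε) ε ∧ (α t).1 ∈ U ∧
      ‖fderiv ℝ (fderiv ℝ G) (α t).1‖ ≤ C ∧ ‖fderiv ℝ G (α t).1‖ ≤ C ∧ ‖(α t).2‖ ≤ C ∧
      ‖geodesicAcceleration G (α t)‖ ≤ C ∧ ‖(G (α t).1).inverse‖ ≤ C := by
    intro t ht
    refine ⟨⟨by linarith [ht.1], by linarith [ht.2]⟩, hball ?_⟩
    rw [Real.dist_eq, sub_zero, abs_of_nonneg ht.1]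
    linarith [ht.2]
  have hbound : ∀ t ∈ Ico 0 r, ‖((f t).2, D t)‖ ≤
      (1 + C * (6 * C ^ 3 + 6 * C ^ 2)) * ‖f t‖ + 0 := by
    intro t ht
    obtain ⟨-, hUt, b2, b1, bu, ba, bi⟩ := hgood t (Ico_subset_Icc_self ht)
    have hY : ‖X (α t).1‖ ≤ ‖f t‖ := norm_fst_le (f t)
    have hZ : ‖fderiv ℝ X (α t).1 (α t).2‖ ≤ ‖f t‖ := norm_snd_le (f t)
    have hDb : ‖D t‖ ≤ C * ((6 * C ^ 3 + 6 * C ^ 2) * ‖f t‖) :=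
      norm_killing_second_derivative_le hU hG hX hsymm hpos hK hUt (α t).2 hC0 b2 b1 bu ba bi hY hZ
    have hZ' : ‖(f t).2‖ ≤ ‖f t‖ := norm_snd_le (f t)
    generalize ‖f t‖ = N at *
    have hN0 : 0 ≤ N := (norm_nonneg _).trans hY
    rw [add_zero, Prod.norm_def, max_le_iff]
    have p : 0 ≤ C * (6 * C ^ 3 + 6 * C ^ 2) * N := by positivity
    constructor
    · linarith
    · linarith
  have hzero : ∀ t ∈ Icc 0 r, f t = 0 := by
    intro t ht
    have h := norm_le_gronwallBound_of_norm_deriv_right_le (f := f) (f' := fun t => ((f t).2, D t))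
      (δ := 0) (a := 0) (b := r)
      (fun t ht => (hf t (hgood t ht).1 (hgood t ht).2.1).continuousAt.continuousWithinAt)
      (fun t ht => (hf t (hgood t (Ico_subset_Icc_self ht)).1
        (hgood t (Ico_subset_Icc_self ht)).2.1).hasDerivWithinAt)
      (by simp [f, hα0, h0, hAv]) hbound t ht
    rw [gronwallBound_ε0, zero_mul] at h
    exact norm_le_zero_iff.mp h
  have hne : ∀ᶠ t in 𝓝[>] (0 : ℝ), (α t).1 ≠ y := by
    have h1 : HasDerivAt (fun t => (α t).1) (α 0).2 0 := hα00.fst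
    rw [hα0] at h1
    exact (h1.eventually_ne hv).filter_mono (nhdsWithin_mono _ fun t ht => ne_of_gt ht)
  have htend : Tendsto (fun t => (α t).1) (𝓝[>] 0) (𝓝[≠] y) := by
    refine tendsto_nhdsWithin_iff.mpr ⟨?_, hne⟩
    have := hc1.tendsto
    rw [hα0] at this
    exact this.mono_left nhdsWithin_le_nhds
  refine htend.frequently (Eventually.frequently ?_)
  filter_upwards [Ioo_mem_nhdsGT hr0] with t ht
  exact congrArg Prod.fst (hzero t (Ioo_subset_Icc_self ht))

end Killing

/-! ### Taylor expansion -/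

section Taylor

variable {V F : Type*} [NormedAddCommGroup V] [NormedSpace ℝ V] [NormedAddCommGroup F]
  [NormedSpace ℝ F] [CompleteSpace F]

/-- Taylor's theorem with a bound for the remainder near a point. -/
theorem exists_taylor_bound {f : V → F} {x : V} {n : ℕ} (hf : ContDiffAt ℝ (n + 1) f x) :
    ∃ C : ℝ, 0 ≤ C ∧ ∀ᶠ z in 𝓝 (0 : V), ‖f (x + z) - ∑ k ∈ Finset.range (n + 1),
      (k.factorial : ℝ)⁻¹ • iteratedFDeriv ℝ k f x (fun _ => z)‖ ≤ C * ‖z‖ ^ (n + 1) := by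
  have hev : ∀ᶠ y in 𝓝 x, ContDiffAt ℝ (n + 1) f y ∧
      ‖iteratedFDeriv ℝ (n + 1) f y‖ ≤ ‖iteratedFDeriv ℝ (n + 1) f x‖ + 1 := by
    refine (hf.eventually (by norm_cast; simp)).and ?_
    have h : ContDiffAt ℝ 0 (iteratedFDeriv ℝ (n + 1) f) x :=
      hf.iteratedFDeriv_right (by norm_cast; simp)
    exact h.continuousAt.eventually_norm_le
  obtain ⟨r, hr, hball⟩ := Metric.eventually_nhds_iff.mp hev
  set B := ‖iteratedFDeriv ℝ (n + 1) f x‖ + 1 with hB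
  have hB0 : 0 ≤ B := by positivity
  refine ⟨(n.factorial : ℝ)⁻¹ * B, by positivity, ?_⟩
  filter_upwards [Metric.ball_mem_nhds (0 : V) hr] with z hz
  have hz' : ‖z‖ < r := by simpa using hz
  have hin : ∀ t ∈ Icc (0 : ℝ) 1, dist (x + t • z) x < r := by
    intro t ht
    rw [dist_eq_norm, add_sub_cancel_left, norm_smul, Real.norm_of_nonneg ht.1]
    calc t * ‖z‖ ≤ 1 * ‖z‖ := by gcongr; exact ht.2
      _ < r := by rwa [one_mul]
  have key := map_add_eq_sum_add_integral_iteratedFDeriv (f := f) (x := x) (y := z) (n := n)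
    fun t ht => (hball (hin t ht)).1
  rw [key, add_sub_cancel_left, norm_smul, Real.norm_of_nonneg (by positivity), mul_assoc]
  gcongr
  have := intervalIntegral.norm_integral_le_of_norm_le_const (a := (0 : ℝ)) (b := 1)
    (C := B * ‖z‖ ^ (n + 1))
    (f := fun t : ℝ => (1 - t) ^ n • iteratedFDeriv ℝ (n + 1) f (x + t • z) (fun _ => z)) ?_
  · simpa using this
  · intro t ht
    rw [uIoc_of_le zero_le_one] at ht
    have ht' : t ∈ Icc (0 : ℝ) 1 := Ioc_subset_Icc_self ht
    rw [norm_smul, norm_pow, Real.norm_of_nonneg (by linarith [ht.2])]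
    have h1 : (1 - t) ^ n ≤ 1 := pow_le_one₀ (by linarith [ht.2]) (by linarith [ht.1])
    have h2 : ‖iteratedFDeriv ℝ (n + 1) f (x + t • z) (fun _ => z)‖ ≤ B * ‖z‖ ^ (n + 1) := by
      refine (ContinuousMultilinearMap.le_opNorm _ _).trans ?_
      rw [Finset.prod_const, Finset.card_univ, Fintype.card_fin]
      gcongr
      exact (hball (hin t ht')).2
    calc _ ≤ 1 * (B * ‖z‖ ^ (n + 1)) := by gcongr
      _ = _ := one_mul _

theorem iteratedFDeriv_neg_apply {f : V → F} {x : V} (k : ℕ) (z : V) :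
    iteratedFDeriv ℝ k f x (fun _ => -z) = (-1 : ℝ) ^ k • iteratedFDeriv ℝ k f x (fun _ => z) := by
  have := (iteratedFDeriv ℝ k f x).map_smul_univ (fun _ => (-1 : ℝ)) (fun _ => z)
  simpa using this

theorem eventually_neg_nhds_zero {p : V → Prop} (h : ∀ᶠ z in 𝓝 (0 : V), p z) :
    ∀ᶠ z in 𝓝 (0 : V), p (-z) := by
  have : Tendsto (fun z : V => -z) (𝓝 0) (𝓝 0) := by
    simpa using (continuous_neg (G := V)).tendsto 0
  exact this.eventually h

/-- A function of class `C²` is constant up to a term of first order, and its even part is constant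
up to a term of second order. -/
theorem exists_even_bound {f : V → F} {x : V} (hf : ContDiffAt ℝ 2 f x) :
    ∃ C : ℝ, 0 ≤ C ∧ ∀ᶠ z in 𝓝 (0 : V), ‖f (x + z) - f x‖ ≤ C * ‖z‖ ∧
      ‖f (x + z) + f (x + -z) - (2 : ℝ) • f x‖ ≤ C * ‖z‖ ^ 2 := by
  obtain ⟨C₁, hC₁, h₁⟩ := exists_taylor_bound (n := 0) (hf.of_le (by norm_num))
  obtain ⟨C₂, hC₂, h₂⟩ := exists_taylor_bound (n := 1) (hf.of_le (by norm_num))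
  refine ⟨C₁ + 2 * C₂, by positivity, ?_⟩
  filter_upwards [h₁, h₂, eventually_neg_nhds_zero h₂] with z z₁ z₂ z₃
  simp only [zero_add, Finset.range_one, Finset.sum_singleton, Nat.factorial, Nat.cast_one, inv_one,
    one_smul, iteratedFDeriv_zero_apply, pow_one] at z₁
  rw [Finset.sum_range_succ, Finset.sum_range_one] at z₂ z₃
  rw [iteratedFDeriv_neg_apply 1] at z₃
  simp only [Nat.factorial, Nat.cast_one, inv_one, one_smul, iteratedFDeriv_zero_apply, norm_neg,
    pow_one, neg_smul, mul_one, Nat.reduceAdd, Nat.succ_eq_add_one, zero_add] at z₂ z₃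
  refine ⟨z₁.trans ?_, ?_⟩
  · gcongr
    linarith
  · have e : f (x + z) + f (x + -z) - (2 : ℝ) • f x =
        (f (x + z) - (f x + iteratedFDeriv ℝ 1 f x fun _ => z)) +
        (f (x + -z) - (f x + -iteratedFDeriv ℝ 1 f x fun _ => z)) := by
      rw [two_smul]; abel
    rw [e]
    refine (norm_add_le _ _).trans ((add_le_add z₂ z₃).trans ?_)
    have : 0 ≤ C₁ * ‖z‖ ^ 2 := by positivity
    linarith

/-- The expansion of a function of class `C⁴` with vanishing first order jet: its even part is
quadratic up to a term of fourth order. -/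
theorem exists_even_bound_of_critical {f : V → F} {x : V} (hf : ContDiffAt ℝ 4 f x)
    (h0 : f x = 0) (h1 : fderiv ℝ f x = 0) :
    ∃ C : ℝ, 0 ≤ C ∧ ∀ᶠ z in 𝓝 (0 : V),
      ‖f (x + z) - (1 / 2 : ℝ) • fderiv ℝ (fderiv ℝ f) x z z‖ ≤ C * ‖z‖ ^ 3 ∧
      ‖f (x + z) + f (x + -z) - (2 : ℝ) • (1 / 2 : ℝ) • fderiv ℝ (fderiv ℝ f) x z z‖ ≤
        C * ‖z‖ ^ 4 := by
  obtain ⟨C₁, hC₁, h₁⟩ := exists_taylor_bound (n := 2) (hf.of_le (by norm_num))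
  obtain ⟨C₂, hC₂, h₂⟩ := exists_taylor_bound (n := 3) (hf.of_le (by norm_num))
  refine ⟨C₁ + 2 * C₂, by positivity, ?_⟩
  filter_upwards [h₁, h₂, eventually_neg_nhds_zero h₂] with z z₁ z₂ z₃
  have e1 : iteratedFDeriv ℝ 1 f x (fun _ => z) = 0 := by
    rw [iteratedFDeriv_one_apply, h1]; rfl
  have e2 : iteratedFDeriv ℝ 2 f x (fun _ => z) = fderiv ℝ (fderiv ℝ f) x z z := by
    rw [iteratedFDeriv_two_apply]
  have e2' : iteratedFDeriv ℝ 2 f x (fun _ => -z) = fderiv ℝ (fderiv ℝ f) x z z := by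
    rw [iteratedFDeriv_neg_apply, e2]; simp
  have e1' : iteratedFDeriv ℝ 1 f x (fun _ => -z) = 0 := by
    rw [iteratedFDeriv_neg_apply, e1]; simp
  have e3 : iteratedFDeriv ℝ 3 f x (fun _ => -z) = -iteratedFDeriv ℝ 3 f x (fun _ => z) := by
    rw [iteratedFDeriv_neg_apply]
    norm_num
  simp only [Finset.sum_range_succ, Finset.sum_range_zero, e1, e2, e1', e2', e3, zero_add,
    iteratedFDeriv_zero_apply, h0, smul_zero, smul_neg, norm_neg, Nat.reduceAdd] at z₁ z₂ z₃
  have hfac : ((Nat.factorial 2 : ℕ) : ℝ)⁻¹ = 1 / 2 := by norm_num [Nat.factorial]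
  rw [hfac] at z₁ z₂ z₃
  refine ⟨z₁.trans ?_, ?_⟩
  · gcongr
    linarith
  · set q := (1 / 2 : ℝ) • fderiv ℝ (fderiv ℝ f) x z z
    set c := ((Nat.factorial 3 : ℕ) : ℝ)⁻¹ • iteratedFDeriv ℝ 3 f x (fun _ => z)
    have e : f (x + z) + f (x + -z) - (2 : ℝ) • q =
        (f (x + z) - (q + c)) + (f (x + -z) - (q + -c)) := by
      rw [two_smul]; abel
    rw [e]
    refine (norm_add_le _ _).trans ((add_le_add z₂ z₃).trans ?_)
    have : 0 ≤ C₁ * ‖z‖ ^ 4 := by positivity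
    linarith

end Taylor

/-! ### Laplace's method -/

theorem abs_exp_neg_sub_le (a : ℝ) : |Real.exp (-a) - 1 + a| ≤ a ^ 2 * Real.exp |a| := by
  have h := Complex.norm_exp_sub_sum_le_norm_mul_exp (-(a : ℂ)) 2
  have e : Complex.exp (-(a : ℂ)) - ∑ m ∈ Finset.range 2, (-(a : ℂ)) ^ m / (m.factorial : ℂ)
      = ((Real.exp (-a) - 1 + a : ℝ) : ℂ) := by
    simp [Finset.sum_range_succ]; ring
  rw [e, Complex.norm_real, norm_neg, Complex.norm_real, Real.norm_eq_abs, Real.norm_eq_abs,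
    sq_abs] at h
  exact h

theorem exists_pow_le_exp {c : ℝ} (hc : 0 < c) :
    ∃ A : ℝ, 0 < A ∧ ∀ x : ℝ, 0 ≤ x → (1 + x) ^ 3 ≤ A * Real.exp (c * x) := by
  refine ⟨6 * c⁻¹ ^ 3 * Real.exp c, by positivity, fun x hx => ?_⟩
  have h := Real.pow_div_factorial_le_exp (c * (1 + x)) (by positivity) 3
  rw [mul_add, mul_one, Real.exp_add] at h
  have e : (1 + x) ^ 3 = 6 * c⁻¹ ^ 3 * ((c + c * x) ^ 3 / (Nat.factorial 3 : ℝ)) := by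
    simp only [Nat.factorial]; push_cast; field_simp
  rw [e]
  calc _ ≤ 6 * c⁻¹ ^ 3 * (Real.exp c * Real.exp (c * x)) := by gcongr
    _ = _ := by ring

section Laplace

variable {V F : Type*} [NormedAddCommGroup V] [NormedSpace ℝ V] [FiniteDimensional ℝ V]
  [MeasurableSpace V] [BorelSpace V] (μ : Measure V) [μ.IsAddHaarMeasure]
  [NormedAddCommGroup F] [NormedSpace ℝ F]

theorem integrable_exp_neg_mul_sq {c : ℝ} (hc : 0 < c) :
    Integrable (fun z : V => Real.exp (-(c * ‖z‖ ^ 2))) μ := by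
  set d := Module.finrank ℝ V
  have h := integrable_one_add_norm (E := V) (μ := μ) (r := d + 1) (by simp [d])
  refine (h.const_mul (((d + 1).factorial : ℝ) * (1 + c⁻¹) ^ (d + 1) * Real.exp 1)).mono' ?_ ?_
  · exact (by fun_prop : Continuous fun z : V => Real.exp (-(c * ‖z‖ ^ 2))).aestronglyMeasurable
  · refine Eventually.of_forall fun z => ?_
    rw [Real.norm_of_nonneg (Real.exp_pos _).le]
    have hz := norm_nonneg z
    have e : (1 + ‖z‖) ^ (-((d : ℝ) + 1)) = ((1 + ‖z‖) ^ (d + 1))⁻¹ := by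
      rw [Real.rpow_neg (by positivity)]
      norm_cast
    rw [e, Real.exp_neg, ← div_eq_mul_inv, inv_le_comm₀ (by positivity) (by positivity), inv_div]
    rw [div_le_iff₀ (by positivity)]
    -- `1 + x ≤ (1 + c⁻¹) (1 + c x²)` bounds the power by an exponential
    have h1 : 1 + ‖z‖ ≤ (1 + c⁻¹) * (1 + c * ‖z‖ ^ 2) := by
      have : (1 + c⁻¹) * (1 + c * ‖z‖ ^ 2) = 1 + c⁻¹ + c * ‖z‖ ^ 2 + ‖z‖ ^ 2 := by
        field_simp; ring
      rw [this]
      have h2 : ‖z‖ ≤ c⁻¹ + c * ‖z‖ ^ 2 := by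
        have : c⁻¹ + c * ‖z‖ ^ 2 - ‖z‖ = c⁻¹ * ((c * ‖z‖ - 1 / 2) ^ 2 + 3 / 4) := by
          field_simp; ring
        have : 0 ≤ c⁻¹ * ((c * ‖z‖ - 1 / 2) ^ 2 + 3 / 4) := by positivity
        linarith
      nlinarith
    have h2 := Real.pow_div_factorial_le_exp (1 + c * ‖z‖ ^ 2) (by positivity) (d + 1)
    rw [div_le_iff₀ (by positivity), Real.exp_add] at h2
    calc (1 + ‖z‖) ^ (d + 1) ≤ ((1 + c⁻¹) * (1 + c * ‖z‖ ^ 2)) ^ (d + 1) := by gcongr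
      _ = (1 + c⁻¹) ^ (d + 1) * (1 + c * ‖z‖ ^ 2) ^ (d + 1) := mul_pow _ _ _
      _ ≤ (1 + c⁻¹) ^ (d + 1) *
          (Real.exp 1 * Real.exp (c * ‖z‖ ^ 2) * ((d + 1).factorial : ℝ)) := by gcongr
      _ = _ := by ring

/-- The scaling of a Gaussian integral. -/
theorem integral_exp_neg_div {q : V → ℝ} (hq : ∀ (s : ℝ) z, q (s • z) = s ^ 2 * q z) {t : ℝ}
    (ht : 0 < t) : ∫ z : V, Real.exp (-(q z / t)) ∂μ =
      √t ^ Module.finrank ℝ V * ∫ z : V, Real.exp (-q z) ∂μ := by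
  have hs : 0 < √t := Real.sqrt_pos.mpr ht
  have h := Measure.integral_comp_inv_smul_of_nonneg μ (fun z : V => Real.exp (-q z)) hs.le
  rw [smul_eq_mul] at h
  rw [← h]
  refine integral_congr_ae (Eventually.of_forall fun z => ?_)
  simp only
  rw [hq, inv_pow, Real.sq_sqrt ht.le, inv_mul_eq_div]

/-- The pointwise estimate behind Laplace's method: after symmetrization the terms of odd order
cancel. -/
theorem norm_symmetrized_sub_le {a b q c C x s t r : ℝ} {u v w : F} (ht : 0 < t) (hC : 0 ≤ C)
    (hs : 0 ≤ s) (hx : x = s ^ 2 / (2 * t)) (hq : c * x ≤ q) (hsr : s ≤ r) (hr : C * r ≤ c / 2)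
    (hu : ‖u - w‖ ≤ C * s) (hv : ‖v - w‖ ≤ C * s) (huv : ‖u + v - (2 : ℝ) • w‖ ≤ C * s ^ 2)
    (ha : |a| ≤ C * s * x) (hb : |b| ≤ C * s * x) (hab : |a + b| ≤ C * s ^ 2 * x) :
    ‖Real.exp (-(q + a)) • u + Real.exp (-(q + b)) • v - (2 : ℝ) • Real.exp (-q) • w‖ ≤
      2 * t * (2 * (‖w‖ + C * r) * C ^ 2 + C + 2 * C ^ 2 + ‖w‖ * C) *
        ((1 + x) ^ 3 * Real.exp (-(c / 2 * x))) := by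
  have hx0 : 0 ≤ x := hx ▸ by positivity
  have hs2 : s ^ 2 = 2 * t * x := by rw [hx]; field_simp
  have hr0 : 0 ≤ r := hs.trans hsr
  have bound (a : ℝ) (u : F) (ha : |a| ≤ C * s * x) (hu : ‖u - w‖ ≤ C * s) :
      ‖(Real.exp (-a) - 1 + a) • u‖ ≤
        2 * t * ((‖w‖ + C * r) * C ^ 2) * x ^ 3 * Real.exp (c / 2 * x) := by
    rw [norm_smul, Real.norm_eq_abs]
    have h1 : ‖u‖ ≤ ‖w‖ + C * r := by
      calc ‖u‖ = ‖w + (u - w)‖ := by rw [add_sub_cancel]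
        _ ≤ ‖w‖ + ‖u - w‖ := norm_add_le _ _
        _ ≤ ‖w‖ + C * r := by
          gcongr
          exact hu.trans (by gcongr)
    have h2 : |a| ≤ c / 2 * x := ha.trans <| by
      gcongr
      exact (mul_le_mul_of_nonneg_left hsr hC).trans hr
    have h3 : a ^ 2 ≤ 2 * t * C ^ 2 * x ^ 3 := by
      calc a ^ 2 = |a| ^ 2 := (sq_abs a).symm
        _ ≤ (C * s * x) ^ 2 := by gcongr
        _ = C ^ 2 * s ^ 2 * x ^ 2 := by ring
        _ = _ := by rw [hs2]; ring
    calc _ ≤ (a ^ 2 * Real.exp |a|) * (‖w‖ + C * r) := by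
          gcongr
          exact abs_exp_neg_sub_le a
      _ ≤ (2 * t * C ^ 2 * x ^ 3 * Real.exp (c / 2 * x)) * (‖w‖ + C * r) := by gcongr
      _ = _ := by ring
  have e : Real.exp (-(q + a)) • u + Real.exp (-(q + b)) • v - (2 : ℝ) • Real.exp (-q) • w =
      Real.exp (-q) • ((Real.exp (-a) - 1 + a) • u + (Real.exp (-b) - 1 + b) • v +
        (u + v - (2 : ℝ) • w) - (a • (u - w) + b • (v - w) + (a + b) • w)) := by
    rw [neg_add, neg_add, Real.exp_add, Real.exp_add]
    module
  have hexp : 1 ≤ Real.exp (c / 2 * x) := by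
    apply Real.one_le_exp
    have : 0 ≤ c / 2 := (mul_nonneg hC hr0).trans hr
    positivity
  have hin : ‖(Real.exp (-a) - 1 + a) • u + (Real.exp (-b) - 1 + b) • v +
        (u + v - (2 : ℝ) • w) - (a • (u - w) + b • (v - w) + (a + b) • w)‖ ≤
      2 * t * (2 * (‖w‖ + C * r) * C ^ 2 + C + 2 * C ^ 2 + ‖w‖ * C) *
        ((1 + x) ^ 3 * Real.exp (c / 2 * x)) := by
    have g1 := bound a u ha hu
    have g2 := bound b v hb hv
    have g3 : ‖a • (u - w)‖ ≤ 2 * t * C ^ 2 * x ^ 2 := by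
      rw [norm_smul, Real.norm_eq_abs]
      calc _ ≤ (C * s * x) * (C * s) := by gcongr
        _ = C ^ 2 * s ^ 2 * x := by ring
        _ = _ := by rw [hs2]; ring
    have g4 : ‖b • (v - w)‖ ≤ 2 * t * C ^ 2 * x ^ 2 := by
      rw [norm_smul, Real.norm_eq_abs]
      calc _ ≤ (C * s * x) * (C * s) := by gcongr
        _ = C ^ 2 * s ^ 2 * x := by ring
        _ = _ := by rw [hs2]; ring
    have g5 : ‖(a + b) • w‖ ≤ 2 * t * (‖w‖ * C) * x ^ 2 := by
      rw [norm_smul, Real.norm_eq_abs]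
      calc _ ≤ (C * s ^ 2 * x) * ‖w‖ := by gcongr
        _ = _ := by rw [hs2]; ring
    have g6 : ‖u + v - (2 : ℝ) • w‖ ≤ 2 * t * C * x := by rw [hs2] at huv; linarith
    have t1 := norm_sub_le ((Real.exp (-a) - 1 + a) • u + (Real.exp (-b) - 1 + b) • v +
        (u + v - (2 : ℝ) • w)) (a • (u - w) + b • (v - w) + (a + b) • w)
    have t2 := norm_add₃_le (a := (Real.exp (-a) - 1 + a) • u)
      (b := (Real.exp (-b) - 1 + b) • v) (c := u + v - (2 : ℝ) • w)
    have t3 := norm_add₃_le (a := a • (u - w)) (b := b • (v - w)) (c := (a + b) • w)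
    have p1 : x ≤ (1 + x) ^ 3 * Real.exp (c / 2 * x) := by
      refine le_trans ?_ (le_mul_of_one_le_right (by positivity) hexp)
      nlinarith [pow_nonneg hx0 2, pow_nonneg hx0 3]
    have p2 : x ^ 2 ≤ (1 + x) ^ 3 * Real.exp (c / 2 * x) := by
      refine le_trans ?_ (le_mul_of_one_le_right (by positivity) hexp)
      nlinarith [pow_nonneg hx0 2, pow_nonneg hx0 3]
    have p3 : x ^ 3 * Real.exp (c / 2 * x) ≤ (1 + x) ^ 3 * Real.exp (c / 2 * x) := by
      gcongr; linarith
    set P := (1 + x) ^ 3 * Real.exp (c / 2 * x)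
    have q1 := mul_le_mul_of_nonneg_left p1 (by positivity : 0 ≤ 2 * t * C)
    have q2 := mul_le_mul_of_nonneg_left p2 (by positivity : 0 ≤ 2 * t * C ^ 2)
    have q3 := mul_le_mul_of_nonneg_left p2 (by positivity : 0 ≤ 2 * t * (‖w‖ * C))
    have q4 := mul_le_mul_of_nonneg_left p3
      (by positivity : 0 ≤ 2 * t * ((‖w‖ + C * r) * C ^ 2))
    linarith
  rw [e, norm_smul, Real.norm_of_nonneg (Real.exp_pos _).le]
  have hq' : Real.exp (-q) ≤ Real.exp (-(c * x)) := by gcongr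
  calc _ ≤ Real.exp (-(c * x)) * _ := mul_le_mul hq' hin (norm_nonneg _) (Real.exp_pos _).le
    _ = _ := by
      have : Real.exp (-(c / 2 * x)) = Real.exp (-(c * x)) * Real.exp (c / 2 * x) := by
        rw [← Real.exp_add]; ring_nf
      rw [this]; ring


theorem setIntegral_closedBall_comp_neg (r : ℝ) (h : V → F) :
    ∫ z in Metric.closedBall (0 : V) r, h (-z) ∂μ = ∫ z in Metric.closedBall (0 : V) r, h z ∂μ := by
  have := (Measure.measurePreserving_neg μ).setIntegral_preimage_emb
    (MeasurableEquiv.neg V).measurableEmbedding h (Metric.closedBall 0 r)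
  rw [← this]
  congr 2
  ext z
  simp

variable [CompleteSpace F]

/-- Laplace's method near a nondegenerate minimum `0` of `φ`, with an explicit set of estimates for
the Taylor expansions of `f` and `φ` on a ball. -/
theorem exists_laplace_bound_closedBall {f : V → F} {φ Q : V → ℝ} {c C r : ℝ} (hc : 0 < c)
    (hC : 0 ≤ C) (hr : 0 < r) (hrC : C * r ≤ c / 2)
    (hf : ContinuousOn f (Metric.closedBall 0 r)) (hφ : ContinuousOn φ (Metric.closedBall 0 r))
    (hQ : Continuous Q) (hQneg : ∀ z, Q (-z) = Q z) (hQc : ∀ z, c * ‖z‖ ^ 2 ≤ Q z)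
    (h1 : ∀ z, ‖z‖ ≤ r → ‖f z - f 0‖ ≤ C * ‖z‖)
    (h2 : ∀ z, ‖z‖ ≤ r → ‖f z + f (-z) - (2 : ℝ) • f 0‖ ≤ C * ‖z‖ ^ 2)
    (h3 : ∀ z, ‖z‖ ≤ r → |φ z - Q z| ≤ C * ‖z‖ ^ 3)
    (h4 : ∀ z, ‖z‖ ≤ r → |φ z + φ (-z) - 2 * Q z| ≤ C * ‖z‖ ^ 4) :
    ∃ A : ℝ, ∀ t : ℝ, 0 < t →
      ‖(∫ z in Metric.closedBall 0 r, Real.exp (-(φ z / (2 * t))) • f z ∂μ) -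
        (∫ z, Real.exp (-(Q z / (2 * t))) ∂μ) • f 0‖ ≤ A * (t * √t ^ Module.finrank ℝ V) := by
  obtain ⟨A₀, hA₀, hexp⟩ := exists_pow_le_exp (c := c / 4) (by positivity)
  set B := Metric.closedBall (0 : V) r with hB
  have hBm : MeasurableSet B := measurableSet_closedBall
  set w := f 0
  set C₁ := 2 * (‖w‖ + C * r) * C ^ 2 + C + 2 * C ^ 2 + ‖w‖ * C
  have hC₁ : 0 ≤ C₁ := by positivity
  set A₁ := 2 * (C₁ + 2 * ‖w‖ / r ^ 2) * A₀ with hA₁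
  set J := ∫ z : V, Real.exp (-(c / 8 * ‖z‖ ^ 2)) ∂μ
  refine ⟨A₁ * J / 2, fun t ht => ?_⟩
  set G : V → F := fun z => Real.exp (-(φ z / (2 * t))) • f z with hG
  have hGc : ContinuousOn G B := by
    refine ContinuousOn.smul ?_ hf
    exact Real.continuous_exp.comp_continuousOn (hφ.div_const _).neg
  have hGi : IntegrableOn G B μ := hGc.integrableOn_compact (isCompact_closedBall 0 r)
  have hmaps : MapsTo (fun z : V => -z) B B := fun z hz => by simpa [hB] using hz
  have hGni : IntegrableOn (fun z => G (-z)) B μ :=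
    (hGc.comp continuous_neg.continuousOn hmaps).integrableOn_compact (isCompact_closedBall 0 r)
  have hQi : Integrable (fun z => Real.exp (-(Q z / (2 * t)))) μ := by
    refine (integrable_exp_neg_mul_sq μ (c := c / (2 * t)) (by positivity)).mono'
      (by fun_prop) (Eventually.of_forall fun z => ?_)
    rw [Real.norm_of_nonneg (Real.exp_pos _).le]
    gcongr
    rw [div_mul_eq_mul_div]
    gcongr
    exact hQc z
  set D : V → F := fun z => B.indicator (fun z => G z + G (-z)) z -
    (2 : ℝ) • Real.exp (-(Q z / (2 * t))) • w with hD
  have hint : ∫ z, D z ∂μ = (2 : ℝ) • ((∫ z in B, G z ∂μ) -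
      (∫ z, Real.exp (-(Q z / (2 * t))) ∂μ) • w) := by
    rw [hD, integral_sub, integral_indicator hBm, integral_add hGi hGni,
      setIntegral_closedBall_comp_neg μ r G, integral_smul, integral_smul_const, smul_sub, two_smul,
      two_smul]
    · exact (hGi.add hGni).integrable_indicator hBm
    · exact (hQi.smul_const w).smul (2 : ℝ)
  have hbound (z : V) : ‖D z‖ ≤ A₁ * t * Real.exp (-(c / 8 * ‖z‖ ^ 2 / t)) := by
    set x := ‖z‖ ^ 2 / (2 * t) with hx
    have hx0 : 0 ≤ x := by positivity
    have hz2 : ‖z‖ ^ 2 = 2 * t * x := by rw [hx]; field_simp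
    have hxe : c / 8 * ‖z‖ ^ 2 / t = c / 4 * x := by rw [hx]; field_simp; ring
    have hqx : c * x ≤ Q z / (2 * t) := by
      rw [hx, ← mul_div_assoc]; gcongr; exact hQc z
    have habs : (1 + x) ^ 3 * Real.exp (-(c / 2 * x)) ≤ A₀ * Real.exp (-(c / 4 * x)) := by
      calc _ ≤ A₀ * Real.exp (c / 4 * x) * Real.exp (-(c / 2 * x)) := by
            gcongr; exact hexp x hx0
        _ = _ := by rw [mul_assoc, ← Real.exp_add]; ring_nf
    rw [hxe]
    by_cases hz : z ∈ B
    · have hzr : ‖z‖ ≤ r := by simpa [hB] using hz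
      have hzr' : ‖-z‖ ≤ r := by simpa using hzr
      have ediv {y : ℝ} {k : ℕ} (h : |y| ≤ C * ‖z‖ ^ (k + 2)) : |y / (2 * t)| ≤ C * ‖z‖ ^ k * x := by
        rw [abs_div, abs_of_pos (by positivity : 0 < 2 * t), hx, ← mul_div_assoc, mul_assoc,
          ← pow_add]
        gcongr
      have key := norm_symmetrized_sub_le (a := (φ z - Q z) / (2 * t))
        (b := (φ (-z) - Q z) / (2 * t)) (q := Q z / (2 * t)) (c := c) (C := C) (x := x) (s := ‖z‖)
        (t := t) (r := r) (u := f z) (v := f (-z)) (w := w) ht hC (norm_nonneg z) hx hqx hzr hrC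
        (h1 z hzr) (by simpa using h1 (-z) hzr') (h2 z hzr)
        (by simpa using ediv (k := 1) (h3 z hzr))
        (by simpa using ediv (k := 1) (by simpa [hQneg] using h3 (-z) hzr'))
        (by
          rw [← add_div]
          refine ediv (k := 2) ?_
          have := h4 z hzr
          rwa [show φ z - Q z + (φ (-z) - Q z) = φ z + φ (-z) - 2 * Q z by ring])
      have e : D z = Real.exp (-(Q z / (2 * t) + (φ z - Q z) / (2 * t))) • f z +
          Real.exp (-(Q z / (2 * t) + (φ (-z) - Q z) / (2 * t))) • f (-z) -
          (2 : ℝ) • Real.exp (-(Q z / (2 * t))) • w := by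
        simp only [hD, indicator_of_mem hz, hG, ← add_div, add_sub_cancel]
      rw [e]
      refine key.trans ?_
      calc _ ≤ 2 * t * C₁ * (A₀ * Real.exp (-(c / 4 * x))) := by gcongr
        _ ≤ 2 * t * (C₁ + 2 * ‖w‖ / r ^ 2) * (A₀ * Real.exp (-(c / 4 * x))) := by
          gcongr
          have : 0 ≤ 2 * ‖w‖ / r ^ 2 := by positivity
          linarith
        _ = _ := by rw [hA₁]; ring
    · have hzr : r < ‖z‖ := by simpa [hB] using hz
      have e : D z = -((2 : ℝ) • Real.exp (-(Q z / (2 * t))) • w) := by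
        simp only [hD, indicator_of_notMem hz, zero_sub]
      rw [e, norm_neg, norm_smul, norm_smul, Real.norm_of_nonneg (Real.exp_pos _).le, Real.norm_two]
      have g1 : Real.exp (-(Q z / (2 * t))) ≤ Real.exp (-(c / 2 * x)) := by
        gcongr
        refine le_trans ?_ hqx
        gcongr
        linarith
      -- outside the ball `1 ≤ ‖z‖² / r² = 2 t x / r²`
      have g2 : 1 ≤ 2 * t * (1 + x) ^ 3 / r ^ 2 := by
        rw [le_div_iff₀ (by positivity), one_mul]
        calc r ^ 2 ≤ ‖z‖ ^ 2 := by gcongr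
          _ = 2 * t * x := hz2
          _ ≤ 2 * t * (1 + x) ^ 3 := by
            gcongr
            nlinarith [pow_nonneg hx0 2, pow_nonneg hx0 3]
      calc _ ≤ 2 * (Real.exp (-(c / 2 * x)) * ‖w‖) * 1 := by rw [mul_one]; gcongr
        _ ≤ 2 * (Real.exp (-(c / 2 * x)) * ‖w‖) * (2 * t * (1 + x) ^ 3 / r ^ 2) := by gcongr
        _ = 2 * t * (2 * ‖w‖ / r ^ 2) * ((1 + x) ^ 3 * Real.exp (-(c / 2 * x))) := by ring
        _ ≤ 2 * t * (C₁ + 2 * ‖w‖ / r ^ 2) * (A₀ * Real.exp (-(c / 4 * x))) := by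
          gcongr
          linarith
        _ = _ := by rw [hA₁]; ring
  have hdom : Integrable (fun z : V => A₁ * t * Real.exp (-(c / 8 * ‖z‖ ^ 2 / t))) μ := by
    have := (integrable_exp_neg_mul_sq μ (c := c / 8 / t) (by positivity)).const_mul (A₁ * t)
    refine this.congr (Eventually.of_forall fun z => ?_)
    simp only
    ring_nf
  have hle := norm_integral_le_of_norm_le hdom (Eventually.of_forall hbound)
  rw [hint, integral_const_mul,
    integral_exp_neg_div μ (q := fun z => c / 8 * ‖z‖ ^ 2)
      (fun s z => by rw [norm_smul, mul_pow, Real.norm_eq_abs, sq_abs]; ring) ht, norm_smul, Real.norm_two] at hle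
  linarith

/-- Laplace's method near a nondegenerate critical point `x` of `φ` with `φ x = 0`. -/
theorem eventually_exists_laplace_bound {f : V → F} {φ : V → ℝ} {x : V} {c : ℝ} (hc : 0 < c)
    (hf : ContDiffAt ℝ ∞ f x) (hφ : ContDiffAt ℝ ∞ φ x) (h0 : φ x = 0) (h1 : fderiv ℝ φ x = 0)
    (hpos : ∀ z, c * ‖z‖ ^ 2 ≤ (1 / 2 : ℝ) * fderiv ℝ (fderiv ℝ φ) x z z) :
    ∀ᶠ r in 𝓝[>] (0 : ℝ), ∃ A : ℝ, ∀ t : ℝ, 0 < t →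
      ‖(∫ z in Metric.closedBall x r, Real.exp (-(φ z / (2 * t))) • f z ∂μ) -
        (∫ z, Real.exp (-((1 / 2 : ℝ) * fderiv ℝ (fderiv ℝ φ) x z z / (2 * t))) ∂μ) • f x‖ ≤
          A * (t * √t ^ Module.finrank ℝ V) := by
  obtain ⟨C₁, hC₁, e₁⟩ := exists_even_bound (hf.of_le (by norm_cast))
  obtain ⟨C₂, hC₂, e₂⟩ :=
    exists_even_bound_of_critical (hφ.of_le (by norm_cast)) h0 h1
  have hfc : ∀ᶠ y in 𝓝 x, ContinuousAt f y :=
    ((hf.of_le (by norm_cast : (0 : ℕ∞ω) ≤ ∞)).eventually (by norm_num)).mono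
      fun _ h => h.continuousAt
  have hφc : ∀ᶠ y in 𝓝 x, ContinuousAt φ y :=
    ((hφ.of_le (by norm_cast : (0 : ℕ∞ω) ≤ ∞)).eventually (by norm_num)).mono
      fun _ h => h.continuousAt
  have htr : Tendsto (fun z : V => x + z) (𝓝 0) (𝓝 x) := by
    simpa using (continuous_const_add x).tendsto (0 : V)
  obtain ⟨R, hR, hball⟩ := Metric.eventually_nhds_iff.mp
    (e₁.and (e₂.and ((htr.eventually hfc).and (htr.eventually hφc))))
  set C := C₁ + C₂
  have hC : 0 ≤ C := by positivity
  have hsmall : ∀ᶠ r in 𝓝[>] (0 : ℝ), 0 < r ∧ r < R ∧ C * r ≤ c / 2 := by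
    refine eventually_mem_nhdsWithin.and (nhdsWithin_le_nhds ?_)
    refine (eventually_lt_nhds hR).and ?_
    have : Tendsto (fun r => C * r) (𝓝 0) (𝓝 0) := by
      simpa using (continuous_const_mul C).tendsto (0 : ℝ)
    exact (this.eventually_lt_const (by positivity : 0 < c / 2)).mono fun _ h => h.le
  filter_upwards [hsmall] with r ⟨hr, hrR, hrC⟩
  have hin {z : V} (hz : ‖z‖ ≤ r) := hball (y := z) (by rw [dist_zero_right]; linarith)
  have hmem {z : V} (hz : z ∈ Metric.closedBall (0 : V) r) : ‖z‖ ≤ r := by simpa using hz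
  obtain ⟨A, hA⟩ := exists_laplace_bound_closedBall μ (f := fun z => f (x + z))
    (φ := fun z => φ (x + z)) (Q := fun z => (1 / 2 : ℝ) * fderiv ℝ (fderiv ℝ φ) x z z)
    hc hC hr hrC
    (fun z hz => ContinuousAt.continuousWithinAt <|
      (hin (hmem hz)).2.2.1.comp (continuous_const_add x).continuousAt)
    (fun z hz => ContinuousAt.continuousWithinAt <|
      (hin (hmem hz)).2.2.2.comp (continuous_const_add x).continuousAt)
    (by fun_prop) (fun z => by simp) hpos
    (fun z hz => by
      rw [add_zero]
      exact (hin hz).1.1.trans (by gcongr; exact le_add_of_nonneg_right hC₂))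
    (fun z hz => by
      rw [add_zero]
      exact (hin hz).1.2.trans (by gcongr; exact le_add_of_nonneg_right hC₂))
    (fun z hz => (hin hz).2.1.1.trans (by gcongr; exact le_add_of_nonneg_left hC₁))
    (fun z hz => (hin hz).2.1.2.trans (by gcongr; exact le_add_of_nonneg_left hC₁))
  refine ⟨A, fun t ht => ?_⟩
  have htrans := (measurePreserving_add_left μ x).setIntegral_preimage_emb
    (MeasurableEquiv.addLeft x).measurableEmbedding
    (fun z => Real.exp (-(φ z / (2 * t))) • f z) (Metric.closedBall x r)
  have hpre : (fun z => x + z) ⁻¹' Metric.closedBall x r = Metric.closedBall 0 r := by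
    ext z; simp [dist_eq_norm]
  rw [hpre] at htrans
  have := hA t ht
  simp only [add_zero] at this
  rw [← htrans]
  exact this

/-- Away from the zeros of `φ` the integrand is of arbitrarily high order in `t`, so that the
integral is the sum of the local contributions. -/
theorem exists_laplace_bound {S L : Set V} {f : V → F} {φ : V → ℝ} (hS : MeasurableSet S)
    (hL : IsCompact L) (hLS : L ⊆ S) (hf : ContinuousOn f L) (hφ : ContinuousOn φ L)
    (hf0 : ∀ y ∈ S \ L, f y = 0) (hφ0 : ∀ y ∈ L, 0 ≤ φ y) (Z : Finset V)
    (hZ : ∀ y ∈ L, φ y = 0 → y ∈ Z) (hZS : ∀ z ∈ Z, S ∈ 𝓝 z) (I : V → ℝ → F)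
    (hloc : ∀ z ∈ Z, ∀ᶠ r in 𝓝[>] (0 : ℝ), ∃ A : ℝ, ∀ t : ℝ, 0 < t →
      ‖(∫ y in Metric.closedBall z r, Real.exp (-(φ y / (2 * t))) • f y ∂μ) - I z t‖ ≤
        A * (t * √t ^ Module.finrank ℝ V)) :
    ∃ A : ℝ, ∀ t ∈ Ioc (0 : ℝ) 1,
      ‖(∫ y in S, Real.exp (-(φ y / (2 * t))) • f y ∂μ) - ∑ z ∈ Z, I z t‖ ≤
        A * (t * √t ^ Module.finrank ℝ V) := by
  classical
  have hev : ∀ᶠ r in 𝓝[>] (0 : ℝ), 0 < r ∧ (∀ z ∈ Z, Metric.closedBall z r ⊆ S ∧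
      (∃ A : ℝ, ∀ t : ℝ, 0 < t →
      ‖(∫ y in Metric.closedBall z r, Real.exp (-(φ y / (2 * t))) • f y ∂μ) - I z t‖ ≤
        A * (t * √t ^ Module.finrank ℝ V))) ∧
      ∀ z ∈ Z, ∀ z' ∈ Z, z ≠ z' → Disjoint (Metric.closedBall z r) (Metric.closedBall z' r) := by
    refine eventually_mem_nhdsWithin.and (Eventually.and ?_ ?_)
    · refine (eventually_all_finset Z).mpr fun z hz => Eventually.and ?_ (hloc z hz)
      obtain ⟨R, hR, hsub⟩ := Metric.nhds_basis_closedBall.mem_iff.mp (hZS z hz)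
      filter_upwards [nhdsWithin_le_nhds (eventually_lt_nhds hR)] with r hr
      exact (Metric.closedBall_subset_closedBall hr.le).trans hsub
    · refine (eventually_all_finset Z).mpr fun z hz => (eventually_all_finset Z).mpr fun z' hz' => ?_
      by_cases h : z = z'
      · simp [h]
      · have hd : 0 < dist z z' / 2 := by have := dist_pos.mpr h; positivity
        filter_upwards [nhdsWithin_le_nhds (eventually_lt_nhds hd)] with r hr _
        exact Metric.closedBall_disjoint_closedBall (by linarith)
  obtain ⟨r, hr, hZr, hdisj⟩ := hev.exists
  have hZr' : ∀ z : V, ∃ A : ℝ, z ∈ Z → ∀ t : ℝ, 0 < t →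
      ‖(∫ y in Metric.closedBall z r, Real.exp (-(φ y / (2 * t))) • f y ∂μ) - I z t‖ ≤
        A * (t * √t ^ Module.finrank ℝ V) := fun z => by
    by_cases hz : z ∈ Z
    · obtain ⟨A, hA⟩ := (hZr z hz).2
      exact ⟨A, fun _ => hA⟩
    · exact ⟨0, fun h => absurd h hz⟩
  choose A hA using hZr'
  set U := ⋃ z ∈ Z, Metric.closedBall z r with hU
  have hUS : U ⊆ S := iUnion₂_subset fun z hz => (hZr z hz).1
  have hUm : MeasurableSet U := Finset.measurableSet_biUnion Z fun z _ => measurableSet_closedBall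
  -- bounds on the complement
  obtain ⟨H, hH⟩ := hL.exists_bound_of_continuousOn hf
  set L' := L \ ⋃ z ∈ Z, Metric.ball z r
  have hL' : IsCompact L' := hL.diff (isOpen_biUnion fun z _ => Metric.isOpen_ball)
  obtain ⟨δ, hδ, hφδ⟩ : ∃ δ > 0, ∀ y ∈ L', δ ≤ φ y := by
    rcases L'.eq_empty_or_nonempty with h | h
    · exact ⟨1, one_pos, by simp [h]⟩
    · obtain ⟨y, hy, hmin⟩ := hL'.exists_isMinOn h (hφ.mono sdiff_subset)
      refine ⟨φ y, lt_of_le_of_ne (hφ0 y hy.1) fun h0 => hy.2 ?_, hmin⟩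
      exact mem_biUnion (hZ y hy.1 h0.symm) (Metric.mem_ball_self hr)
  set d := Module.finrank ℝ V
  refine ⟨∑ z ∈ Z, A z + (2 / δ) ^ (d + 1) * (d + 1).factorial * |H| * μ.real L,
    fun t ht => ?_⟩
  have ht0 : 0 < t := ht.1
  set G : V → F := fun y => Real.exp (-(φ y / (2 * t))) • f y with hG
  have hGc : ContinuousOn G L :=
    (Real.continuous_exp.comp_continuousOn (hφ.div_const _).neg).smul hf
  have hG0 : ∀ y ∈ S \ L, G y = 0 := fun y hy => by simp [hG, hf0 y hy]
  have hGi : IntegrableOn G S μ :=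
    (hGc.integrableOn_compact hL).of_forall_sdiff_eq_zero hS hG0
  have hsplit : ∫ y in S, G y ∂μ = (∑ z ∈ Z, ∫ y in Metric.closedBall z r, G y ∂μ) +
      ∫ y in S \ U, G y ∂μ := by
    rw [← integral_biUnion_finset Z (fun z _ => measurableSet_closedBall) ?_
      fun z hz => hGi.mono_set (hZr z hz).1, setIntegral_sdiff hUm hGi hUS]
    · abel
    · intro z hz z' hz' h
      exact hdisj z hz z' hz' h
  have htail : ‖∫ y in S \ U, G y ∂μ‖ ≤
      (2 / δ) ^ (d + 1) * (d + 1).factorial * |H| * μ.real L * (t * √t ^ d) := by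
    have e : ∫ y in S \ U, G y ∂μ = ∫ y in L \ U, G y ∂μ := by
      refine setIntegral_eq_of_subset_of_forall_sdiff_eq_zero (hS.diff hUm)
        (sdiff_subset_sdiff_left hLS) fun y hy => hG0 y ⟨hy.1.1, fun h => hy.2 ⟨h, hy.1.2⟩⟩
    have hsmall : Real.exp (-(δ / (2 * t))) ≤
        (2 / δ) ^ (d + 1) * (d + 1).factorial * (t * √t ^ d) := by
      have h := Real.pow_div_factorial_le_exp (δ / (2 * t)) (by positivity) (d + 1)
      have h' : t ≤ √t := by
        refine Real.le_sqrt_of_sq_le ?_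
        nlinarith [ht.2]
      rw [Real.exp_neg]
      calc _ ≤ ((δ / (2 * t)) ^ (d + 1) / (d + 1).factorial)⁻¹ := by gcongr
        _ = (2 / δ) ^ (d + 1) * (d + 1).factorial * (t * t ^ d) := by
          rw [inv_div, div_pow, div_pow, mul_pow]; field_simp; ring
        _ ≤ _ := by gcongr
    rw [e]
    have hfin : μ (L \ U) < ⊤ := (measure_mono sdiff_subset).trans_lt hL.measure_lt_top
    refine (norm_setIntegral_le_of_norm_le_const hfin
      (C := (2 / δ) ^ (d + 1) * (d + 1).factorial * (t * √t ^ d) * |H|) fun y hy => ?_).trans ?_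
    · have hy' : y ∈ L' := ⟨hy.1, fun h => hy.2 <| by
        obtain ⟨z, hz, hyz⟩ := mem_iUnion₂.mp h
        exact mem_biUnion hz (Metric.ball_subset_closedBall hyz)⟩
      rw [hG, norm_smul, Real.norm_of_nonneg (Real.exp_pos _).le]
      refine mul_le_mul (le_trans ?_ hsmall) ((hH y hy.1).trans (le_abs_self H)) (norm_nonneg _)
        (by positivity)
      gcongr
      exact hφδ y hy'
    · have : μ.real (L \ U) ≤ μ.real L :=
        measureReal_mono sdiff_subset hL.measure_lt_top.ne
      calc _ ≤ (2 / δ) ^ (d + 1) * (d + 1).factorial * (t * √t ^ d) * |H| * μ.real L := by gcongr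
        _ = _ := by ring
  have e : (∫ y in S, G y ∂μ) - ∑ z ∈ Z, I z t =
      ∑ z ∈ Z, ((∫ y in Metric.closedBall z r, G y ∂μ) - I z t) + ∫ y in S \ U, G y ∂μ := by
    rw [hsplit, Finset.sum_sub_distrib]; abel
  rw [e]
  refine (norm_add_le _ _).trans ?_
  rw [add_mul, Finset.sum_mul]
  exact add_le_add ((norm_sum_le _ _).trans (Finset.sum_le_sum fun z hz => hA z hz t ht0)) htail

end Laplace

/-! ### The linearization at a zero -/

/-- An endomorphism which is skew-adjoint for a Hermitian inner product has a unitary basis of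
eigenvectors, with imaginary eigenvalues. The inner product is given by its real part `G`. -/
theorem exists_unitary_eigenbasis {W : Type*} [AddCommGroup W] [Module ℂ W] [Module ℝ W]
    [IsScalarTower ℝ ℂ W] [FiniteDimensional ℂ W] (G : W →ₗ[ℝ] W →ₗ[ℝ] ℝ)
    (hsymm : ∀ u v, G u v = G v u) (hpos : ∀ u, u ≠ 0 → 0 < G u u)
    (hI : ∀ u v, G (Complex.I • u) (Complex.I • v) = G u v) (A : W →ₗ[ℂ] W)
    (hA : ∀ u v, G (A u) v = -G u (A v)) {n : ℕ} (hn : Module.finrank ℂ W = n) :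
    ∃ (b : Module.Basis (Fin n) ℂ W) (a : Fin n → ℝ),
      (∀ j, A (b j) = a j • Complex.I • b j) ∧ (∀ j k, G (b j) (b k) = if j = k then 1 else 0) ∧
      ∀ j k, G (Complex.I • b j) (b k) = 0 := by
  have hII (u : W) : Complex.I • Complex.I • u = -u := by
    rw [smul_smul, Complex.I_mul_I, neg_one_smul]
  have hskew (u v : W) : G (Complex.I • u) v = -G u (Complex.I • v) := by
    rw [← hI u, hII, map_neg, neg_neg]
  have hsmul (c : ℂ) (u : W) : c • u = c.re • u + c.im • Complex.I • u := by
    conv_lhs => rw [← Complex.re_add_im c, add_smul, mul_smul]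
    rw [← smul_one_smul ℂ c.re u, ← smul_one_smul ℂ c.im (Complex.I • u)]
    simp
  let core : InnerProductSpace.Core ℂ W :=
    { inner := fun u v => (G u v : ℂ) + Complex.I * (G (Complex.I • u) v : ℂ)
      conj_inner_symm := fun u v => by
        simp only [map_add, map_mul, Complex.conj_ofReal, Complex.conj_I]
        rw [hsymm v u, hskew v u, hsymm v]
        push_cast; ring
      re_inner_nonneg := fun u => by
        have : 0 ≤ G u u := by
          by_cases hu : u = 0
          · simp [hu]
          · exact (hpos u hu).le
        simpa using this
      add_left := fun u v w => by
        simp only [map_add, smul_add, LinearMap.add_apply]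
        push_cast; ring
      smul_left := fun u v c => by
        rw [hsmul c u]
        simp only [map_add, smul_add, LinearMap.add_apply, map_smul, LinearMap.smul_apply,
          smul_eq_mul]
        rw [smul_comm Complex.I c.re u, smul_comm Complex.I c.im (Complex.I • u), hII]
        simp only [map_smul, LinearMap.smul_apply, map_neg, LinearMap.neg_apply, smul_eq_mul]
        apply Complex.ext <;> simp
      definite := fun u h => by
        by_contra hu
        have := congrArg Complex.re h
        simp at this
        exact (hpos u hu).ne' this }
  let _ := core.toNormedAddCommGroup
  let _ : InnerProductSpace ℂ W := InnerProductSpace.ofCore core.toCore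
  have hinner (u v : W) : inner ℂ u v = (G u v : ℂ) + Complex.I * (G (Complex.I • u) v : ℂ) := rfl
  have hT : ((-Complex.I) • A).IsSymmetric := by
    intro u v
    simp only [LinearMap.smul_apply]
    rw [inner_smul_left, inner_smul_right, hinner, hinner, hA u v, ← map_smul, hA]
    simp
    ring
  refine ⟨(hT.eigenvectorBasis hn).toBasis, hT.eigenvalues hn, fun j => ?_, fun j k => ?_,
    fun j k => ?_⟩
  · have h := hT.apply_eigenvectorBasis hn j
    rw [OrthonormalBasis.coe_toBasis]
    have h' := congrArg (fun w => Complex.I • w) h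
    simp only [LinearMap.smul_apply, smul_smul, mul_neg, Complex.I_mul_I, neg_neg, one_smul] at h'
    rw [h', mul_comm, mul_smul, hsmul]
    simp
  · have h := (hT.eigenvectorBasis hn).inner_eq_ite j k
    rw [hinner] at h
    have := congrArg Complex.re h
    rw [OrthonormalBasis.coe_toBasis]
    split_ifs at this ⊢ <;> simpa using this
  · have h := (hT.eigenvectorBasis hn).inner_eq_ite j k
    rw [hinner] at h
    have := congrArg Complex.im h
    rw [OrthonormalBasis.coe_toBasis]
    split_ifs at this <;> simpa using this

theorem apply_smul_smul_of_unitary {W : Type*} [AddCommGroup W] [Module ℂ W] [Module ℝ W]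
    [IsScalarTower ℝ ℂ W] {G : W →ₗ[ℝ] W →ₗ[ℝ] ℝ}
    (hI : ∀ u v, G (Complex.I • u) (Complex.I • v) = G u v) {n : ℕ} {b : Fin n → W}
    (hb : ∀ j k, G (b j) (b k) = if j = k then 1 else 0)
    (hb' : ∀ j k, G (Complex.I • b j) (b k) = 0) (z z' : ℂ) (j k : Fin n) :
    G (z • b j) (z' • b k) = if j = k then z.re * z'.re + z.im * z'.im else 0 := by
  have hsmul (c : ℂ) (u : W) : c • u = c.re • u + c.im • Complex.I • u := by
    conv_lhs => rw [← Complex.re_add_im c, add_smul, mul_smul]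
    rw [← smul_one_smul ℂ c.re u, ← smul_one_smul ℂ c.im (Complex.I • u)]
    simp
  have h1 : G (b j) (Complex.I • b k) = 0 := by
    rw [← hI, smul_smul Complex.I Complex.I, Complex.I_mul_I, neg_one_smul, map_neg, hb', neg_zero]
  rw [hsmul z, hsmul z']
  simp only [map_add, map_smul, LinearMap.add_apply, LinearMap.smul_apply, smul_eq_mul, hI, hb,
    hb', h1]
  split_ifs <;> ring

/-- The derivative of `det (A + b)⁻¹` for a diagonalizable endomorphism. -/
theorem deriv_inv_det_add {W : Type*} [AddCommGroup W] [Module ℂ W] {n : ℕ}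
    (b : Module.Basis (Fin n) ℂ W) (A : W →ₗ[ℂ] W) (l : Fin n → ℂ) (hl : ∀ j, l j ≠ 0)
    (hA : ∀ j, A (b j) = l j • b j) :
    deriv (fun s : ℂ => (LinearMap.det (A + s • LinearMap.id))⁻¹) 0 =
      -(∑ j, ∏ k ∈ Finset.univ.erase j, l k) / (∏ j, l j) ^ 2 := by
  have hdet (s : ℂ) : LinearMap.det (A + s • LinearMap.id) = ∏ j, (l j + s) := by
    have : LinearMap.toMatrix b b (A + s • LinearMap.id) = Matrix.diagonal fun j => l j + s := by
      ext i j
      rw [LinearMap.toMatrix_apply, LinearMap.add_apply, hA, LinearMap.smul_apply,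
        LinearMap.id_apply, ← add_smul, map_smul, Finsupp.smul_apply, Module.Basis.repr_self,
        Matrix.diagonal_apply, smul_eq_mul, Finsupp.single_apply]
      by_cases h : j = i
      · subst h; simp
      · simp [h, Ne.symm h]
    rw [← LinearMap.det_toMatrix b, this, Matrix.det_diagonal]
  simp only [hdet]
  have h : HasDerivAt (fun s : ℂ => ∏ j, (l j + s))
      (∑ j, (∏ k ∈ Finset.univ.erase j, (l k + 0)) • (1 : ℂ)) 0 :=
    HasDerivAt.fun_finsetProd fun j _ => (hasDerivAt_id (0 : ℂ)).const_add (l j)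
  have h' := h.fun_inv (by simpa [Finset.prod_eq_zero_iff] using hl)
  rw [h'.deriv]
  simp

section RealBasis

variable {E : Type*} [NormedAddCommGroup E] [NormedSpace ℂ E]

/-- The real basis `b_1, i b_1, b_2, i b_2, …` attached to a complex basis. -/
def realify {n : ℕ} (b : Module.Basis (Fin n) ℂ E) : Module.Basis (Fin (n * 2)) ℝ E :=
  (Complex.basisOneI.smulTower' b).reindex finProdFinEquiv

theorem realify_apply {n : ℕ} (b : Module.Basis (Fin n) ℂ E) (i : Fin n × Fin 2) :
    realify b (finProdFinEquiv i) = Complex.basisOneI i.2 • b i.1 := by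
  rw [realify, Module.Basis.reindex_apply, Equiv.symm_apply_apply, Module.Basis.smulTower'_apply]

variable [FiniteDimensional ℂ E] [MeasurableSpace E] [BorelSpace E]

/-- The product of the coefficient of a top degree form and Lebesgue measure does not depend on the
complex basis, because complex linear maps preserve the orientation. -/
theorem smul_integral_addHaar_realify {n : ℕ} (b b' : Module.Basis (Fin n) ℂ E)
    (F : E [⋀^Fin (n * 2)]→L[ℝ] ℂ) (f : E → ℝ) :
    (∫ z, f z ∂(realify b).addHaar) • F (realify b) =
      (∫ z, f z ∂(realify b').addHaar) • F (realify b') := by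
  have : FiniteDimensional ℝ E := FiniteDimensional.complexToReal E
  set e : E ≃ₗ[ℂ] E := b.equiv b' (Equiv.refl _)
  set f' : E ≃ₗ[ℝ] E := e.restrictScalars ℝ
  have hb : realify b' = (realify b).map f' := by
    apply Module.Basis.eq_of_apply_eq
    intro i
    obtain ⟨i, rfl⟩ := finProdFinEquiv.surjective i
    rw [Module.Basis.map_apply, realify_apply, realify_apply]
    simp [f', e]
  have hdet : 0 < LinearMap.det (f' : E →ₗ[ℝ] E) := by
    have h : (f' : E →ₗ[ℝ] E) = (e : E →ₗ[ℂ] E).restrictScalars ℝ := rfl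
    rw [h, LinearMap.det_restrictScalars, Algebra.norm_complex_apply, Complex.normSq_pos]
    exact (LinearEquiv.isUnit_det' e).ne_zero
  have hF : F (realify b') = LinearMap.det (f' : E →ₗ[ℝ] E) • F (realify b) := by
    have key (ℓ : ℂ →ₗ[ℝ] ℝ) :
        ℓ (F (realify b')) = LinearMap.det (f' : E →ₗ[ℝ] E) * ℓ (F (realify b)) := by
      have h := AlternatingMap.eq_smul_basis_det (realify b)
        (ℓ.compAlternatingMap F.toAlternatingMap)
      have h' := congrArg (fun α : E [⋀^Fin (n * 2)]→ₗ[ℝ] ℝ => α (realify b')) h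
      have e1 : (realify b' : Fin (n * 2) → E) = (f' : E →ₗ[ℝ] E) ∘ realify b := by
        rw [hb]; rfl
      have e2 := Module.Basis.det_comp (realify b) (f' : E →ₗ[ℝ] E) (realify b)
      rw [Module.Basis.det_self, mul_one, ← e1] at e2
      rw [← e2]
      exact h'.trans (mul_comm _ _)
    apply Complex.ext
    · simpa using key Complex.reLm
    · simpa using key Complex.imLm
  have hm : (realify b').addHaar = ENNReal.ofReal |(LinearMap.det (f' : E →ₗ[ℝ] E))⁻¹| •
      (realify b).addHaar := by
    have h1 := Module.Basis.map_addHaar (realify b) f'.toContinuousLinearEquiv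
    have h2 := Measure.map_linearMap_addHaar_eq_smul_addHaar (realify b).addHaar hdet.ne'
    rw [← h2]
    rw [hb]
    exact h1.symm
  rw [hm, hF, integral_smul_measure, abs_of_pos (inv_pos.mpr hdet),
    ENNReal.toReal_ofReal (inv_pos.mpr hdet).le, smul_smul, smul_eq_mul]
  congr 1
  field_simp

/-- A Gaussian integral in coordinates with respect to a basis. -/
theorem integral_exp_neg_realify {n : ℕ} (b : Module.Basis (Fin n) ℂ E) (q : Fin n → ℝ)
    (hq : ∀ j, 0 < q j) :
    ∫ z, Real.exp (-(∑ j, q j * Complex.normSq (b.repr z j))) ∂(realify b).addHaar =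
      ∏ j, (Real.pi / q j) := by
  have : FiniteDimensional ℝ E := FiniteDimensional.complexToReal E
  have hm : (realify b).addHaar = Measure.map
      ((realify b).equivFun.symm.toContinuousLinearEquiv) (volume : Measure (Fin (n * 2) → ℝ)) := by
    have h := Module.Basis.map_addHaar (Pi.basisFun ℝ (Fin (n * 2)))
      ((realify b).equivFun.symm.toContinuousLinearEquiv)
    rw [Module.Basis.addHaar_def, Module.Basis.parallelepiped_basisFun,
      addHaarMeasure_eq_volume_pi] at h
    rw [h]
    congr 1
    apply Module.Basis.eq_of_apply_eq
    intro i
    simp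
  rw [hm]
  have hme := (realify b).equivFun.symm.toContinuousLinearEquiv.toHomeomorph.measurableEmbedding
  erw [hme.integral_map]
  have hint (x : Fin (n * 2) → ℝ) :
      Real.exp (-(∑ j, q j * Complex.normSq (b.repr ((realify b).equivFun.symm x) j))) =
      ∏ i, Real.exp (-q (finProdFinEquiv.symm i).1 * x i ^ 2) := by
    have hc (j : Fin n) (s : Fin 2) :
        Complex.basisOneI.repr (b.repr ((realify b).equivFun.symm x) j) s =
          x (finProdFinEquiv (j, s)) := by
      have h := congrFun ((realify b).equivFun.apply_symm_apply x) (finProdFinEquiv (j, s))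
      rw [Module.Basis.equivFun_apply] at h
      rw [← h, realify, Module.Basis.repr_reindex_apply, Equiv.symm_apply_apply,
        Module.Basis.smulTower'_repr]
    rw [← Real.exp_sum, ← finProdFinEquiv.sum_comp, Fintype.sum_prod_type,
      ← Finset.sum_neg_distrib]
    congr 1
    refine Finset.sum_congr rfl fun j _ => ?_
    rw [Fin.sum_univ_two]
    have h0 := hc j 0
    have h1 := hc j 1
    simp only [Complex.coe_basisOneI_repr, Matrix.cons_val_zero, Matrix.cons_val_one] at h0 h1
    rw [Complex.normSq_apply, h0, h1]
    simp only [Equiv.symm_apply_apply]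
    ring
  have : ∀ x : Fin (n * 2) → ℝ, Real.exp (-(∑ j, q j * Complex.normSq
      (b.repr ((realify b).equivFun.symm.toContinuousLinearEquiv.toHomeomorph x) j))) =
      ∏ i, Real.exp (-q (finProdFinEquiv.symm i).1 * x i ^ 2) := hint
  simp only [this]
  rw [integral_fintype_prod_volume_eq_prod
    (f := fun (i : Fin (n * 2)) (y : ℝ) => Real.exp (-q (finProdFinEquiv.symm i).1 * y ^ 2))]
  simp only [integral_gaussian]
  rw [← finProdFinEquiv.prod_comp, Fintype.prod_prod_type]
  refine Finset.prod_congr rfl fun j _ => ?_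
  rw [Fin.prod_univ_two]
  simp only [Equiv.symm_apply_apply]
  exact Real.mul_self_sqrt (div_pos Real.pi_pos (hq j)).le

end RealBasis

/-! ### The contribution of a zero -/

/-- A positive definite bilinear form on a finite dimensional space is coercive. -/
theorem exists_coercive {V : Type*} [NormedAddCommGroup V] [NormedSpace ℝ V]
    [FiniteDimensional ℝ V] {B : V →L[ℝ] V →L[ℝ] ℝ} (hB : ∀ u, u ≠ 0 → 0 < B u u) :
    ∃ c > 0, ∀ u, c * ‖u‖ ^ 2 ≤ B u u := by
  have : ProperSpace V := FiniteDimensional.proper ℝ V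
  rcases (Metric.sphere (0 : V) 1).eq_empty_or_nonempty with h | h
  · refine ⟨1, one_pos, fun u => ?_⟩
    have hu : u = 0 := by
      by_contra hu
      have : ‖u‖⁻¹ • u ∈ Metric.sphere (0 : V) 1 := by
        simp [norm_smul, norm_ne_zero_iff.mpr hu]
      simp [h] at this
    simp [hu]
  · have hc : Continuous fun u => B u u := by fun_prop
    obtain ⟨v, hv, hmin⟩ := (isCompact_sphere (0 : V) 1).exists_isMinOn h hc.continuousOn
    have hv0 : v ≠ 0 := by
      rintro rfl
      simp at hv
    refine ⟨B v v, hB v hv0, fun u => ?_⟩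
    by_cases hu : u = 0
    · simp [hu]
    have hu' := norm_ne_zero_iff.mpr hu
    have : ‖u‖⁻¹ • u ∈ Metric.sphere (0 : V) 1 := by
      simp [norm_smul, hu']
    have h1 := hmin this
    simp only [mem_ofPred_eq, map_smul, smul_apply, smul_eq_mul] at h1
    calc B v v * ‖u‖ ^ 2 ≤ (‖u‖⁻¹ * (‖u‖⁻¹ * B u u)) * ‖u‖ ^ 2 := by gcongr
      _ = B u u := by field_simp

section Energy

variable {V : Type*} [NormedAddCommGroup V] [NormedSpace ℝ V]
  {G : V → V →L[ℝ] V →L[ℝ] ℝ} {X : V → V} {U : Set V}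

theorem contDiffOn_energy (hG : ContDiffOn ℝ ∞ G U) (hX : ContDiffOn ℝ ∞ X U) :
    ContDiffOn ℝ ∞ (fun y => G y (X y) (X y)) U := (hG.clm_apply hX).clm_apply hX

/-- The first derivative of the energy `G (X, X)`. -/
theorem fderiv_energy (hU : IsOpen U) (hG : ContDiffOn ℝ ∞ G U) (hX : ContDiffOn ℝ ∞ X U)
    (hsymm : ∀ y u v, G y u v = G y v u) {y : V} (hy : y ∈ U) (z : V) :
    fderiv ℝ (fun y => G y (X y) (X y)) y z =
      (fderiv ℝ G y z (X y) + (2 : ℝ) • G y (fderiv ℝ X y z)) (X y) := by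
  have hGd : HasFDerivAt G (fderiv ℝ G y) y :=
    ((hG.contDiffAt (hU.mem_nhds hy)).differentiableAt (by simp)).hasFDerivAt
  have hXd : HasFDerivAt X (fderiv ℝ X y) y :=
    ((hX.contDiffAt (hU.mem_nhds hy)).differentiableAt (by simp)).hasFDerivAt
  rw [((hGd.clm_apply hXd).clm_apply hXd).fderiv]
  simp only [add_apply, ContinuousLinearMap.comp_apply, ContinuousLinearMap.flip_apply, smul_apply,
    smul_eq_mul]
  rw [hsymm y (X y)]
  ring

theorem fderiv_energy_at_zero (hU : IsOpen U) (hG : ContDiffOn ℝ ∞ G U) (hX : ContDiffOn ℝ ∞ X U)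
    (hsymm : ∀ y u v, G y u v = G y v u) {y : V} (hy : y ∈ U) (h0 : X y = 0) :
    fderiv ℝ (fun y => G y (X y) (X y)) y = 0 := by
  ext z
  rw [fderiv_energy hU hG hX hsymm hy, h0, map_zero]
  rfl

/-- The Hessian of the energy at a zero of `X` in terms of the linearization of `X`. -/
theorem fderiv_fderiv_energy_at_zero (hU : IsOpen U) (hG : ContDiffOn ℝ ∞ G U)
    (hX : ContDiffOn ℝ ∞ X U) (hsymm : ∀ y u v, G y u v = G y v u) {y : V} (hy : y ∈ U)
    (h0 : X y = 0) (z : V) :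
    (1 / 2 : ℝ) * fderiv ℝ (fderiv ℝ (fun y => G y (X y) (X y))) y z z =
      G y (fderiv ℝ X y z) (fderiv ℝ X y z) := by
  have hUy := hU.mem_nhds hy
  have hφ : ContDiffAt ℝ ∞ (fun y => G y (X y) (X y)) y :=
    (contDiffOn_energy hG hX).contDiffAt hUy
  have hφd : DifferentiableAt ℝ (fderiv ℝ (fun y => G y (X y) (X y))) y :=
    (hφ.fderiv_right (m := 1) (by norm_cast)).differentiableAt (by simp)
  have e1 : fderiv ℝ (fderiv ℝ (fun y => G y (X y) (X y))) y z z =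
      fderiv ℝ (fun w => fderiv ℝ (fun y => G y (X y) (X y)) w z) y z := by
    have := hφd.hasFDerivAt.clm_apply (hasFDerivAt_const z y)
    rw [this.fderiv]
    simp
  have e2 : (fun w => fderiv ℝ (fun y => G y (X y) (X y)) w z) =ᶠ[𝓝 y] fun w =>
      (fderiv ℝ G w z (X w) + (2 : ℝ) • G w (fderiv ℝ X w z)) (X w) := by
    filter_upwards [hUy] with w hw
    exact fderiv_energy hU hG hX hsymm hw z
  have hXd : HasFDerivAt X (fderiv ℝ X y) y :=
    ((hX.contDiffAt hUy).differentiableAt (by simp)).hasFDerivAt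
  have hψ : DifferentiableAt ℝ
      (fun w => fderiv ℝ G w z (X w) + (2 : ℝ) • G w (fderiv ℝ X w z)) y := by
    have g1 : DifferentiableAt ℝ (fderiv ℝ G) y :=
      ((hG.contDiffAt hUy).fderiv_right (m := 1) (by norm_cast)).differentiableAt (by simp)
    have g2 : DifferentiableAt ℝ (fderiv ℝ X) y :=
      ((hX.contDiffAt hUy).fderiv_right (m := 1) (by norm_cast)).differentiableAt (by simp)
    have g3 : DifferentiableAt ℝ G y := (hG.contDiffAt hUy).differentiableAt (by simp)
    exact ((g1.clm_apply (differentiableAt_const z)).clm_apply hXd.differentiableAt).add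
      ((g3.clm_apply (g2.clm_apply (differentiableAt_const z))).const_smul (2 : ℝ))
  rw [e1, e2.fderiv_eq, (hψ.hasFDerivAt.clm_apply hXd).fderiv]
  simp [h0]

end Energy

section Zero

variable {E : Type*} [NormedAddCommGroup E] [NormedSpace ℂ E]
  {M : Type*} [TopologicalSpace M] [ChartedSpace E M] [IsManifold 𝓘(ℂ, E) ω M]

/-- The transformation law of the coordinates of a vector field. -/
theorem inChart_transition (X : VField E M) {c q : M} {y : E} (hy : y ∈ transitionDomain c q) :
    X.inChart q (transition c q y) = fderiv ℂ (transition c q) y (X.inChart c y) := by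
  have hy1 := (mem_transitionDomain.mp hy).1
  apply frame_injective (transition_mem_target hy)
  rw [frame_inChart X (transition_mem_target hy)]
  have h1 := frame_inChart X hy1
  have hr := mem_transitionDomain_of_eq (E := E) hy1 rfl
  have e := symm_transition hy
  have key : ∀ (p : M) (hp : (chartAt E q).symm (transition c q y) = p)
      (hr : y ∈ transitionDomain c p)
      (h1 : fderiv ℂ (transition c p) y (X.inChart c y) = X p),
      X ((chartAt E q).symm (transition c q y)) = frame q (transition c q y)
        (fderiv ℂ (transition c q) y (X.inChart c y)) := by
    rintro p rfl hr h1
    rw [frame_eq (transition_mem_target hy), ← h1, fderiv_transition_trans hy hr]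
    rfl
  refine key _ e hr ?_
  rw [← h1, frame_eq hy1]
  rfl

/-- The determinant defining the contribution of a zero may be computed in any chart. -/
theorem cTopInvDeriv_eq [FiniteDimensional ℂ E] {X : VField E M} (hX : X.IsHolomorphic) {c : M}
    {y : E} (hy : y ∈ (chartAt E c).target) (h0 : X.inChart c y = 0) :
    cTopInvDeriv X ((chartAt E c).symm y) =
      deriv (fun b : ℂ => (LinearMap.det
        ((fderiv ℂ (X.inChart c) y : E →ₗ[ℂ] E) + b • LinearMap.id))⁻¹) 0 := by
  set p := (chartAt E c).symm y with hp
  have hyp : y ∈ transitionDomain c p := mem_transitionDomain_of_eq hy hp.symm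
  have hty : transition c p y = chartAt E p p := rfl
  have hXp : DifferentiableAt ℂ (X.inChart p) (transition c p y) :=
    hX.differentiableAt (transition_mem_target hyp)
  have hXc : DifferentiableAt ℂ (X.inChart c) y := hX.differentiableAt hy
  -- differentiate the transformation law of vector fields at the zero
  have e1 : X.inChart p ∘ transition c p =ᶠ[𝓝 y]
      fun z => fderiv ℂ (transition c p) z (X.inChart c z) := by
    filter_upwards [(isOpen_transitionDomain c p).mem_nhds hyp] with z hz
    exact inChart_transition X hz
  have hτ' : DifferentiableAt ℂ (fderiv ℂ (transition c p)) y :=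
    ((contDiffAt_transition hyp).fderiv_right (m := 1) (by simp)).differentiableAt (by simp)
  have e2 := e1.fderiv_eq (𝕜 := ℂ)
  rw [fderiv_comp y hXp (differentiableAt_transition hyp),
    (hτ'.hasFDerivAt.clm_apply hXc.hasFDerivAt).fderiv, h0] at e2
  set T := fderiv ℂ (transition c p) y
  set T' := fderiv ℂ (transition p c) (transition c p y)
  have hT'T : T'.comp T = ContinuousLinearMap.id ℂ E := fderiv_transition_comp hyp
  have hTT' : T.comp T' = ContinuousLinearMap.id ℂ E := by
    have := fderiv_transition_comp (transition_mem hyp)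
    rwa [transition_transition hyp] at this
  let e : E ≃ₗ[ℂ] E := (ContinuousLinearEquiv.equivOfInverse T T'
    (fun x => DFunLike.congr_fun hT'T x) (fun x => DFunLike.congr_fun hTT' x)).toLinearEquiv
  have hconj (b : ℂ) : (momentAtZero X p : E →ₗ[ℂ] E) + b • LinearMap.id =
      e ∘ₗ ((fderiv ℂ (X.inChart c) y : E →ₗ[ℂ] E) + b • LinearMap.id) ∘ₗ e.symm := by
    ext v
    have h1 := DFunLike.congr_fun e2 (T' v)
    have h2 : T (T' v) = v := DFunLike.congr_fun hTT' v
    simp only [ContinuousLinearMap.comp_apply, h2] at h1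
    change momentAtZero X p v + b • v = T (fderiv ℂ (X.inChart c) y (T' v) + b • T' v)
    rw [map_add, map_smul, h2, momentAtZero, ← hty, h1]
    simp
  rw [cTopInvDeriv]
  simp only [hconj, LinearMap.det_conj]

end Zero

namespace HermitianMetric

open MForm

variable {E : Type*} [NormedAddCommGroup E] [NormedSpace ℂ E] [FiniteDimensional ℂ E]
  {M : Type*} [TopologicalSpace M] [ChartedSpace E M] [IsManifold 𝓘(ℂ, E) ω M]

theorem inner_eq_gram (g : HermitianMetric E M) (X : VField E M) {c : M} {y : E}
    (hy : y ∈ (chartAt E c).target) :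
    g.inner ((chartAt E c).symm y) (X ((chartAt E c).symm y)) (X ((chartAt E c).symm y)) =
      g.gram c y (X.inChart c y) (X.inChart c y) := by
  rw [← frame_inChart X hy]
  rfl

/-- The linearization of a Killing field at an isolated zero is injective. -/
theorem IsKilling.linearization_injective {g : HermitianMetric E M} {X : VField E M}
    (hXg : g.IsKilling X) (hX : X.Smooth) {c : M} {y : E} (hy : y ∈ (chartAt E c).target)
    (h0 : X.inChart c y = 0) (hiso : ∀ᶠ z in 𝓝[≠] y, X.inChart c z ≠ 0) {v : E}
    (hv : fderiv ℝ (X.inChart c) y v = 0) : v = 0 := by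
  by_contra hne
  exact killing_zero_not_isolated (chartAt E c).open_target (g.contDiffOn_gram c) (hX c)
    (g.gram_symm c) (fun y hy u hu => g.gram_pos hy hu) (fun y hy u v => hXg c y hy u v) hy h0 hne hv
    hiso

/-- Only the degree zero part of `η` contributes to the top degree part of the product with the
form of top degree `coeffForm g X m`. -/
theorem mul_coeffForm_apply (g : HermitianMetric E M) (X : VField E M) (η : MForm E M) (m : ℕ)
    (p : M) (v : Fin ((m + 1) * 2) → TangentSpace 𝓘(ℝ, E) p) :
    (η.mul (g.coeffForm X m)) ((m + 1) * 2) p v =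
      η.fn p * ((2 * Real.pi : ℂ)⁻¹ * (2 * Real.pi * Complex.I : ℂ)⁻¹ ^ m * (m.factorial : ℂ)⁻¹ *
        g.kahler.mul ((ofDegree 2 (g.beta X)).pow m) ((m + 1) * 2) p v) := by
  have hz (k : ℕ) (hk : k ≠ (m + 1) * 2) : g.coeffForm X m k p = 0 := by
    have h4 : g.kahler.mul ((ofDegree 2 (g.beta X)).pow m) k p = 0 := by
      rcases lt_or_ge k 2 with hk2 | hk2
      · exact ofDegree_mul_of_lt hk2 _ _ _
      · obtain ⟨l, rfl⟩ := Nat.exists_eq_add_of_le hk2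
        rw [kahler, ofDegree_mul rfl, pow_ofDegree_two_of_ne _ (by omega)]
        exact wedge_zero_right _ _
    ext v
    change _ * g.kahler.mul ((ofDegree 2 (g.beta X)).pow m) k p v = 0
    rw [h4]
    simp
  rw [mul, Finset.sum_eq_single (0 : Fin ((m + 1) * 2 + 1))]
  · exact wedge_degree_zero _ _ _ v
  · intro k _ hk
    rw [hz _ ?_]
    · exact wedge_zero_right _ _
    · have : (k : ℕ) ≠ 0 := fun h => hk (Fin.ext h)
      have := k.isLt
      omega
  · simp

/-- The leading term of Laplace's method at a nondegenerate zero of `X`, for the term of highest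
order in `1 / t`. -/
theorem leading_term (g : HermitianMetric E M) [MeasurableSpace E] [BorelSpace E] {X : VField E M}
    (hX : X.IsHolomorphic) (hXg : g.IsKilling X) {c : M} {y : E} (hy : y ∈ (chartAt E c).target)
    (h0 : X.inChart c y = 0) (hinj : ∀ v, fderiv ℝ (X.inChart c) y v = 0 → v = 0) {n m : ℕ}
    (hn : n = m + 1) (b₀ : Module.Basis (Fin n) ℂ E) (η : MForm E M) {t : ℝ} (ht : 0 < t) :
    ((t : ℂ)⁻¹ ^ (m + 1)) * ((∫ z, Real.exp (-(g.gram c y (fderiv ℝ (X.inChart c) y z)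
        (fderiv ℝ (X.inChart c) y z) / (2 * t))) ∂(realify b₀).addHaar) •
      ((η.mul (g.coeffForm X m)) (n * 2)).inChart c y (realify b₀)) =
    η.fn ((chartAt E c).symm y) * cTopInvDeriv X ((chartAt E c).symm y) := by
  subst hn
  rw [cTopInvDeriv_eq hX hy h0]
  set A := fderiv ℂ (X.inChart c) y with hA
  have hAr (v : E) : fderiv ℝ (X.inChart c) y v = A v := by
    rw [(hX.differentiableAt hy).fderiv_restrictScalars ℝ]; rfl
  simp only [hAr] at hinj ⊢
  set G : E →ₗ[ℝ] E →ₗ[ℝ] ℝ := (g.gram c y).toLinearMap₁₂ with hG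
  have hGg (u v : E) : G u v = g.gram c y u v := rfl
  obtain ⟨b, a, hAb, hb, hb'⟩ := exists_unitary_eigenbasis G (g.gram_symm c y)
    (fun u hu => g.gram_pos hy hu) (g.gram_I_smul hy) (A : E →ₗ[ℂ] E)
    (fun u v => by
      have := hXg.skew hy h0 u v
      rwa [hAr, hAr] at this)
    (n := m + 1) ((Module.finrank_eq_card_basis b₀).trans (Fintype.card_fin _))
  have hAz (z : ℂ) (j : Fin (m + 1)) : A (z • b j) = (z * (a j * Complex.I)) • b j := by
    rw [map_smul, SemigroupAction.mul_smul]
    congr 1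
    exact (hAb j).trans (by rw [SemigroupAction.mul_smul]; rfl)
  have hGz := apply_smul_smul_of_unitary (G := G) (g.gram_I_smul hy) hb hb'
  have ha (j : Fin (m + 1)) : a j ≠ 0 := fun h => by
    have h1 := hAz 1 j
    rw [h] at h1
    exact b.ne_zero j (hinj (b j) (by simpa using h1))
  -- the values of the forms on the basis
  have hω (z z' : ℂ) (j k : Fin (m + 1)) : g.kahlerForm.inChart c y ![z • b j, z' • b k] =
      (G ((Complex.I * z) • b j) (z' • b k) : ℝ) := by
    rw [SemigroupAction.mul_smul, hGg, gram_apply, inChart, frame_I_smul hy]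
    rfl
  have hβ (z z' : ℂ) (j k : Fin (m + 1)) : (g.beta X).inChart c y ![z • b j, z' • b k] =
      (G ((z * (a j * Complex.I)) • b j) (z' • b k) : ℝ) := by
    rw [g.inChart_beta hX hXg hy h0, hAr]
    simp only [Matrix.cons_val_zero, Matrix.cons_val_one]
    rw [hAz]
    rfl
  have hval : ((η.mul (g.coeffForm X m)) ((m + 1) * 2)).inChart c y (realify b) =
      η.fn ((chartAt E c).symm y) * ((2 * Real.pi : ℂ)⁻¹ * (2 * Real.pi * Complex.I : ℂ)⁻¹ ^ m *
        ∑ j : Fin (m + 1), ∏ k : Fin m, (a (j.succAbove k) : ℂ)) := by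
    set w : Fin (m + 1) × Fin 2 → E := fun i => Complex.basisOneI i.2 • b i.1 with hw
    have hpair (α : DForm E M 2) (u : Fin 2 → Fin (m + 1) × Fin 2) :
        α ((chartAt E c).symm y) (fun i => frame c y (w (u i))) =
          α.inChart c y ![Complex.basisOneI (u 0).2 • b (u 0).1,
            Complex.basisOneI (u 1).2 • b (u 1).1] := by
      change _ = α ((chartAt E c).symm y) (fun i => frame c y _)
      congr 1
      funext i
      fin_cases i <;> rfl
    have hreal : (fun i => frame c y (realify b i)) =
        fun i => (fun i => frame c y (w i))
          ((finProdFinEquiv.trans (finCongr (rfl : (m + 1) * 2 = (m + 1) * 2))).symm i) := by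
      funext i
      obtain ⟨i, rfl⟩ := finProdFinEquiv.surjective i
      rw [realify_apply]
      change _ = frame c y (w (finProdFinEquiv.symm (finProdFinEquiv i)))
      rw [Equiv.symm_apply_apply]
    change (η.mul (g.coeffForm X m)) ((m + 1) * 2) ((chartAt E c).symm y)
      (fun i => frame c y (realify b i)) = _
    rw [mul_coeffForm_apply, hreal, kahler,
      two_mul_pow_pairs g.kahlerForm (g.beta X) rfl (fun i => frame c y (w i))]
    · have h1 (j : Fin (m + 1)) : g.kahlerForm ((chartAt E c).symm y)
          (fun s => frame c y (w (j, s))) = 1 := by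
        rw [hpair _ (fun s => (j, s)), hω, hGz]
        simp
      have h2 (j : Fin (m + 1)) : g.beta X ((chartAt E c).symm y)
          (fun s => frame c y (w (j, s))) = a j := by
        rw [hpair _ (fun s => (j, s)), hβ, hGz]
        simp
      simp only [h1, h2, one_mul]
      have : (m.factorial : ℂ) ≠ 0 := by exact_mod_cast m.factorial_ne_zero
      field_simp
    · intro u hu
      rw [hpair, hω, hGz, if_neg hu, Complex.ofReal_zero]
    · intro u hu
      rw [hpair, hβ, hGz, if_neg hu, Complex.ofReal_zero]
  have hQ (z : E) : g.gram c y (A z) (A z) / (2 * t) =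
      ∑ j, (a j ^ 2 / (2 * t)) * Complex.normSq (b.repr z j) := by
    have hz : A z = ∑ j, (b.repr z j * (a j * Complex.I)) • b j := by
      conv_lhs => rw [← b.sum_repr z]
      rw [map_sum]
      exact Finset.sum_congr rfl fun j _ => hAz _ j
    rw [← hGg, hz, map_sum]
    simp only [LinearMap.sum_apply, map_sum, hGz]
    rw [Finset.sum_div]
    refine Finset.sum_congr rfl fun j _ => ?_
    rw [Complex.normSq_apply]
    simp
    ring
  have hI : ∫ z, Real.exp (-(g.gram c y (A z) (A z) / (2 * t))) ∂(realify b).addHaar =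
      (2 * Real.pi * t) ^ (m + 1) / (∏ j, a j) ^ 2 := by
    simp only [hQ]
    rw [integral_exp_neg_realify b _ fun j => by have := ha j; positivity, ← Finset.prod_pow]
    have : (2 * Real.pi * t) ^ (m + 1) = ∏ _j : Fin (m + 1), (2 * Real.pi * t) := by simp
    rw [this, ← Finset.prod_div_distrib]
    refine Finset.prod_congr rfl fun j _ => ?_
    have := ha j
    field_simp
  rw [smul_integral_addHaar_realify b₀ b, hval, hI, Complex.real_smul,
    deriv_inv_det_add b (A : E →ₗ[ℂ] E) (fun j => a j * Complex.I)
      (fun j => mul_ne_zero (by exact_mod_cast ha j) Complex.I_ne_zero)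
      (fun j => by simpa using hAz 1 j)]
  have herase (j : Fin (m + 1)) : ∏ k ∈ Finset.univ.erase j, ((a k : ℂ) * Complex.I) =
      Complex.I ^ m * ∏ k : Fin m, (a (j.succAbove k) : ℂ) := by
    have h1 := Finset.mul_prod_erase Finset.univ (fun k => (a k : ℂ) * Complex.I)
      (Finset.mem_univ j)
    rw [Fin.prod_univ_succAbove _ j] at h1
    have h2 := mul_left_cancel₀ (mul_ne_zero (by exact_mod_cast ha j) Complex.I_ne_zero) h1
    rw [h2, Finset.prod_mul_distrib, Finset.prod_const, Finset.card_univ, Fintype.card_fin, mul_comm]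
  simp only [herase, ← Finset.mul_sum]
  rw [Finset.prod_mul_distrib, Finset.prod_const, Finset.card_univ, Fintype.card_fin]
  set S := ∑ j : Fin (m + 1), ∏ k : Fin m, (a (j.succAbove k) : ℂ)
  have hP : (∏ j, (a j : ℂ)) ≠ 0 := Finset.prod_ne_zero_iff.mpr fun j _ => by exact_mod_cast ha j
  have ht' : (t : ℂ) ≠ 0 := by exact_mod_cast ht.ne'
  have hpi : (Real.pi : ℂ) ≠ 0 := by exact_mod_cast Real.pi_ne_zero
  have hI2 : (Complex.I ^ (m + 1)) ^ 2 = -Complex.I ^ m * Complex.I ^ m := by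
    rw [← pow_mul, neg_mul, ← pow_add, show (m + 1) * 2 = m + m + 2 by ring, pow_add, Complex.I_sq]
    ring
  rw [mul_pow _ (Complex.I ^ (m + 1)), hI2]
  push_cast
  have hIm : Complex.I ^ m ≠ 0 := pow_ne_zero _ Complex.I_ne_zero
  simp only [mul_pow, mul_inv, inv_pow, pow_succ]
  field_simp

end HermitianMetric

/-! ### Localization of the integral -/

section Localization

variable {E : Type*} [NormedAddCommGroup E] [NormedSpace ℂ E] [FiniteDimensional ℂ E]
  {M : Type*} [TopologicalSpace M] [ChartedSpace E M]

/-- The part of `K` lying in the domain of the chart around `c`, in coordinates. -/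
def chartPart (E : Type*) [NormedAddCommGroup E] [ChartedSpace E M] (K : Set M) (c : M) : Set E :=
  (chartAt E c).target ∩ (chartAt E c).symm ⁻¹' K

/-- The part of `K` in the closed support of `r`, in the coordinates of the chart around `c`. -/
def chartSupport (E : Type*) [NormedAddCommGroup E] [ChartedSpace E M] (K : Set M) (r : M → ℝ)
    (c : M) : Set E :=
  chartAt E c '' (tsupport r ∩ K)

variable {K : Set M} {r : M → ℝ} {c : M}

theorem measurableSet_chartPart [MeasurableSpace E] [BorelSpace E] (hK : IsClosed K) :
    MeasurableSet (chartPart E K c) := by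
  have h := (chartAt E c).continuousOn_symm.isOpen_inter_preimage (chartAt E c).open_target
    hK.isOpen_compl
  have e : chartPart E K c =
      (chartAt E c).target \ ((chartAt E c).target ∩ (chartAt E c).symm ⁻¹' Kᶜ) := by
    ext y
    simp [chartPart]
  rw [e]
  exact (chartAt E c).open_target.measurableSet.diff h.measurableSet

theorem isCompact_chartSupport (hK : IsCompact K) (hr : tsupport r ⊆ (chartAt E c).source) :
    IsCompact (chartSupport E K r c) :=
  (hK.inter_left (isClosed_tsupport r)).image_of_continuousOn
    ((chartAt E c).continuousOn.mono (inter_subset_left.trans hr))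

theorem chartSupport_subset (hr : tsupport r ⊆ (chartAt E c).source) :
    chartSupport E K r c ⊆ chartPart E K c := by
  rintro _ ⟨p, ⟨hp, hpK⟩, rfl⟩
  refine ⟨(chartAt E c).map_source (hr hp), ?_⟩
  rw [mem_preimage, (chartAt E c).left_inv (hr hp)]
  exact hpK

theorem eq_zero_of_notMem_chartSupport {y : E} (hy : y ∈ chartPart E K c \ chartSupport E K r c) :
    r ((chartAt E c).symm y) = 0 := by
  by_contra h
  exact hy.2 ⟨_, ⟨subset_tsupport r h, hy.1.2⟩, (chartAt E c).right_inv hy.1.1⟩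

theorem integrableOn_chartPart [MeasurableSpace E] [BorelSpace E] (μ : Measure E)
    [IsFiniteMeasureOnCompacts μ] [T2Space M] (hK : IsCompact K)
    (hr : tsupport r ⊆ (chartAt E c).source) {f : E → ℂ}
    (hf : ContinuousOn f (chartAt E c).target)
    (hf0 : ∀ y, r ((chartAt E c).symm y) = 0 → f y = 0) : IntegrableOn f (chartPart E K c) μ :=
  ((hf.mono ((chartSupport_subset hr).trans inter_subset_left)).integrableOn_compact
    (isCompact_chartSupport hK hr)).of_forall_sdiff_eq_zero (measurableSet_chartPart hK.isClosed)
    fun _ hy => hf0 _ (eq_zero_of_notMem_chartSupport hy)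

theorem contDiffOn_comp_chart_symm [IsManifold 𝓘(ℂ, E) ω M]
    (hr : ContMDiff 𝓘(ℝ, E) 𝓘(ℝ) ∞ r) (c : M) :
    ContDiffOn ℝ ∞ (fun y => r ((chartAt E c).symm y)) (chartAt E c).target := by
  have : IsManifold 𝓘(ℝ, E) ∞ M := isManifold_real ∞
  have h1 : ContMDiffOn 𝓘(ℝ, E) 𝓘(ℝ, E) ∞ (chartAt E c).symm (chartAt E c).target :=
    contMDiffOn_chart_symm
  exact contMDiffOn_iff_contDiffOn.mp (hr.comp_contMDiffOn h1)

theorem eventually_ne_zero_inChart [IsManifold 𝓘(ℂ, E) ω M] {X : VField E M} {y : E}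
    (hy : y ∈ (chartAt E c).target)
    (hiso : ∀ᶠ q in 𝓝[≠] ((chartAt E c).symm y), X q ≠ 0) :
    ∀ᶠ z in 𝓝[≠] y, X.inChart c z ≠ 0 := by
  have h1 : ∀ᶠ z in 𝓝[≠] y, z ∈ (chartAt E c).target :=
    nhdsWithin_le_nhds ((chartAt E c).open_target.mem_nhds hy)
  have h2 : Tendsto (chartAt E c).symm (𝓝[≠] y) (𝓝[≠] ((chartAt E c).symm y)) := by
    refine tendsto_nhdsWithin_iff.mpr ⟨?_, ?_⟩
    · exact ((chartAt E c).continuousAt_symm hy).tendsto.mono_left nhdsWithin_le_nhds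
    · filter_upwards [h1, self_mem_nhdsWithin] with z hz hne h
      exact hne ((chartAt E c).symm.injOn hz hy h)
  filter_upwards [h1, h2.eventually hiso] with z hz hz'
  rwa [Ne, inChart_eq_zero_iff X hz]

/-- Isolated zeros in a compact set are finite in number. -/
theorem finite_zeros [IsManifold 𝓘(ℂ, E) ω M] {X : VField E M} (hX : X.Smooth) (hK : IsCompact K)
    (hiso : ∀ p ∈ K, X p = 0 → ∀ᶠ q in 𝓝[≠] p, X q ≠ 0) : {p | p ∈ K ∧ X p = 0}.Finite := by
  have h : ∀ p ∈ K, ∃ U ∈ 𝓝 p, ∀ q ∈ U, X q = 0 → q = p := by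
    intro p hp
    by_cases h0 : X p = 0
    · obtain ⟨U, hU, hU'⟩ := (eventually_nhdsWithin_iff.mp (hiso p hp h0)).exists_mem
      exact ⟨U, hU, fun q hq hq0 => by_contra fun hne => hU' q hq hne hq0⟩
    · have hs := mem_chart_source E p
      have ht := mem_chart_target E p
      have h1 : X.inChart p (chartAt E p p) ≠ 0 := by
        rw [Ne, inChart_eq_zero_iff X ht, (chartAt E p).left_inv hs]
        exact h0
      have h2 : ContinuousAt (fun q => X.inChart p (chartAt E p q)) p :=
        ContinuousAt.comp (f := chartAt E p) (g := X.inChart p)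
          ((hX p).continuousOn.continuousAt ((chartAt E p).open_target.mem_nhds ht))
          ((chartAt E p).continuousAt hs)
      refine ⟨_, (h2.eventually_ne h1).and ((chartAt E p).open_source.mem_nhds hs), ?_⟩
      rintro q ⟨hq, hqs⟩ hq0
      refine absurd ?_ hq
      rw [inChart_eq_zero_iff X ((chartAt E p).map_source hqs), (chartAt E p).left_inv hqs]
      exact hq0
  choose! U hU hU' using h
  obtain ⟨T, hT, hKT⟩ := hK.elim_nhds_subcover U hU
  refine T.finite_toSet.subset fun q ⟨hq, hq0⟩ => ?_
  obtain ⟨p, hp, hqp⟩ := mem_iUnion₂.mp (hKT hq)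
  rw [hU' p (hT p hp) q hqp hq0]
  exact hp

end Localization

namespace HermitianMetric

open MForm

variable {E : Type*} [NormedAddCommGroup E] [NormedSpace ℂ E] [FiniteDimensional ℂ E]
  [MeasurableSpace E] [BorelSpace E]
  {M : Type*} [TopologicalSpace M] [T2Space M] [ChartedSpace E M] [IsManifold 𝓘(ℂ, E) ω M]

set_option maxHeartbeats 1000000 in
/-- The contributions to the integral coming from one chart and one power of `1 / t`: only the
term of highest order contributes to the limit. -/
theorem exists_chart_bound (g : HermitianMetric E M) {X : VField E M} (hX : X.IsHolomorphic)
    (hXg : g.IsKilling X) {K : Set M} (hK : IsCompact K) (hXK : ∀ p ∈ frontier K, X p ≠ 0)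
    (hiso : ∀ p ∈ K, X p = 0 → ∀ᶠ q in 𝓝[≠] p, X q ≠ 0) {r : M → ℝ}
    (hr : ContMDiff 𝓘(ℝ, E) 𝓘(ℝ) ∞ r) {c : M} (hrc : tsupport r ⊆ (chartAt E c).source)
    {η : MForm E M} (hη : η.Smooth) {P : Finset M} (hP : ∀ p, p ∈ P ↔ p ∈ K ∧ X p = 0) {n : ℕ}
    (b : Module.Basis (Fin n) ℂ E) {m : ℕ} (hm : m < n) :
    ∃ A : ℝ, ∀ t ∈ Ioc (0 : ℝ) 1,
      ‖(t : ℂ)⁻¹ ^ (m + 1) * (∫ y in chartPart E K c,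
          Real.exp (-(g.gram c y (X.inChart c y) (X.inChart c y) / (2 * t))) •
            ((r ((chartAt E c).symm y) : ℂ) *
              ((η.mul (g.coeffForm X m)) (n * 2)).inChart c y (realify b)) ∂(realify b).addHaar) -
        (if m + 1 = n then ∑ p ∈ P, (r p : ℂ) * (η.fn p * cTopInvDeriv X p) else 0)‖ ≤ A * t := by
  classical
  set μ := (realify b).addHaar
  set φ : E → ℝ := fun y => g.gram c y (X.inChart c y) (X.inChart c y) with hφ
  set F : E → ℂ := fun y => ((η.mul (g.coeffForm X m)) (n * 2)).inChart c y (realify b) with hF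
  set f : E → ℂ := fun y => (r ((chartAt E c).symm y) : ℂ) * F y with hf
  have hXs := hX.smooth
  have hTo := (chartAt E c).open_target
  have hφs : ContDiffOn ℝ ∞ φ (chartAt E c).target :=
    contDiffOn_energy (g.contDiffOn_gram c) (hXs c)
  have hFs : ContDiffOn ℝ ∞ F (chartAt E c).target :=
    DForm.smooth_iff.mp (hη.mul (g.smooth_coeffForm hXs m) (n * 2)) c _
  have hfs : ContDiffOn ℝ ∞ f (chartAt E c).target :=
    (Complex.ofRealCLM.contDiff.comp_contDiffOn (contDiffOn_comp_chart_symm hr c)).mul hFs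
  have hLS := chartSupport_subset (K := K) hrc
  have hLT := hLS.trans inter_subset_left
  set P' := P.filter (· ∈ tsupport r) with hP'
  set Z := P'.image (chartAt E c) with hZ
  have hPs {p : M} (hp : p ∈ P') : p ∈ (chartAt E c).source :=
    hrc (Finset.mem_filter.mp hp).2
  have hPz {p : M} (hp : p ∈ P') : p ∈ K ∧ X p = 0 := (hP p).mp (Finset.mem_filter.mp hp).1
  have hZt {z : E} (hz : z ∈ Z) : z ∈ (chartAt E c).target ∧ X.inChart c z = 0 ∧
      (chartAt E c).symm z ∈ K := by
    obtain ⟨p, hp, rfl⟩ := Finset.mem_image.mp hz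
    have ht := (chartAt E c).map_source (hPs hp)
    rw [inChart_eq_zero_iff X ht, (chartAt E c).left_inv (hPs hp)]
    exact ⟨ht, (hPz hp).2, (hPz hp).1⟩
  have hinj {z : E} (hz : z ∈ Z) (v : E) (hv : fderiv ℝ (X.inChart c) z v = 0) : v = 0 := by
    obtain ⟨ht, h0, hzK⟩ := hZt hz
    exact hXg.linearization_injective hXs ht h0 (eventually_ne_zero_inChart ht
      (hiso _ hzK ((inChart_eq_zero_iff X ht).mp h0))) hv
  set q : E → E → ℝ := fun z v => g.gram c z (fderiv ℝ (X.inChart c) z v)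
    (fderiv ℝ (X.inChart c) z v) with hq
  set J : E → ℝ → ℝ := fun z t => ∫ v, Real.exp (-(q z v / (2 * t))) ∂μ with hJ
  obtain ⟨A, hA⟩ := exists_laplace_bound μ (measurableSet_chartPart hK.isClosed)
    (isCompact_chartSupport hK hrc) hLS (hfs.continuousOn.mono hLT) (hφs.continuousOn.mono hLT)
    (fun y hy => by simp [hf, eq_zero_of_notMem_chartSupport hy])
    (fun y hy => by
      by_cases h : X.inChart c y = 0
      · simp [hφ, h]
      · exact (g.gram_pos (hLT hy) h).le) Z
    (fun y hy h0 => by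
      have h : X.inChart c y = 0 := by
        by_contra h
        exact (g.gram_pos (hLT hy) h).ne' h0
      obtain ⟨p, ⟨hp, hpK⟩, rfl⟩ := hy
      refine Finset.mem_image_of_mem _ (Finset.mem_filter.mpr ⟨(hP p).mpr ⟨hpK, ?_⟩, hp⟩)
      rwa [inChart_eq_zero_iff X ((chartAt E c).map_source (hrc hp)),
        (chartAt E c).left_inv (hrc hp)] at h)
    (fun z hz => by
      obtain ⟨ht, h0, hzK⟩ := hZt hz
      refine inter_mem (hTo.mem_nhds ht) (((chartAt E c).continuousAt_symm ht).preimage_mem_nhds ?_)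
      -- the zeros of `X` in `K` are interior points
      refine mem_interior_iff_mem_nhds.mp (by_contra fun h => ?_)
      exact hXK _ ⟨subset_closure hzK, h⟩ ((inChart_eq_zero_iff X ht).mp h0))
    (fun z t => J z t • f z)
    (fun z hz => by
      obtain ⟨ht, h0, -⟩ := hZt hz
      have hn := hTo.mem_nhds ht
      have hH (v : E) : (1 / 2 : ℝ) * fderiv ℝ (fderiv ℝ φ) z v v = q z v :=
        fderiv_fderiv_energy_at_zero hTo (g.contDiffOn_gram c) (hXs c) (g.gram_symm c) ht h0 v
      obtain ⟨k, hk, hcoer⟩ := exists_coercive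
        (B := (g.gram c z).bilinearComp (fderiv ℝ (X.inChart c) z) (fderiv ℝ (X.inChart c) z))
        fun u hu => g.gram_pos ht fun h => hu (hinj hz u h)
      have := eventually_exists_laplace_bound μ hk (hfs.contDiffAt hn) (hφs.contDiffAt hn)
        (by simp [hφ, h0]) (fderiv_energy_at_zero hTo (g.contDiffOn_gram c) (hXs c) (g.gram_symm c)
          ht h0) (fun v => by rw [hH]; exact hcoer v)
      simpa only [hH] using this)
  have hd (t : ℝ) (ht : 0 < t) : √t ^ Module.finrank ℝ E = t ^ n := by
    rw [finrank_real_of_complex, pow_mul, Real.sq_sqrt ht.le, Module.finrank_eq_card_basis b,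
      Fintype.card_fin]
  have hJt (z : E) (t : ℝ) (ht : 0 < t) : J z t = t ^ n * J z 1 := by
    have hs (s : ℝ) (v : E) : q z (s • v) / 2 = s ^ 2 * (q z v / 2) := by
      simp only [hq, map_smul, smul_apply, smul_eq_mul]
      ring
    have h := integral_exp_neg_div μ (q := fun v => q z v / 2) hs ht
    rw [hd t ht] at h
    simp only [div_div] at h
    simp only [hJ, mul_one]
    exact h
  -- the prefactor `t^{-(m+1)}` against the `t^n` of the Gaussian integrals leaves `t^k`, and `k = 0`
  -- only for the term of highest order
  obtain ⟨k, hk⟩ := Nat.exists_eq_add_of_lt hm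
  have hpow {t : ℝ} (ht : t ∈ Ioc (0 : ℝ) 1) : t⁻¹ ^ (m + 1) * t ^ n = t ^ k := by
    have := ht.1.ne'
    rw [hk, inv_pow, show m + k + 1 = (m + 1) + k by ring, pow_add t (m + 1) k,
      inv_mul_cancel_left₀ (pow_ne_zero _ this)]
  have hmain {t : ℝ} (ht : t ∈ Ioc (0 : ℝ) 1) :
      ‖(t : ℂ)⁻¹ ^ (m + 1) * ((∫ y in chartPart E K c, Real.exp (-(φ y / (2 * t))) • f y ∂μ) -
        ∑ z ∈ Z, J z t • f z)‖ ≤ |A| * t := by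
    have ht0 := ht.1
    rw [norm_mul, norm_pow, norm_inv, Complex.norm_real, Real.norm_of_nonneg ht.1.le]
    calc _ ≤ t⁻¹ ^ (m + 1) * (A * (t * √t ^ Module.finrank ℝ E)) := by gcongr; exact hA t ht
      _ = A * (t * (t⁻¹ ^ (m + 1) * t ^ n)) := by rw [hd t ht.1]; ring
      _ ≤ |A| * (t * 1) := by
        rw [hpow ht]
        have h1 : t ^ k ≤ 1 := pow_le_one₀ ht.1.le ht.2
        gcongr
        exact le_abs_self A
      _ = _ := by rw [mul_one]
  by_cases hmn : m + 1 = n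
  · refine ⟨|A|, fun t ht => ?_⟩
    have hlead : (t : ℂ)⁻¹ ^ (m + 1) * ∑ z ∈ Z, J z t • f z =
        ∑ p ∈ P, (r p : ℂ) * (η.fn p * cTopInvDeriv X p) := by
      have h1 : ∑ p ∈ P, (r p : ℂ) * (η.fn p * cTopInvDeriv X p) =
          ∑ p ∈ P', (r p : ℂ) * (η.fn p * cTopInvDeriv X p) := by
        refine (Finset.sum_filter_of_ne fun p _ hne => ?_).symm
        refine subset_tsupport r fun h => hne ?_
        rw [h, Complex.ofReal_zero, zero_mul]
      rw [h1, hZ, Finset.sum_image fun p hp p' hp' h =>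
        (chartAt E c).injOn (hPs hp) (hPs hp') h, Finset.mul_sum]
      refine Finset.sum_congr rfl fun p hp => ?_
      have hz : chartAt E c p ∈ Z := Finset.mem_image_of_mem _ hp
      obtain ⟨hzt, h0, -⟩ := hZt hz
      have := g.leading_term hX hXg hzt h0 (hinj hz) hmn.symm b η ht.1
      rw [(chartAt E c).left_inv (hPs hp)] at this
      rw [← this]
      simp only [hf, hF, (chartAt E c).left_inv (hPs hp), hJ, hq, Complex.real_smul]
      ring
    rw [if_pos hmn, ← hlead, ← mul_sub]
    exact hmain ht
  · have hk1 : 1 ≤ k := by omega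
    refine ⟨|A| + ∑ z ∈ Z, ‖J z 1 • f z‖, fun t ht => ?_⟩
    have hsmall : ‖(t : ℂ)⁻¹ ^ (m + 1) * ∑ z ∈ Z, J z t • f z‖ ≤ (∑ z ∈ Z, ‖J z 1 • f z‖) * t := by
      have e : (t : ℂ)⁻¹ ^ (m + 1) * ∑ z ∈ Z, J z t • f z =
          ((t ^ k : ℝ) : ℂ) * ∑ z ∈ Z, J z 1 • f z := by
        rw [← hpow ht, Finset.mul_sum, Finset.mul_sum]
        refine Finset.sum_congr rfl fun z _ => ?_
        rw [hJt z t ht.1, Complex.real_smul, Complex.real_smul]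
        push_cast
        ring
      rw [e, norm_mul, Complex.norm_real, Real.norm_of_nonneg (pow_nonneg ht.1.le k), mul_comm]
      have h1 : t ^ k ≤ t := pow_le_of_le_one ht.1.le ht.2 (by omega)
      have ht0 := ht.1
      gcongr
      exact norm_sum_le _ _
    rw [if_neg hmn, sub_zero, add_mul]
    have e : ∀ I s : ℂ, (t : ℂ)⁻¹ ^ (m + 1) * I =
      (t : ℂ)⁻¹ ^ (m + 1) * (I - s) + (t : ℂ)⁻¹ ^ (m + 1) * s := fun I s => by ring
    rw [e _ (∑ z ∈ Z, J z t • f z)]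
    exact (norm_add_le _ _).trans (add_le_add (hmain ht) hsmall)

end HermitianMetric

section Assembly

open MForm HermitianMetric

variable {E : Type*} [NormedAddCommGroup E] [NormedSpace ℂ E] [FiniteDimensional ℂ E]
  {M : Type*} [TopologicalSpace M] [ChartedSpace E M]

theorem cTopInvDeriv_eq_zero (h : Module.finrank ℂ E = 0) (X : VField E M) (p : M) :
    cTopInvDeriv X p = 0 := by
  simp [cTopInvDeriv, LinearMap.det_eq_one_of_finrank_eq_zero h]

variable [MeasurableSpace E] [BorelSpace E] [T2Space M] [IsManifold 𝓘(ℂ, E) ω M]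

/-- The contribution of one chart to the integral. -/
theorem exists_chart_integral_bound {g : HermitianMetric E M} (hg : g.IsKahler) {X : VField E M}
    (hX : X.IsHolomorphic)
    (hXg : g.IsKilling X) {K : Set M} (hK : IsCompact K) (hXK : ∀ p ∈ frontier K, X p ≠ 0)
    (hiso : ∀ p ∈ K, X p = 0 → ∀ᶠ q in 𝓝[≠] p, X q ≠ 0) {r : M → ℝ}
    (hr : ContMDiff 𝓘(ℝ, E) 𝓘(ℝ) ∞ r) {c : M} (hrc : tsupport r ⊆ (chartAt E c).source)
    {η : MForm E M} (hη : η.Smooth) {P : Finset M} (hP : ∀ p, p ∈ P ↔ p ∈ K ∧ X p = 0) :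
    ∃ A : ℝ, ∀ t ∈ Ioc (0 : ℝ) 1,
      ‖(∫ y in (chartAt E c).target ∩ (chartAt E c).symm ⁻¹' K,
        (r ((chartAt E c).symm y) : ℂ) *
          DForm.inChart ((η.mul (g.dForm X t)) (Module.finrank ℂ E * 2)) c y (realBasis E)
            ∂(realBasis E).addHaar) -
        ∑ p ∈ P, (r p : ℂ) * (η.fn p * cTopInvDeriv X p)‖ ≤ A * t := by
  set n := Module.finrank ℂ E with hn
  set f : ℕ → E → ℂ := fun m y => (r ((chartAt E c).symm y) : ℂ) *
    ((η.mul (g.coeffForm X m)) (n * 2)).inChart c y (realBasis E) with hf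
  set φ : E → ℝ := fun y => g.gram c y (X.inChart c y) (X.inChart c y) with hφ
  have hbound : ∀ m : ℕ, ∃ A : ℝ, m < n → ∀ t ∈ Ioc (0 : ℝ) 1,
      ‖(t : ℂ)⁻¹ ^ (m + 1) * (∫ y in chartPart E K c, Real.exp (-(φ y / (2 * t))) • f m y
          ∂(realBasis E).addHaar) -
        (if m + 1 = n then ∑ p ∈ P, (r p : ℂ) * (η.fn p * cTopInvDeriv X p) else 0)‖ ≤ A * t := by
    intro m
    by_cases hm : m < n
    · obtain ⟨A, hA⟩ := exists_chart_bound g hX hXg hK hXK hiso hr hrc hη hP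
        (Module.finBasis ℂ E) hm
      exact ⟨A, fun _ => hA⟩
    · exact ⟨0, fun h => absurd h hm⟩
  choose A hA using hbound
  refine ⟨∑ m ∈ Finset.range n, A m, fun t ht => ?_⟩
  have hφc : ContinuousOn φ (chartAt E c).target :=
    (contDiffOn_energy (g.contDiffOn_gram c) (hX.smooth c)).continuousOn
  have hfc (m : ℕ) : ContinuousOn (f m) (chartAt E c).target :=
    ((Complex.ofRealCLM.contDiff.comp_contDiffOn (contDiffOn_comp_chart_symm hr c)).mul
      (DForm.smooth_iff.mp (hη.mul (g.smooth_coeffForm hX.smooth m) (n * 2)) c _)).continuousOn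
  have hint (m : ℕ) : IntegrableOn (fun y => Real.exp (-(φ y / (2 * t))) • f m y)
      (chartPart E K c) (realBasis E).addHaar :=
    integrableOn_chartPart _ hK hrc
      ((Real.continuous_exp.comp_continuousOn (hφc.div_const _).neg).smul (hfc m))
      fun y hy => by simp [hf, hy]
  have hsplit : (∫ y in (chartAt E c).target ∩ (chartAt E c).symm ⁻¹' K,
        (r ((chartAt E c).symm y) : ℂ) *
          DForm.inChart ((η.mul (g.dForm X t)) (n * 2)) c y (realBasis E)
            ∂(realBasis E).addHaar) =
      ∑ m ∈ Finset.range n, (t : ℂ)⁻¹ ^ (m + 1) *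
        ∫ y in chartPart E K c, Real.exp (-(φ y / (2 * t))) • f m y ∂(realBasis E).addHaar := by
    simp only [← integral_const_mul]
    rw [← integral_finsetSum _ fun m _ => (hint m).const_mul _]
    refine setIntegral_congr_fun (measurableSet_chartPart hK.isClosed) fun y hy => ?_
    simp only [DForm.inChart]
    rw [mul_dForm_apply hg, inner_eq_gram g X hy.1, ← Complex.ofReal_neg, ← Complex.ofReal_exp]
    change _ * (_ * (∑ m ∈ Finset.range n, ((t : ℂ)⁻¹ ^ (m + 1)) •
      (η.mul (g.coeffForm X m)) (n * 2) ((chartAt E c).symm y))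
        fun i => frame c y (realBasis E i)) = _
    rw [ContinuousAlternatingMap.sum_apply, Finset.mul_sum, Finset.mul_sum]
    refine Finset.sum_congr rfl fun m _ => ?_
    rw [Complex.real_smul]
    change _ * (_ * (_ * (η.mul (g.coeffForm X m)) (n * 2) ((chartAt E c).symm y)
      fun i => frame c y (realBasis E i))) = _ * (_ * (_ *
        (η.mul (g.coeffForm X m)) (n * 2) ((chartAt E c).symm y)
          fun i => frame c y (realBasis E i)))
    ring
  have hvalue : ∑ p ∈ P, (r p : ℂ) * (η.fn p * cTopInvDeriv X p) = ∑ m ∈ Finset.range n,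
      if m + 1 = n then ∑ p ∈ P, (r p : ℂ) * (η.fn p * cTopInvDeriv X p) else 0 := by
    -- in dimension zero there are no terms, and the derivative of the determinant vanishes as well
    rcases Nat.eq_zero_or_pos n with h0 | hpos
    · rw [h0, Finset.sum_range_zero]
      exact Finset.sum_eq_zero fun p _ => by
        rw [cTopInvDeriv_eq_zero (hn.symm.trans h0), mul_zero, mul_zero]
    · rw [Finset.sum_eq_single (n - 1)]
      · rw [if_pos (by omega)]
      · intro m _ hm
        rw [if_neg (by omega)]
      · intro h
        exact absurd (Finset.mem_range.mpr (by omega)) h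
  rw [hsplit, hvalue, ← Finset.sum_sub_distrib, Finset.sum_mul]
  exact (norm_sum_le _ _).trans
    (Finset.sum_le_sum fun m hm => hA m (Finset.mem_range.mp hm) t ht)

end Assembly

end KahlerForms

end

theorem lemma5p4 {E : Type*} [NormedAddCommGroup E] [NormedSpace ℂ E] [FiniteDimensional ℂ E]
    [MeasurableSpace E] [BorelSpace E]
    {M : Type*} [TopologicalSpace M] [T2Space M] [SigmaCompactSpace M]
    [ChartedSpace E M] [IsManifold 𝓘(ℂ, E) ω M]
    (g : KahlerForms.HermitianMetric E M) (hg : g.IsKahler)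
    (X : KahlerForms.VField E M) (hX : X.IsHolomorphic) (hXg : g.IsKilling X)
    (K : Set M) (hK : IsCompact K) (hXK : ∀ p ∈ frontier K, X p ≠ 0)
    (hiso : ∀ p ∈ K, X p = 0 → ∀ᶠ q in 𝓝[≠] p, X q ≠ 0)
    (ρ : SmoothPartitionOfUnity M 𝓘(ℝ, E) M K)
    (hρ : ρ.IsSubordinate fun c => (chartAt E c).source)
    (η : KahlerForms.MForm E M) (hη : η.Smooth) :
    (fun t : ℝ => KahlerForms.integral ρ (η.mul (g.dForm X t))
        - ∑ᶠ p ∈ {p : M | p ∈ K ∧ X p = 0}, η.fn p * KahlerForms.cTopInvDeriv X p)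
      =O[𝓝[>] 0] fun t : ℝ => t := by
  classical
  have hfin := KahlerForms.finite_zeros hX.smooth hK hiso
  set P : Finset M := hfin.toFinset with hPdef
  have hP (p : M) : p ∈ P ↔ p ∈ K ∧ X p = 0 := by rw [hPdef, hfin.mem_toFinset]; rfl
  -- only finitely many charts matter on the compact set `K`
  have hC : {c : M | (Function.support (ρ c) ∩ K).Nonempty}.Finite :=
    ρ.locallyFinite.finite_nonempty_inter_compact hK
  set C : Finset M := hC.toFinset with hCdef
  have hCz {c : M} (hc : c ∉ C) {p : M} (hp : p ∈ K) : ρ c p = 0 := by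
    by_contra h
    exact hc (hC.mem_toFinset.mpr ⟨p, h, hp⟩)
  choose A hA using fun c : M => KahlerForms.exists_chart_integral_bound hg hX hXg hK hXK hiso
    (ρ c).contMDiff (hρ c) hη hP
  refine Asymptotics.IsBigO.of_bound (∑ c ∈ C, A c) ?_
  refine eventually_of_mem (Ioc_mem_nhdsGT (zero_lt_one (α := ℝ))) fun t ht => ?_
  have hint : KahlerForms.integral ρ (η.mul (g.dForm X t)) =
      ∑ c ∈ C, ∫ y in (chartAt E c).target ∩ (chartAt E c).symm ⁻¹' K,
        ((ρ c ((chartAt E c).symm y) : ℝ) : ℂ) * KahlerForms.DForm.inChart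
          ((η.mul (g.dForm X t)) (Module.finrank ℂ E * 2)) c y (KahlerForms.realBasis E)
            ∂(KahlerForms.realBasis E).addHaar := by
    refine finsum_eq_sum_of_support_subset _ fun c hc => ?_
    by_contra hcC
    refine hc (setIntegral_eq_zero_of_forall_eq_zero fun y hy => ?_)
    rw [hCz hcC hy.2, Complex.ofReal_zero, zero_mul]
  have hsum : ∑ᶠ p ∈ {p : M | p ∈ K ∧ X p = 0}, η.fn p * KahlerForms.cTopInvDeriv X p =
      ∑ c ∈ C, ∑ p ∈ P, ((ρ c p : ℝ) : ℂ) * (η.fn p * KahlerForms.cTopInvDeriv X p) := by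
    rw [finsum_mem_eq_finite_toFinset_sum _ hfin, Finset.sum_comm]
    refine Finset.sum_congr rfl fun p hp => ?_
    have hpK := ((hP p).mp hp).1
    have h1 : ∑ c ∈ C, ρ c p = 1 := by
      rw [← ρ.sum_eq_one hpK]
      refine (finsum_eq_sum_of_support_subset _ fun c hc => ?_).symm
      by_contra hcC
      exact hc (hCz hcC hpK)
    rw [← Finset.sum_mul, ← Complex.ofReal_sum, h1, Complex.ofReal_one, one_mul]
  rw [hint, hsum, ← Finset.sum_sub_distrib, Real.norm_of_nonneg ht.1.le, Finset.sum_mul]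
  exact (norm_sum_le _ _).trans (Finset.sum_le_sum fun c _ => hA c t ht)
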